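/- **Theorem 2.4.** Let $d\ge 1$, $-1\le \alpha<d-1$, and let $K\colon\mathbb R^d\to\mathbb R^d$ be differentiable on $\mathbb R^d\setminus\{0\}$ with $$\operatorname{div}K=0,\qquad |K(x)|+|x|\,|\nabla K(x)|\le \frac{C}{|x|^{\alpha}}\qquad (x\ne 0)$$ for some constant $C$. Let $C_1, M_\tau, M_\varphi$ be constants. Then there is a constant $C_2>0$, depending only on $d,\alpha,K,C_1,M_\tau,M_\varphi$, with the following property. For every $N$ let $\varphi_N\in L^\infty((0,\infty);W^{1,\infty}(\mathbb R^d;\mathbb R^d))$ be a divergence-free vector field with $\|\varphi_N\|_{L^\infty(W^{1,\infty})}\le M_\varphi$, let $\tau_N^0$ be a probability density with $\|\tau_N^0\|_{L^\infty}\le M_\tau$, and let $\tau_N$ be a weak solution on $[0,\infty)$ of $$\partial_t\tau_N+(K*\tau_N+\varphi_N)\cdot\nabla\tau_N=0,\qquad \tau_N(0)=\tau_N^0,$$ where $\tau_N(t)$ is a probability density for every $t$, bounded in $L^\infty(\mathbb R^d)$ locally uniformly in time, weakly continuous in time, and such that $(1+|x|)^{-1}\int|K(x-y)|\,\tau_N(t,y)\,dy$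 is bounded in $x\in\mathbb R^d$, locally uniformly in time (this is automatic if $\alpha\ge 0$). Let $X_1,\dots,X_N$ be a solution of $$\dot X_i(t)=\varphi_N(t,X_i(t))+\frac1N\sum_{j\ne i}K(X_i(t)-X_j(t))+E_i(t),\qquad 1\le i\le N,$$ (in integrated form, with $E_i$ locally integrable in time) on its maximal interval of existence $[0,S_N)$, $0<S_N\le\infty$. That is, with $d_{\min}(t)=\min_{i\ne j}|X_i(t)-X_j(t)|$, there are no collisions on $[0,S_N)$, and either $S_N=\infty$ or $\inf_{[0,S_N)}d_{\min}=0$. (The $X_i$, $E_i$ and $d_{\min}$ depend on $N$.) Put $$\sigma_N(t)=\frac1N\sum_{i}\delta_{X_i(t)},\qquad \eta(t)=\mathcal W_\infty(\sigma_N(t),\tau_N(t)),$$ where $\mathcal W_\infty(\mu,\nu)$ is the infimum over all couplings $\gamma$ of $\mu,\nu$ of the $\gamma$-essential supremum of $|x-y|$. Assume that there are non-decreasing functions $e_N\colon[0,\infty)\to[0,\infty)$ such that 1. for all $t\ge0$, $$\lim_{N\to\infty}\frac{(\eta(0)+e_N(t))^{d-(1+\alpha)}}{d_{\min}(0)^{1+\alpha}N^{(1+\alpha)/d}}=0,\qquad\text{and}\qquad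 \limsup_{N\to\infty} d_{\min}(0)N^{1/d}<\infty;$$ 2. for all $T>0$ and $\lambda>0$ there is $N_0$ such that for all $N>N_0$ and all $t\in[0,T]$ with $t<S_N$, $$\frac{\eta(t)}{\eta(0)+e_N(t)}+\frac{d_{\min}(0)}{d_{\min}(t)}\le\lambda\quad\Longrightarrow\quad \sup_i|E_i(t)|\le e_N(t)\ \text{ and }\ \sup_{i\ne j}\frac{|E_i(t)-E_j(t)|}{|X_i(t)-X_j(t)|}\le C_1 .$$ Then for every $T>0$ and all $N$ sufficiently large (depending on $T$) one has $S_N>T$, and for all $t\in[0,T]$ $$\eta(t)\le e^{C_2t}(\eta(0)+e_N(t)),\qquad d_{\min}(t)\ge d_{\min}(0)\,e^{-C_2t},$$ and, for all $x\notin\{X_1(t),\dots,X_N(t)\}$, $$\bigl|(K*(\tau_N(t)-\sigma_N(t)))(x)\bigr|\le\frac{C_2}{N\operatorname{dist}(x,\{X_i(t)\}_i)^{\alpha}}+C_2e^{C_2t}(\eta(0)+e_N(t)).$$ -/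

import Mathlib

open MeasureTheory Set Filter Topology
open scoped ENNReal NNReal ContDiff

namespace MeanField

/-- Euclidean space of dimension `d`. -/
abbrev Eucl (d : ℕ) : Type := EuclideanSpace ℝ (Fin d)

/-- The kernel condition with exponent `α`: away from the origin `K` is differentiable and
divergence free, and `|K(x)| + |x| |∇K(x)| ≤ C |x|^(-α)` for some constant `C`. -/
def KernelCondition {d : ℕ} (K : Eucl d → Eucl d) (α : ℝ) : Prop :=
  (∀ x, x ≠ 0 → DifferentiableAt ℝ K x) ∧
  (∀ x, x ≠ 0 → LinearMap.trace ℝ (Eucl d) (fderiv ℝ K x : Eucl d →ₗ[ℝ] Eucl d) = 0) ∧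
  ∃ C : ℝ, ∀ x, x ≠ 0 → ‖K x‖ + ‖x‖ * ‖fderiv ℝ K x‖ ≤ C / ‖x‖ ^ α

/-- `φ` is a (weakly) divergence-free vector field in `L^∞((0,∞); W^{1,∞}(ℝ^d))` of norm at most
`M`. An element of `W^{1,∞}(ℝ^d)` is represented by its bounded Lipschitz representative, the norm
being the larger one of the sup norm and the Lipschitz constant. -/
structure IsDrift {d : ℕ} (φ : ℝ → Eucl d → Eucl d) (M : ℝ) : Prop where
  measurable : Measurable (Function.uncurry φ)
  bounded : ∀ᵐ t ∂(volume.restrict (Ioi (0 : ℝ))), ∀ x, ‖φ t x‖ ≤ M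
  lipschitz : ∀ᵐ t ∂(volume.restrict (Ioi (0 : ℝ))), ∀ x y, ‖φ t x - φ t y‖ ≤ M * ‖x - y‖
  div_free : ∀ᵐ t ∂(volume.restrict (Ioi (0 : ℝ))), ∀ ψ : Eucl d → ℝ, ContDiff ℝ ∞ ψ →
    HasCompactSupport ψ → ∫ x, fderiv ℝ ψ x (φ t x) = 0

/-- Probability densities on `ℝ^d`. -/
structure IsProbDensity {d : ℕ} (f : Eucl d → ℝ) : Prop where
  measurable : Measurable f
  nonneg : ∀ᵐ x, 0 ≤ f x
  mass : ∫⁻ x, ENNReal.ofReal (f x) = 1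

/-- The convolution `(K * f)(x) = ∫ K(x - y) f(y) dy`. -/
noncomputable def kernelConv {d : ℕ} (K : Eucl d → Eucl d) (f : Eucl d → ℝ) (x : Eucl d) :
    Eucl d :=
  ∫ y, f y • K (x - y)

/-- `τ` is a weak solution on `[0,∞)` of `∂ₜτ + (K * τ + φ) · ∇τ = 0`, `τ(0) = τ₀`, in the class
of curves of probability densities that are bounded in `L^∞(ℝ^d)` locally uniformly in time.
As the velocity field is divergence free, the transport term is `div ((K * τ + φ) τ)`, and the
equation is tested with smooth compactly supported functions `ψ` of `x` in its time-integrated form,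
which holds at every time for the weakly continuous representative of `τ`. -/
structure IsTransportSolution {d : ℕ} (K : Eucl d → Eucl d) (φ : ℝ → Eucl d → Eucl d)
    (τ₀ : Eucl d → ℝ) (τ : ℝ → Eucl d → ℝ) : Prop where
  measurable : Measurable (Function.uncurry τ)
  density : ∀ t, 0 ≤ t → IsProbDensity (τ t)
  bounded : ∀ T : ℝ, ∃ B : ℝ, ∀ t ∈ Icc 0 T, ∀ᵐ x, τ t x ≤ B
  /-- The convolution `K * τ` makes sense, with at most linear growth in space, locally uniformly
  in time. This is automatic from the two preceding fields if `K` is dominated by `|x|^(-α)`,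
  `0 ≤ α < d`; it matters only for kernels that grow at infinity. -/
  conv_finite : ∀ T : ℝ, ∃ B : ℝ, ∀ t ∈ Icc 0 T, ∀ x,
    ∫⁻ y, ‖τ t y • K (x - y)‖ₑ ≤ ENNReal.ofReal (B * (1 + ‖x‖))
  weak_eq : ∀ ψ : Eucl d → ℝ, ContDiff ℝ ∞ ψ → HasCompactSupport ψ → ∀ t, 0 ≤ t →
    ∫ x, τ t x * ψ x = (∫ x, τ₀ x * ψ x) +
      ∫ s in (0 : ℝ)..t, ∫ x, τ s x * fderiv ℝ ψ x (kernelConv K (τ s) x + φ s x)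

/-- The minimal distance `min_{i ≠ j} |X_i - X_j|` of `N ≥ 2` points (for `N ≤ 1` this is an
infimum over the empty set, with value `0`). -/
noncomputable def dMin {d N : ℕ} (X : Fin N → Eucl d) : ℝ :=
  ⨅ p : {p : Fin N × Fin N // p.1 ≠ p.2}, dist (X p.1.1) (X p.1.2)

/-- `X` is a solution, on its maximal interval of existence `[0,S)`, of the particle system
`dX_i/dt = φ(t, X_i) + (1/N) ∑_{j ≠ i} K(X_i - X_j) + E_i(t)`. The system is understood in
integrated form (`φ` and `E_i` are only measurable in time). There is no collision in `[0,S)`,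
and `S = ∞` unless the minimal distance of the particles is not bounded away from zero. -/
structure IsParticleSolution {d N : ℕ} (K : Eucl d → Eucl d) (φ : ℝ → Eucl d → Eucl d)
    (E : Fin N → ℝ → Eucl d) (X : ℝ → Fin N → Eucl d) (S : EReal) : Prop where
  pos : 0 < S
  no_collision : ∀ t : ℝ, 0 ≤ t → (t : EReal) < S → Function.Injective (X t)
  continuous : ∀ i, ContinuousOn (fun t => X t i) {t : ℝ | 0 ≤ t ∧ (t : EReal) < S}
  integrable_error : ∀ i, ∀ t : ℝ, 0 ≤ t → (t : EReal) < S →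
    IntervalIntegrable (E i) volume 0 t
  ode : ∀ i, ∀ t : ℝ, 0 ≤ t → (t : EReal) < S →
    X t i = X 0 i + ∫ s in (0 : ℝ)..t,
      (φ s (X s i) + (1 / (N : ℝ)) • (∑ j ∈ Finset.univ.erase i, K (X s i - X s j)) + E i s)
  maximal : S = ⊤ ∨ ∀ ε > 0, ∃ t : ℝ, 0 ≤ t ∧ (t : EReal) < S ∧ dMin (X t) < ε

/-- The `∞`-Wasserstein distance: the infimum over all couplings `γ` of `μ` and `ν` of the
`γ`-essential supremum of `|x - y|`. -/
noncomputable def wInf {d : ℕ} (μ ν : Measure (Eucl d)) : ℝ≥0∞ :=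
  ⨅ (γ : Measure (Eucl d × Eucl d)) (_ : γ.map Prod.fst = μ ∧ γ.map Prod.snd = ν),
    essSup (fun p : Eucl d × Eucl d => edist p.1 p.2) γ

/-- The empirical measure `(1/N) ∑ δ_{X_i}`. -/
noncomputable def empirical {d N : ℕ} (X : Fin N → Eucl d) : Measure (Eucl d) :=
  (N : ℝ≥0∞)⁻¹ • ∑ i, Measure.dirac (X i)

/-- The measure with Lebesgue density `f`. -/
noncomputable def densityMeasure {d : ℕ} (f : Eucl d → ℝ) : Measure (Eucl d) :=
  volume.withDensity fun x => ENNReal.ofReal (f x)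

/-- `η = W_∞(σ, τ)`, for `σ` the empirical measure of the points `X` and `τ` a density. -/
noncomputable def etaDist {d N : ℕ} (X : Fin N → Eucl d) (τ : Eucl d → ℝ) : ℝ≥0∞ :=
  wInf (empirical X) (densityMeasure τ)

end MeanField

/-!
Write `b = 1 + α`, so that `0 ≤ b < d`; the kernel has increments bounded by `|x - y|` times
`|x|^(-b) + |y|^(-b)`. The mean-field density `τ` and the particles move along nearly the same
velocity field, and the proof propagates a coupling between them by a Grönwall argument.

*Lagrangian picture.* For a measure of bounded density, `K * τ` is Lipschitz in space, since
`|x|^(-b)` is locally integrable; hence `K * τ + φ` generates a flow `Φ`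
(`IsVelocity.exists_flow`). A weak solution of the continuity equation gives each set at least the
initial mass of its preimage under the flow: test functions that are bumps around finitely many
trajectories, with radii growing like `exp (L t)`, never lose mass
(`IsWeakSolution.measure_preimage_le`). Applied to the probability densities `τ` this gives
`τ t = Φ t # τ 0`. Applied to Lebesgue measure, a weak solution because the velocity is divergence
free (`integral_fderiv_kernel` for the kernel, by removing the singularity with a cutoff), it shows
that the bound `Mτ` of the density is preserved (`IsTransportSolution.exists_flow`).

*Static estimates.* A coupling of the empirical measure with `τ` of transport distance `r` spreads
each atom to a measure `ν i` of mass `1 / N` within distance `r` (`AtomCoupling`). If the particles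
are `δ`-separated with `δ ≤ N^(-1/d)` and `r^(d-b) ≤ δ^b N^(b/d)`, then the discrete potentials
`(1/N) ∑ |x - X j|^(-b)` without a particle closer than `δ / 2` are bounded
(`exists_discrete_potential_le`): particles beyond `2 r` are compared with the potential of `τ`, the
nearer ones, of which there are at most about `N r^d`, by packing. Consequently the discrete force
differs from `K * τ` by at most `C r` (`exists_kernel_comparison`).

*Dynamics.* Start from an almost optimal coupling at time zero and transport its second marginal
with `Φ`. Let `r(t)` be the largest distance of `X i (t)` from the trajectories that start within
the initial transport distance of `X i (0)`. While `r` and the minimal distance are within twice the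
asserted bounds, the static estimates and the assumption on the errors hold, so `r` grows and the
minimal distance shrinks at most exponentially, with a rate that depends on the constants only.
This gives back the asserted bounds themselves, and a continuity argument
(`forall_mem_Icc_of_bootstrap`, `IsParticleSolution.exists_coupling_and_separation`) extends them to
`[0, T]`; there is no collision by then, so the solution exists beyond `T`. The limit assumption
enters only through the condition on `r` and `δ`, which it implies for all large `N`
(`eventually_smallness`). The estimate of the field at a point `x` off the particles is the static
comparison, the omitted particle being the one that realizes the distance of `x` to the particles.
-/

namespace MeanField

/-! ### Grönwall inequalities and kernel bounds -/

theorem le_mul_exp_of_continuous {g : ℝ → ℝ} {a L t : ℝ} (hL : 0 ≤ L) (ht : 0 ≤ t)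
    (hg : Continuous g) (h : ∀ s ∈ Icc 0 t, g s ≤ a + L * ∫ x in (0 : ℝ)..s, g x) :
    g t ≤ a * Real.exp (L * t) := by
  set f : ℝ → ℝ := fun s => (a + L * ∫ x in (0 : ℝ)..s, g x) * Real.exp (-L * s) with hf
  have hd : ∀ s, HasDerivAt f ((L * g s) * Real.exp (-L * s) +
      (a + L * ∫ x in (0 : ℝ)..s, g x) * (Real.exp (-L * s) * (-L))) s := by
    intro s
    have h1 : HasDerivAt (fun s => ∫ x in (0 : ℝ)..s, g x) (g s) s :=
      intervalIntegral.integral_hasDerivAt_right (hg.intervalIntegrable _ _)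
        (hg.stronglyMeasurableAtFilter _ _) hg.continuousAt
    have h2 : HasDerivAt (fun s : ℝ => -L * s) (-L) s := by
      simpa using (hasDerivAt_id s).const_mul (-L)
    exact ((h1.const_mul L).const_add a).mul h2.exp
  have hanti : AntitoneOn f (Icc 0 t) := by
    refine antitoneOn_of_deriv_nonpos (convex_Icc _ _)
      (fun s _ => (hd s).continuousAt.continuousWithinAt)
      (fun s _ => (hd s).differentiableAt.differentiableWithinAt) (fun s hs => ?_)
    rw [(hd s).deriv]
    rw [interior_Icc] at hs
    have h1 := h s (Ioo_subset_Icc_self hs)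
    have h2 := Real.exp_pos (-L * s)
    have h3 : 0 ≤ L * Real.exp (-L * s) * ((a + L * ∫ x in (0 : ℝ)..s, g x) - g s) :=
      mul_nonneg (by positivity) (by linarith)
    linarith
  have h0 := hanti (left_mem_Icc.2 ht) (right_mem_Icc.2 ht) ht
  have h1 : f 0 = a := by simp [hf]
  have h2 : f t * Real.exp (L * t) = a + L * ∫ x in (0 : ℝ)..t, g x := by
    simp only [hf]
    rw [mul_assoc, ← Real.exp_add]
    simp
  calc g t ≤ _ := h t (right_mem_Icc.2 ht)
    _ = f t * Real.exp (L * t) := h2.symm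
    _ ≤ a * Real.exp (L * t) := by rw [← h1]; gcongr

/-- Grönwall's inequality in integral form. -/
theorem le_mul_exp_of_le_add_integral {g : ℝ → ℝ} {a L t : ℝ} (hL : 0 ≤ L) (ht : 0 ≤ t)
    (hg : ContinuousOn g (Icc 0 t))
    (h : ∀ s ∈ Icc 0 t, g s ≤ a + L * ∫ x in (0 : ℝ)..s, g x) :
    g t ≤ a * Real.exp (L * t) := by
  have hc : Continuous (IccExtend ht ((Icc 0 t).domRestrict g)) :=
    (continuousOn_iff_continuous_domRestrict.1 hg).Icc_extend'
  have heq : ∀ s ∈ Icc 0 t, IccExtend ht ((Icc 0 t).domRestrict g) s = g s := fun s hs => by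
    rw [IccExtend_of_mem ht _ hs]; rfl
  rw [← heq t (right_mem_Icc.2 ht)]
  refine le_mul_exp_of_continuous hL ht hc fun s hs => ?_
  rw [heq s hs, intervalIntegral.integral_congr (g := g)]
  · exact h s hs
  · intro x hx
    rw [uIcc_of_le hs.1] at hx
    exact heq x ⟨hx.1, hx.2.trans hs.2⟩

/-- A curve whose velocity is bounded by a multiple of its distance to the origin approaches the
origin at most exponentially fast: this is Grönwall's inequality with time reversed. -/
theorem mul_exp_neg_le_norm {E : Type*} [NormedAddCommGroup E] [NormedSpace ℝ E]
    {Z z : ℝ → E} {L t : ℝ} (hL : 0 ≤ L) (ht : 0 ≤ t)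
    (hZ : ContinuousOn Z (Icc 0 t)) (hz : IntervalIntegrable z volume 0 t)
    (hode : ∀ s ∈ Icc 0 t, Z s = Z 0 + ∫ x in (0 : ℝ)..s, z x)
    (hb : ∀ᵐ s ∂(volume.restrict (Ioc 0 t)), ‖z s‖ ≤ L * ‖Z s‖) :
    ‖Z 0‖ * Real.exp (-L * t) ≤ ‖Z t‖ := by
  have hmaps : MapsTo (fun s => t - s) (Icc 0 t) (Icc 0 t) := fun s hs =>
    ⟨by linarith [hs.2], by linarith [hs.1]⟩
  have hg : ContinuousOn (fun s => ‖Z (t - s)‖) (Icc 0 t) :=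
    (hZ.comp (by fun_prop) hmaps).norm
  have hint : ∀ a ∈ Icc 0 t, IntervalIntegrable z volume 0 a := fun a ha =>
    hz.mono_set (by rw [uIcc_of_le ha.1, uIcc_of_le ht]; exact Icc_subset_Icc_right ha.2)
  have key := le_mul_exp_of_le_add_integral (a := ‖Z t‖) hL ht hg (fun s hs => by
    have hts := hmaps hs
    have h1 : Z (t - s) = Z t - ∫ x in (t - s)..t, z x := by
      rw [hode _ hts, hode t (right_mem_Icc.2 ht),
        ← intervalIntegral.integral_interval_sub_left (hint t (right_mem_Icc.2 ht)) (hint _ hts)]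
      abel
    have h2 : ‖∫ x in (t - s)..t, z x‖ ≤ ∫ x in (t - s)..t, L * ‖Z x‖ := by
      refine intervalIntegral.norm_integral_le_of_norm_le hts.2 ?_ ?_
      · have := (ae_restrict_iff' measurableSet_Ioc).1 hb
        filter_upwards [this] with x hx hx'
        exact hx ⟨hts.1.trans_lt hx'.1, hx'.2⟩
      · refine (ContinuousOn.intervalIntegrable ?_)
        rw [uIcc_of_le hts.2]
        exact (continuousOn_const.mul hZ.norm).mono (Icc_subset_Icc_left hts.1)
    have h3 : (∫ x in (t - s)..t, L * ‖Z x‖) = L * ∫ x in (0 : ℝ)..s, ‖Z (t - x)‖ := by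
      rw [intervalIntegral.integral_const_mul,
        intervalIntegral.integral_comp_sub_left (fun x => ‖Z x‖) t, sub_zero]
    rw [← h3, h1]
    exact (norm_sub_le _ _).trans (by gcongr))
  simp only [sub_self] at key
  calc ‖Z 0‖ * Real.exp (-L * t) ≤ (‖Z t‖ * Real.exp (L * t)) * Real.exp (-L * t) := by gcongr
    _ = ‖Z t‖ := by rw [mul_assoc, ← Real.exp_add]; simp

theorem nontrivial_eucl {d : ℕ} (hd : 0 < d) : Nontrivial (Eucl d) := by
  apply Module.nontrivial_of_finrank_pos (R := ℝ)
  simpa using hd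

/-- The quantitative form in which the kernel condition is used: with `b = 1 + α`, the kernel is
dominated by `|x| |x|^(-b)`, its derivative by `|x|^(-b)`, and its increments by the distance times
`|x|^(-b)`. -/
structure KernelBounds {d : ℕ} (K : Eucl d → Eucl d) (b C : ℝ) : Prop where
  pos : 0 < C
  size : ∀ x, x ≠ 0 → ‖K x‖ ≤ C * ‖x‖ * ‖x‖ ^ (-b)
  deriv : ∀ x, x ≠ 0 → ‖fderiv ℝ K x‖ ≤ C * ‖x‖ ^ (-b)
  increment : ∀ x y, x ≠ 0 → y ≠ 0 → ‖K x - K y‖ ≤ C * ‖x - y‖ * (‖x‖ ^ (-b) + ‖y‖ ^ (-b))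

/-- If one of two points is closer to the other than half its distance to the origin, the
increment is controlled by the mean value inequality on a ball that avoids the origin; otherwise
the distance of the points dominates both norms. -/
theorem KernelCondition.exists_kernelBounds {d : ℕ} {K : Eucl d → Eucl d} {α : ℝ} (hα : -1 ≤ α)
    (hK : KernelCondition K α) :
    ∃ C, KernelBounds K (1 + α) C ∧ ∀ x, x ≠ 0 → ‖K x‖ ≤ C / ‖x‖ ^ α := by
  obtain ⟨hdiff, -, C, hC⟩ := hK
  set b := 1 + α with hb
  have hb0 : 0 ≤ b := by linarith
  set D := max C 1 with hD
  have hD1 : 1 ≤ D := le_max_right _ _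
  have hpow : ∀ x : Eucl d, x ≠ 0 → D / ‖x‖ ^ α = D * ‖x‖ * ‖x‖ ^ (-b) := by
    intro x hx
    have hx' : 0 < ‖x‖ := norm_pos_iff.2 hx
    have : ‖x‖ ^ (-α) = ‖x‖ * ‖x‖ ^ (-b) := by
      rw [show -α = 1 + -b by simp [hb], Real.rpow_add hx', Real.rpow_one]
    rw [mul_assoc, ← this, Real.rpow_neg hx'.le, div_eq_mul_inv]
  have hKD : ∀ x, x ≠ 0 → ‖K x‖ + ‖x‖ * ‖fderiv ℝ K x‖ ≤ D * ‖x‖ * ‖x‖ ^ (-b) := by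
    intro x hx
    rw [← hpow x hx]
    refine (hC x hx).trans ?_
    gcongr
    exact le_max_left _ _
  have hsize : ∀ x, x ≠ 0 → ‖K x‖ ≤ D * ‖x‖ * ‖x‖ ^ (-b) := fun x hx =>
    le_trans (le_add_of_nonneg_right (by positivity)) (hKD x hx)
  have hderiv : ∀ x, x ≠ 0 → ‖fderiv ℝ K x‖ ≤ D * ‖x‖ ^ (-b) := by
    intro x hx
    have hx' : 0 < ‖x‖ := norm_pos_iff.2 hx
    have h1 : ‖x‖ * ‖fderiv ℝ K x‖ ≤ ‖x‖ * (D * ‖x‖ ^ (-b)) := by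
      have := hKD x hx
      have h2 := norm_nonneg (K x)
      linarith
    exact le_of_mul_le_mul_left h1 hx'
  have hnear : ∀ x y : Eucl d, x ≠ 0 → ‖x - y‖ ≤ ‖x‖ / 2 →
      ‖K x - K y‖ ≤ D * 2 ^ b * ‖x - y‖ * ‖x‖ ^ (-b) := by
    intro x y hx hxy
    have hx' : 0 < ‖x‖ := norm_pos_iff.2 hx
    have hlow : ∀ z ∈ Metric.closedBall x (‖x‖ / 2), ‖x‖ / 2 ≤ ‖z‖ := by
      intro z hz
      rw [mem_closedBall_iff_norm'] at hz
      have := norm_sub_norm_le x z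
      linarith
    have hne : ∀ z ∈ Metric.closedBall x (‖x‖ / 2), z ≠ 0 := fun z hz =>
      norm_pos_iff.1 (lt_of_lt_of_le (by positivity) (hlow z hz))
    have h1 := (convex_closedBall x (‖x‖ / 2)).norm_image_sub_le_of_norm_fderiv_le (𝕜 := ℝ)
      (C := D * (‖x‖ / 2) ^ (-b)) (fun z hz => hdiff z (hne z hz)) (fun z hz =>
        (hderiv z (hne z hz)).trans (by
          have := Real.rpow_le_rpow_of_nonpos (by positivity) (hlow z hz)
            (neg_nonpos.2 hb0)
          gcongr))
      (x := y) (y := x) (mem_closedBall_iff_norm'.2 hxy)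
      (Metric.mem_closedBall_self (by positivity))
    refine h1.trans_eq ?_
    rw [Real.div_rpow hx'.le (by norm_num), Real.rpow_neg (by norm_num : (0 : ℝ) ≤ 2)]
    field_simp
  have hpos2 : (0 : ℝ) < 2 ^ b := by positivity
  refine ⟨D * (2 ^ b + 2), ⟨by positivity, fun x hx => (hsize x hx).trans ?_,
    fun x hx => (hderiv x hx).trans ?_, ?_⟩,
    fun x hx => ?_⟩
  · gcongr
    nlinarith
  · gcongr
    nlinarith
  · intro x y hx hy
    have hx' : 0 < ‖x‖ := norm_pos_iff.2 hx
    have hy' : 0 < ‖y‖ := norm_pos_iff.2 hy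
    by_cases h1 : ‖x - y‖ ≤ ‖x‖ / 2
    · calc _ ≤ _ := hnear x y hx h1
        _ ≤ D * (2 ^ b + 2) * ‖x - y‖ * (‖x‖ ^ (-b) + ‖y‖ ^ (-b)) := by
          gcongr
          · linarith
          · exact le_add_of_nonneg_right (by positivity)
    by_cases h2 : ‖x - y‖ ≤ ‖y‖ / 2
    · rw [norm_sub_rev x y] at h2 ⊢
      rw [norm_sub_rev (K x)]
      calc _ ≤ _ := hnear y x hy h2
        _ ≤ D * (2 ^ b + 2) * ‖y - x‖ * (‖x‖ ^ (-b) + ‖y‖ ^ (-b)) := by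
          gcongr
          · linarith
          · exact le_add_of_nonneg_left (by positivity)
    push Not at h1 h2
    calc ‖K x - K y‖ ≤ ‖K x‖ + ‖K y‖ := norm_sub_le _ _
      _ ≤ D * ‖x‖ * ‖x‖ ^ (-b) + D * ‖y‖ * ‖y‖ ^ (-b) := add_le_add (hsize x hx) (hsize y hy)
      _ ≤ D * (2 * ‖x - y‖) * ‖x‖ ^ (-b) + D * (2 * ‖x - y‖) * ‖y‖ ^ (-b) := by
        gcongr <;> linarith
      _ = D * 2 * ‖x - y‖ * (‖x‖ ^ (-b) + ‖y‖ ^ (-b)) := by ring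
      _ ≤ _ := by gcongr; linarith
  · have h1 : ‖K x‖ ≤ D / ‖x‖ ^ α := by rw [hpow x hx]; exact hsize x hx
    refine h1.trans ?_
    gcongr
    nlinarith

/-- The kernel is Borel measurable, whatever its value at the origin. -/
theorem KernelCondition.measurable {d : ℕ} {K : Eucl d → Eucl d} {α : ℝ}
    (hK : KernelCondition K α) : Measurable K := by
  have h : ContinuousOn K {0}ᶜ := fun x hx => (hK.1 x hx).continuousAt.continuousWithinAt
  refine measurable_of_measurable_on_compl_singleton 0 ?_
  exact (continuousOn_iff_continuous_domRestrict.1 h).measurable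

/-! ### Riesz potentials and packing -/

/-- The integral of `|z|^(-b)` over the unit ball. -/
noncomputable def rieszMass (d : ℕ) (b : ℝ) : ℝ≥0∞ :=
  ∫⁻ z in Metric.ball (0 : Eucl d) 1, ENNReal.ofReal (‖z‖ ^ (-b))

theorem rieszMass_lt_top {d : ℕ} {b : ℝ} (hb : 0 ≤ b) (hbd : b < d) : rieszMass d b < ⊤ := by
  have hd : 1 ≤ Module.finrank ℝ (Eucl d) := by
    have : (0 : ℝ) < d := hb.trans_lt hbd
    have : 0 < d := by exact_mod_cast this
    simpa using Nat.succ_le_of_lt this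
  have h := integrableOn_ball_of_norm_le_rpow (μ := (volume : Measure (Eucl d))) (r := 1) (C := 1)
    (f := fun z : Eucl d => ‖z‖ ^ (-b)) (α := b) hd (by simpa using hbd)
    (ae_of_all _ fun z => by rw [one_mul, Real.norm_of_nonneg (by positivity)])
    (by fun_prop : Measurable fun z : Eucl d => ‖z‖ ^ (-b)).aestronglyMeasurable
  exact h.lintegral_lt_top

theorem setLIntegral_ball_rpow {d : ℕ} {b ρ : ℝ} (hρ : 0 < ρ) (x : Eucl d) :
    ∫⁻ z in Metric.ball x ρ, ENNReal.ofReal (‖x - z‖ ^ (-b)) =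
      ENNReal.ofReal (ρ ^ ((d : ℝ) - b)) * rieszMass d b := by
  set F : Eucl d → ℝ≥0∞ :=
    (Metric.ball (0 : Eucl d) ρ).indicator fun z => ENNReal.ofReal (‖z‖ ^ (-b)) with hF
  have hFm : Measurable F := Measurable.indicator (by fun_prop) measurableSet_ball
  have h1 : ∫⁻ z in Metric.ball x ρ, ENNReal.ofReal (‖x - z‖ ^ (-b)) = ∫⁻ z, F (x - z) := by
    rw [← lintegral_indicator measurableSet_ball]
    refine lintegral_congr fun z => ?_
    simp only [hF, indicator, mem_ball_zero_iff]
    simp only [mem_ball_iff_norm']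
  have h2 := Measure.map_addHaar_smul (volume : Measure (Eucl d)) hρ.ne'
  have h3 : ∫⁻ z, F z = ENNReal.ofReal (ρ ^ d) * ∫⁻ w, F (ρ • w) := by
    rw [← lintegral_map hFm (by fun_prop : Measurable fun w : Eucl d => ρ • w), h2,
      lintegral_smul_measure, smul_eq_mul, ← mul_assoc, ← ENNReal.ofReal_mul (by positivity)]
    simp only [finrank_euclideanSpace, Fintype.card_fin, abs_inv, abs_of_pos (pow_pos hρ d)]
    rw [mul_inv_cancel₀ (by positivity)]
    simp
  have h4 : ∀ w, F (ρ • w) = ENNReal.ofReal (ρ ^ (-b)) *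
      (Metric.ball (0 : Eucl d) 1).indicator (fun z => ENNReal.ofReal (‖z‖ ^ (-b))) w := by
    intro w
    simp only [hF, indicator, mem_ball_zero_iff, norm_smul, Real.norm_of_nonneg hρ.le]
    have : ρ * ‖w‖ < ρ ↔ ‖w‖ < 1 := by
      constructor <;> intro h <;> nlinarith
    simp only [this]
    split_ifs
    · rw [Real.mul_rpow hρ.le (norm_nonneg _), ENNReal.ofReal_mul (by positivity)]
    · simp
  rw [h1, lintegral_sub_left_eq_self, h3]
  simp_rw [h4]
  rw [lintegral_const_mul _ (Measurable.indicator (by fun_prop) measurableSet_ball),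
    lintegral_indicator measurableSet_ball, ← mul_assoc, ← ENNReal.ofReal_mul (by positivity),
    ← Real.rpow_natCast, ← Real.rpow_add hρ, ← sub_eq_add_neg]
  rfl

/-- Potential estimate for a measure of bounded density, by splitting at an arbitrary radius. -/
theorem lintegral_rpow_le {d : ℕ} {b ρ : ℝ} (hb : 0 ≤ b) (hρ : 0 < ρ) {M : ℝ≥0∞}
    {μ : Measure (Eucl d)} (hμ : μ ≤ M • volume) (x : Eucl d) :
    ∫⁻ z, ENNReal.ofReal (‖x - z‖ ^ (-b)) ∂μ ≤
      M * (ENNReal.ofReal (ρ ^ ((d : ℝ) - b)) * rieszMass d b) +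
        ENNReal.ofReal (ρ ^ (-b)) * μ univ := by
  rw [← lintegral_add_compl _ (measurableSet_ball (x := x) (ε := ρ))]
  gcongr
  · calc _ ≤ ∫⁻ z in Metric.ball x ρ, ENNReal.ofReal (‖x - z‖ ^ (-b)) ∂(M • volume) :=
        lintegral_mono' (Measure.restrict_mono le_rfl hμ) le_rfl
      _ = _ := by
        rw [Measure.restrict_smul, lintegral_smul_measure, setLIntegral_ball_rpow hρ, smul_eq_mul]
  · calc _ ≤ ∫⁻ z in (Metric.ball x ρ)ᶜ, ENNReal.ofReal (ρ ^ (-b)) ∂μ := by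
          refine setLIntegral_mono measurable_const fun z hz => ?_
          rw [mem_compl_iff, mem_ball_iff_norm', not_lt] at hz
          exact ENNReal.ofReal_le_ofReal
            (Real.rpow_le_rpow_of_nonpos hρ hz (neg_nonpos.2 hb))
      _ ≤ _ := by
        rw [setLIntegral_const]
        gcongr
        exact subset_univ _

/-- The volume of the unit ball. -/
noncomputable def unitBallVol (d : ℕ) : ℝ := (volume : Measure (Eucl d)).real (Metric.ball 0 1)

theorem unitBallVol_pos (d : ℕ) : 0 < unitBallVol d :=
  ENNReal.toReal_pos (Metric.measure_ball_pos _ _ one_pos).ne' measure_ball_lt_top.ne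

theorem volume_ball_eq {d : ℕ} (x : Eucl d) {r : ℝ} (hr : 0 < r) :
    volume (Metric.ball x r) = ENNReal.ofReal (unitBallVol d * r ^ d) := by
  rw [Measure.addHaar_ball_of_pos _ _ hr, unitBallVol, ENNReal.ofReal_mul (by positivity),
    ofReal_measureReal measure_ball_lt_top.ne, mul_comm]
  simp

theorem volume_closedBall_eq {d : ℕ} (x : Eucl d) {r : ℝ} (hr : 0 ≤ r) :
    volume (Metric.closedBall x r) = ENNReal.ofReal (unitBallVol d * r ^ d) := by
  rw [Measure.addHaar_closedBall _ _ hr, unitBallVol, ENNReal.ofReal_mul (by positivity),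
    ofReal_measureReal measure_ball_lt_top.ne, mul_comm]
  simp

/-- Packing estimate: the sum is compared with `δ^(-d)` times the potential of the union of the
disjoint balls of radius `δ / 4`, a set of volume proportional to `n δ^d`. -/
theorem exists_sum_rpow_le {d : ℕ} {b : ℝ} (hb : 0 ≤ b) (hbd : b < d) :
    ∃ C : ℝ, 0 < C ∧ ∀ (ι : Type) (J : Finset ι) (X : ι → Eucl d) (x : Eucl d) (δ : ℝ), 0 < δ →
      (∀ i ∈ J, ∀ j ∈ J, i ≠ j → δ ≤ dist (X i) (X j)) → (∀ i ∈ J, δ / 2 ≤ ‖x - X i‖) →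
      ∑ i ∈ J, ‖x - X i‖ ^ (-b) ≤ C * δ ^ (-b) * (J.card : ℝ) ^ (1 - b / d) := by
  have hd : (0 : ℝ) < d := hb.trans_lt hbd
  set I := (rieszMass d b).toReal with hI
  have hw := unitBallVol_pos d
  set w := unitBallVol d
  have hI0 : 0 ≤ I := ENNReal.toReal_nonneg
  refine ⟨(3 / 2) ^ b * (4 ^ d * I / w + 1), by positivity, ?_⟩
  intro ι J X x δ hδ hsep hfar
  rcases J.eq_empty_or_nonempty with rfl | hne
  · simp only [Finset.sum_empty]; positivity
  have hn : 0 < (J.card : ℝ) := by exact_mod_cast hne.card_pos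
  set n : ℝ := (J.card : ℝ) with hn_def
  -- the radius at which both terms of the potential estimate have the same size: a ball of this
  -- radius has about the volume of the union of the small balls
  set ρ := δ * n ^ (1 / (d : ℝ)) with hρ
  have hρ0 : 0 < ρ := by positivity
  set U : Set (Eucl d) := ⋃ i ∈ J, Metric.ball (X i) (δ / 4) with hU
  have hdisj : (J : Set ι).PairwiseDisjoint fun i => Metric.ball (X i) (δ / 4) := by
    intro i hi j hj hij
    exact Metric.ball_disjoint_ball (by linarith [hsep i hi j hj hij])
  have hUvol : (volume.restrict U : Measure (Eucl d)) univ =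
      ENNReal.ofReal (n * (w * (δ / 4) ^ d)) := by
    rw [Measure.restrict_apply_univ, hU,
      measure_biUnion_finset hdisj (fun _ _ => measurableSet_ball)]
    simp_rw [volume_ball_eq _ (by positivity : 0 < δ / 4)]
    rw [Finset.sum_const, nsmul_eq_mul, ← ENNReal.ofReal_natCast,
      ← ENNReal.ofReal_mul (by positivity)]
  have hlow : ∀ i ∈ J, ENNReal.ofReal (w * (δ / 4) ^ d * ((2 / 3) ^ b * ‖x - X i‖ ^ (-b))) ≤
      ∫⁻ z in Metric.ball (X i) (δ / 4), ENNReal.ofReal (‖x - z‖ ^ (-b)) := by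
    intro i hi
    have h1 : ∫⁻ z in Metric.ball (X i) (δ / 4),
        ENNReal.ofReal ((2 / 3) ^ b * ‖x - X i‖ ^ (-b)) ≤
        ∫⁻ z in Metric.ball (X i) (δ / 4), ENNReal.ofReal (‖x - z‖ ^ (-b)) := by
      refine setLIntegral_mono (by fun_prop) fun z hz => ?_
      apply ENNReal.ofReal_le_ofReal
      rw [mem_ball_iff_norm] at hz
      have h2 := hfar i hi
      have h3 : ‖x - X i‖ ≤ ‖x - z‖ + ‖z - X i‖ := norm_sub_le_norm_sub_add_norm_sub _ _ _
      have h4 : ‖x - z‖ ≤ ‖x - X i‖ + ‖z - X i‖ := by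
        rw [norm_sub_rev z]; exact norm_sub_le_norm_sub_add_norm_sub _ _ _
      have h5 : 0 < ‖x - z‖ := by linarith
      have h6 : 0 < ‖x - X i‖ := by linarith
      have h7 := Real.rpow_le_rpow_of_nonpos h5 (by linarith : ‖x - z‖ ≤ (3 / 2) * ‖x - X i‖)
        (neg_nonpos.2 hb)
      refine le_trans (le_of_eq ?_) h7
      rw [Real.mul_rpow (by norm_num) h6.le, Real.rpow_neg (by norm_num : (0 : ℝ) ≤ 3 / 2),
        ← Real.inv_rpow (by norm_num : (0 : ℝ) ≤ 3 / 2)]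
      norm_num
    refine le_trans (le_of_eq ?_) h1
    rw [setLIntegral_const, volume_ball_eq _ (by positivity : 0 < δ / 4), mul_comm,
      ENNReal.ofReal_mul' (by positivity)]
  have hsum : ENNReal.ofReal (w * (δ / 4) ^ d * ((2 / 3) ^ b * ∑ i ∈ J, ‖x - X i‖ ^ (-b))) ≤
      ENNReal.ofReal (ρ ^ ((d : ℝ) - b) * I + ρ ^ (-b) * (n * (w * (δ / 4) ^ d))) := by
    calc _ = ∑ i ∈ J, ENNReal.ofReal (w * (δ / 4) ^ d * ((2 / 3) ^ b * ‖x - X i‖ ^ (-b))) := by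
          rw [← ENNReal.ofReal_sum_of_nonneg (fun i _ => by positivity), Finset.mul_sum,
            Finset.mul_sum]
      _ ≤ ∑ i ∈ J, ∫⁻ z in Metric.ball (X i) (δ / 4), ENNReal.ofReal (‖x - z‖ ^ (-b)) :=
          Finset.sum_le_sum hlow
      _ = ∫⁻ z in U, ENNReal.ofReal (‖x - z‖ ^ (-b)) := by
          rw [hU, lintegral_biUnion_finset hdisj (fun _ _ => measurableSet_ball)]
      _ ≤ _ := by
          refine (lintegral_rpow_le (M := 1) hb hρ0
            (by simpa using Measure.restrict_le_self) x).trans ?_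
          rw [hUvol, one_mul, ← ENNReal.ofReal_toReal (rieszMass_lt_top hb hbd).ne,
            ← ENNReal.ofReal_mul (by positivity), ← ENNReal.ofReal_mul (by positivity),
            ← ENNReal.ofReal_add (by positivity) (by positivity)]
  have hreal := (ENNReal.ofReal_le_ofReal_iff (by positivity)).1 hsum
  have hp1 : ρ ^ ((d : ℝ) - b) = δ ^ d * (δ ^ (-b) * n ^ (1 - b / d)) := by
    rw [hρ, Real.mul_rpow hδ.le (by positivity), ← Real.rpow_mul hn.le, sub_eq_add_neg,
      Real.rpow_add hδ, Real.rpow_natCast, mul_assoc]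
    congr 3
    field_simp
    ring
  have hp2 : ρ ^ (-b) * n = δ ^ (-b) * n ^ (1 - b / d) := by
    rw [hρ, Real.mul_rpow hδ.le (by positivity), ← Real.rpow_mul hn.le, mul_assoc]
    nth_rewrite 2 [← Real.rpow_one n]
    rw [← Real.rpow_add hn]
    congr 2
    field_simp
    ring
  rw [hp1] at hreal
  set q := δ ^ (-b) * n ^ (1 - b / d) with hq
  set W := ∑ i ∈ J, ‖x - X i‖ ^ (-b)
  have h32 : ((3 : ℝ) / 2) ^ b * (2 / 3) ^ b = 1 := by
    rw [← Real.mul_rpow (by norm_num) (by norm_num)]; norm_num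
  have e1 : w * (δ / 4) ^ d * ((2 / 3) ^ b * W) ≤
      w * (δ / 4) ^ d * ((4 ^ d * I / w + 1) * q) := by
    refine hreal.trans_eq ?_
    rw [show ρ ^ (-b) * (n * (w * (δ / 4) ^ d)) = (ρ ^ (-b) * n) * (w * (δ / 4) ^ d) by ring, hp2,
      div_pow]
    field_simp
  have e2 : (2 / 3) ^ b * W ≤ (4 ^ d * I / w + 1) * q := le_of_mul_le_mul_left e1 (by positivity)
  calc W = (3 / 2) ^ b * ((2 / 3) ^ b * W) := by rw [← mul_assoc, h32, one_mul]
    _ ≤ (3 / 2) ^ b * ((4 ^ d * I / w + 1) * q) := by gcongr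
    _ = _ := by rw [hq]; ring

/-! ### Couplings with an empirical measure and comparison of the forces -/

/-- A coupling of the empirical measure of the points `X i` with `μ` whose transport distance is
at most `r`, encoded by the images `ν i` of the atoms: the atom of mass `1 / N` at `X i` is spread
out to the measure `ν i`, which lives in the closed ball of radius `r` about `X i`. -/
structure AtomCoupling {d N : ℕ} (X : Fin N → Eucl d) (μ : Measure (Eucl d)) (r : ℝ)
    (ν : Fin N → Measure (Eucl d)) : Prop where
  mass : ∀ i, ν i univ = (N : ℝ≥0∞)⁻¹
  near : ∀ i, ∀ᵐ z ∂(ν i), ‖X i - z‖ ≤ r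
  sum : ∑ i, ν i = μ

theorem AtomCoupling.wInf_le {d N : ℕ} {X : Fin N → Eucl d} {μ : Measure (Eucl d)} {r : ℝ}
    {ν : Fin N → Measure (Eucl d)} (h : AtomCoupling X μ r ν) :
    wInf (empirical X) μ ≤ ENNReal.ofReal r := by
  have hm : ∀ i, Measurable fun z : Eucl d => (X i, z) := fun i => by fun_prop
  refine iInf₂_le_of_le (∑ i, (ν i).map fun z => (X i, z)) ⟨?_, ?_⟩ ?_
  · ext s hs
    rw [Measure.map_apply measurable_fst hs]
    simp only [empirical, Measure.coe_finsetSum, Finset.sum_apply, Measure.smul_apply,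
      smul_eq_mul, Finset.mul_sum]
    refine Finset.sum_congr rfl fun i _ => ?_
    rw [Measure.map_apply (hm i) (measurable_fst hs), Measure.dirac_apply' _ hs, ← h.mass i]
    by_cases hi : X i ∈ s
    · have : (fun z : Eucl d => (X i, z)) ⁻¹' (Prod.fst ⁻¹' s) = univ := by
        ext z; simp [hi]
      rw [this]; simp [hi]
    · have : (fun z : Eucl d => (X i, z)) ⁻¹' (Prod.fst ⁻¹' s) = ∅ := by
        ext z; simp [hi]
      rw [this]; simp [hi]
  · ext s hs
    rw [Measure.map_apply measurable_snd hs, ← h.sum]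
    simp only [Measure.coe_finsetSum, Finset.sum_apply]
    refine Finset.sum_congr rfl fun i _ => ?_
    rw [Measure.map_apply (hm i) (measurable_snd hs)]
    rfl
  · refine essSup_le_of_ae_le _ ?_
    rw [Filter.EventuallyLE, ae_iff]
    have hset : MeasurableSet {a : Eucl d × Eucl d | ¬edist a.1 a.2 ≤ ENNReal.ofReal r} :=
      (measurableSet_le (f := fun a : Eucl d × Eucl d => edist a.1 a.2) (by fun_prop)
        measurable_const).compl
    simp only [Measure.coe_finsetSum, Finset.sum_apply, Finset.sum_eq_zero_iff]
    intro i _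
    rw [Measure.map_apply (hm i) hset]
    refine measure_mono_null (fun z hz => ?_) (ae_iff.1 (h.near i))
    simp only [mem_preimage, mem_ofPred_eq] at hz ⊢
    intro hz'
    apply hz
    rw [edist_dist, dist_eq_norm]
    exact ENNReal.ofReal_le_ofReal hz'

/-- A coupling with a discrete marginal is cut into the pieces above the points `X i`; these have
mass `1 / N` each only because the points are distinct. -/
theorem exists_atomCoupling {d N : ℕ} {X : Fin N → Eucl d} (hX : Function.Injective X)
    {μ : Measure (Eucl d)} {r : ℝ} (h : wInf (empirical X) μ < ENNReal.ofReal r) :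
    ∃ ν, AtomCoupling X μ r ν := by
  obtain ⟨γ, ⟨h1, h2⟩, h3⟩ := by simpa only [wInf, iInf_lt_iff, exists_prop] using h
  have hemp : ∀ i, empirical X {X i} = (N : ℝ≥0∞)⁻¹ := by
    intro i
    simp only [empirical, Measure.smul_apply, Measure.coe_finsetSum, Finset.sum_apply,
      Measure.dirac_apply' _ (measurableSet_singleton _), smul_eq_mul]
    rw [Finset.sum_eq_single i]
    · simp
    · intro j _ hj
      simp [hX.ne hj]
    · simp
  have hr0 : 0 < r := ENNReal.ofReal_pos.1 (zero_le.trans_lt h)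
  have hae : ∀ᵐ p ∂γ, ‖p.1 - p.2‖ ≤ r := by
    filter_upwards [ENNReal.ae_le_essSup (μ := γ) (fun p : Eucl d × Eucl d => edist p.1 p.2)]
      with p hp
    have := hp.trans h3.le
    rwa [edist_dist, dist_eq_norm, ENNReal.ofReal_le_ofReal_iff hr0.le] at this
  have hms : ∀ i, MeasurableSet (Prod.fst ⁻¹' {X i} : Set (Eucl d × Eucl d)) := fun i =>
    measurable_fst (measurableSet_singleton _)
  refine ⟨fun i => (γ.restrict (Prod.fst ⁻¹' {X i})).map Prod.snd, fun i => ?_, fun i => ?_, ?_⟩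
  · rw [Measure.map_apply measurable_snd MeasurableSet.univ, preimage_univ,
      Measure.restrict_apply_univ, ← Measure.map_apply measurable_fst (measurableSet_singleton _),
      h1, hemp]
  · have hset : MeasurableSet {z : Eucl d | ‖X i - z‖ ≤ r} :=
      measurableSet_le (by fun_prop) measurable_const
    rw [ae_map_iff measurable_snd.aemeasurable hset]
    filter_upwards [ae_restrict_of_ae hae, ae_restrict_mem (hms i)] with p hp hpi
    rw [mem_preimage, mem_singleton_iff] at hpi
    rwa [← hpi]
  · ext s hs
    simp only [Measure.coe_finsetSum, Finset.sum_apply, Measure.map_apply measurable_snd hs,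
      Measure.restrict_apply (measurable_snd hs)]
    rw [← measure_biUnion_finset, ← h2, Measure.map_apply measurable_snd hs]
    · refine measure_congr ?_
      have hnull : γ (Prod.fst ⁻¹' (range X)ᶜ) = 0 := by
        have hm : MeasurableSet (range X)ᶜ := (finite_range X).measurableSet.compl
        rw [← Measure.map_apply measurable_fst hm, h1]
        simp [empirical, Measure.dirac_apply' _ hm]
      have : ∀ᵐ p ∂γ, p.1 ∈ range X := by
        rw [ae_iff]; exact hnull
      filter_upwards [this] with p hp
      obtain ⟨i, hi⟩ := hp
      apply propext
      change (p ∈ ⋃ i ∈ Finset.univ, (Prod.snd ⁻¹' s ∩ Prod.fst ⁻¹' {X i} :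
        Set (Eucl d × Eucl d))) ↔ p ∈ Prod.snd ⁻¹' s
      simp only [mem_iUnion, mem_inter_iff, mem_preimage, mem_singleton_iff]
      exact ⟨fun ⟨_, _, h, _⟩ => h, fun h => ⟨i, Finset.mem_univ _, h, hi.symm⟩⟩
    · intro i _ j _ hij
      refine disjoint_left.2 fun p hp hp' => hij (hX ?_)
      have e1 : p.1 = X i := hp.2
      have e2 : p.1 = X j := hp'.2
      rw [← e1, e2]
    · exact fun i _ => (measurable_snd hs).inter (hms i)


theorem AtomCoupling.le {d N : ℕ} {X : Fin N → Eucl d} {μ : Measure (Eucl d)} {r : ℝ}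
    {ν : Fin N → Measure (Eucl d)} (h : AtomCoupling X μ r ν) (i : Fin N) : ν i ≤ μ := by
  rw [← h.sum]
  intro s
  simp only [Measure.coe_finsetSum, Finset.sum_apply]
  exact Finset.single_le_sum (f := fun j => ν j s) (fun _ _ => zero_le) (Finset.mem_univ i)

theorem AtomCoupling.measure_univ {d N : ℕ} {X : Fin N → Eucl d} {μ : Measure (Eucl d)} {r : ℝ}
    {ν : Fin N → Measure (Eucl d)} (h : AtomCoupling X μ r ν) (hN : 0 < N) : μ univ = 1 := by
  rw [← h.sum]
  simp only [Measure.coe_finsetSum, Finset.sum_apply, h.mass, Finset.sum_const, Finset.card_univ,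
    Fintype.card_fin, nsmul_eq_mul]
  exact ENNReal.mul_inv_cancel (by exact_mod_cast hN.ne') (ENNReal.natCast_ne_top N)

/-- A density bound forces the transport distance to be at least of the order of the typical
distance `N^(-1/d)` of `N` particles, since each atom has to be spread over a volume `1 / N`. -/
theorem AtomCoupling.rpow_le {d N : ℕ} (hd : 0 < d) {X : Fin N → Eucl d} {μ : Measure (Eucl d)}
    {r : ℝ} {ν : Fin N → Measure (Eucl d)} (h : AtomCoupling X μ r ν) (hN : 0 < N) (hr : 0 ≤ r)
    {M : ℝ≥0} (hμ : μ ≤ (M : ℝ≥0∞) • volume) :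
    (N : ℝ) ^ (-(1 / (d : ℝ))) ≤ (M * unitBallVol d) ^ (1 / (d : ℝ)) * r := by
  have hw := unitBallVol_pos d
  have hd' : (0 : ℝ) < d := by exact_mod_cast hd
  have hN' : (0 : ℝ) < N := by exact_mod_cast hN
  let i : Fin N := ⟨0, hN⟩
  have h1 : (N : ℝ≥0∞)⁻¹ ≤ ENNReal.ofReal (M * (unitBallVol d * r ^ d)) := by
    calc (N : ℝ≥0∞)⁻¹ = ν i univ := (h.mass i).symm
      _ = ν i (Metric.closedBall (X i) r) := by
        refine (measure_congr ?_).symm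
        filter_upwards [h.near i] with z hz
        exact eq_true (mem_closedBall_iff_norm'.2 hz) |>.trans (eq_true (mem_univ z)).symm
      _ ≤ μ (Metric.closedBall (X i) r) := h.le i _
      _ ≤ _ := by
        refine (hμ _).trans_eq ?_
        rw [Measure.smul_apply, volume_closedBall_eq _ hr, ENNReal.ofReal_mul M.coe_nonneg,
          ENNReal.ofReal_coe_nnreal, smul_eq_mul]
  have h2 : (N : ℝ)⁻¹ ≤ M * (unitBallVol d * r ^ d) := by
    rw [← ENNReal.ofReal_le_ofReal_iff (by positivity), ENNReal.ofReal_inv_of_pos hN',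
      ENNReal.ofReal_natCast]
    exact h1
  calc (N : ℝ) ^ (-(1 / (d : ℝ))) = ((N : ℝ)⁻¹) ^ (1 / (d : ℝ)) := by
        rw [Real.rpow_neg hN'.le, Real.inv_rpow hN'.le]
    _ ≤ (M * (unitBallVol d * r ^ d)) ^ (1 / (d : ℝ)) := by gcongr
    _ = _ := by
      rw [← mul_assoc, Real.mul_rpow (by positivity) (by positivity), ← Real.rpow_natCast r,
        ← Real.rpow_mul hr, mul_one_div_cancel hd'.ne', Real.rpow_one]

theorem exists_potential_le {d : ℕ} {b : ℝ} (hb : 0 ≤ b) (hbd : b < d) (M : ℝ≥0) :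
    ∃ C : ℝ, 0 < C ∧ ∀ (μ : Measure (Eucl d)), μ ≤ (M : ℝ≥0∞) • volume → μ univ ≤ 1 → ∀ x,
      ∫⁻ z, ENNReal.ofReal (‖x - z‖ ^ (-b)) ∂μ ≤ ENNReal.ofReal C := by
  refine ⟨M * (rieszMass d b).toReal + 1, by positivity, fun μ hμ hμ1 x => ?_⟩
  refine (lintegral_rpow_le hb one_pos hμ x).trans ?_
  rw [ENNReal.ofReal_add (by positivity) zero_le_one, ENNReal.ofReal_mul M.coe_nonneg,
    ENNReal.ofReal_toReal (rieszMass_lt_top hb hbd).ne, ENNReal.ofReal_coe_nnreal]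
  simp only [Real.one_rpow, ENNReal.ofReal_one, one_mul]
  gcongr

/-- The discrete potential, without the possible particle closest to `x`, is bounded: particles at
distance at least `2 r` are compared with the potential of `μ`, the others are counted by means of
the density bound and estimated by packing. -/
theorem exists_discrete_potential_le {d : ℕ} {b : ℝ} (hb : 0 ≤ b) (hbd : b < d) (M : ℝ≥0) :
    ∃ C : ℝ, 0 < C ∧ ∀ (N : ℕ) (X : Fin N → Eucl d) (μ : Measure (Eucl d)) (r δ : ℝ)
      (ν : Fin N → Measure (Eucl d)), AtomCoupling X μ r ν → 0 < N → 0 ≤ r → 0 < δ →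
      μ ≤ (M : ℝ≥0∞) • volume → (∀ i j, i ≠ j → δ ≤ dist (X i) (X j)) →
      r ^ ((d : ℝ) - b) ≤ δ ^ b * (N : ℝ) ^ (b / d) → ∀ x,
      (1 / (N : ℝ)) * ∑ j with δ / 2 ≤ ‖x - X j‖, ‖x - X j‖ ^ (-b) ≤ C := by
  obtain ⟨C₁, hC₁, hpot⟩ := exists_potential_le hb hbd M
  obtain ⟨C₂, hC₂, hpack⟩ := exists_sum_rpow_le hb hbd
  have hw := unitBallVol_pos d
  have hd' : (0 : ℝ) < d := hb.trans_lt hbd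
  have hd0 : 0 < d := by exact_mod_cast hd'
  have := nontrivial_eucl hd0
  have hbd' : 0 ≤ 1 - b / d := by rw [sub_nonneg, div_le_one hd']; exact hbd.le
  set A : ℝ := M * (unitBallVol d * 3 ^ d) with hA
  have hA0 : 0 ≤ A := by positivity
  refine ⟨C₂ * A ^ (1 - b / d) + (3 / 2) ^ b * C₁, by positivity, ?_⟩
  intro N X μ r δ ν h hN hr hδ hμ hsep hθ x
  have hN' : (0 : ℝ) < N := by exact_mod_cast hN
  set J : Finset (Fin N) := {j | δ / 2 ≤ ‖x - X j‖ ∧ ‖x - X j‖ < 2 * r} with hJ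
  set J' : Finset (Fin N) := {j | δ / 2 ≤ ‖x - X j‖ ∧ 2 * r ≤ ‖x - X j‖} with hJ'
  have hsplit : ∑ j with δ / 2 ≤ ‖x - X j‖, ‖x - X j‖ ^ (-b) =
      ∑ j ∈ J, ‖x - X j‖ ^ (-b) + ∑ j ∈ J', ‖x - X j‖ ^ (-b) := by
    rw [← Finset.sum_filter_add_sum_filter_not _ (fun j => ‖x - X j‖ < 2 * r),
      Finset.filter_filter, Finset.filter_filter]
    simp only [not_lt, hJ, hJ']
  have hcard : (J.card : ℝ) ≤ N * A * r ^ d := by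
    have h1 : (J.card : ℝ≥0∞) * (N : ℝ≥0∞)⁻¹ ≤ ENNReal.ofReal (A * r ^ d) := by
      calc (J.card : ℝ≥0∞) * (N : ℝ≥0∞)⁻¹ = ∑ j ∈ J, ν j univ := by
            simp [h.mass]
        _ = ∑ j ∈ J, ν j (Metric.closedBall x (3 * r)) := by
            refine Finset.sum_congr rfl fun j hj => (measure_congr ?_).symm
            filter_upwards [h.near j] with z hz
            simp only [hJ, Finset.mem_filter, Finset.mem_univ, true_and] at hj
            refine (eq_true (mem_closedBall_iff_norm'.2 ?_)).trans (eq_true (mem_univ z)).symm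
            have := norm_sub_le_norm_sub_add_norm_sub x (X j) z
            linarith [hj.2]
        _ ≤ μ (Metric.closedBall x (3 * r)) := by
            rw [← h.sum]
            simp only [Measure.coe_finsetSum, Finset.sum_apply]
            exact Finset.sum_le_sum_of_subset (Finset.subset_univ _)
        _ ≤ _ := by
            refine (hμ _).trans_eq ?_
            rw [Measure.smul_apply, volume_closedBall_eq _ (by positivity), smul_eq_mul,
              ← ENNReal.ofReal_coe_nnreal, ← ENNReal.ofReal_mul M.coe_nonneg, mul_pow]
            congr 1
            rw [hA]; ring
    have h2 : (J.card : ℝ) * (N : ℝ)⁻¹ ≤ A * r ^ d := by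
      rw [← ENNReal.ofReal_le_ofReal_iff (by positivity), ENNReal.ofReal_mul (by positivity),
        ENNReal.ofReal_inv_of_pos hN', ENNReal.ofReal_natCast, ENNReal.ofReal_natCast]
      exact h1
    rw [← div_eq_mul_inv, div_le_iff₀ hN'] at h2
    linarith
  have hnear : (1 / (N : ℝ)) * ∑ j ∈ J, ‖x - X j‖ ^ (-b) ≤ C₂ * A ^ (1 - b / d) := by
    have h1 := hpack (Fin N) J X x δ hδ (fun i _ j _ hij => hsep i j hij) (fun i hi => by
      simp only [hJ, Finset.mem_filter, Finset.mem_univ, true_and] at hi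
      exact hi.1)
    calc (1 / (N : ℝ)) * ∑ j ∈ J, ‖x - X j‖ ^ (-b)
        ≤ (1 / (N : ℝ)) * (C₂ * δ ^ (-b) * (N * A * r ^ d) ^ (1 - b / d)) := by
          gcongr
          refine h1.trans ?_
          gcongr
      _ = C₂ * A ^ (1 - b / d) * (r ^ ((d : ℝ) - b) / (δ ^ b * (N : ℝ) ^ (b / d))) := by
          rw [Real.mul_rpow (by positivity) (by positivity),
            Real.mul_rpow (by positivity) (by positivity), ← Real.rpow_natCast r,
            ← Real.rpow_mul hr, Real.rpow_neg hδ.le, Real.rpow_sub hN', Real.rpow_one,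
            show (d : ℝ) * (1 - b / d) = d - b by field_simp]
          field_simp
      _ ≤ C₂ * A ^ (1 - b / d) * 1 := by
          gcongr
          exact div_le_one_of_le₀ hθ (by positivity)
      _ = _ := mul_one _
  have hfar : (1 / (N : ℝ)) * ∑ j ∈ J', ‖x - X j‖ ^ (-b) ≤ (3 / 2) ^ b * C₁ := by
    have hμ0 : μ {x} = 0 := le_antisymm ((hμ _).trans (by simp)) zero_le
    rw [← ENNReal.ofReal_le_ofReal_iff (by positivity)]
    calc ENNReal.ofReal ((1 / (N : ℝ)) * ∑ j ∈ J', ‖x - X j‖ ^ (-b))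
        = ∑ j ∈ J', ∫⁻ _, ENNReal.ofReal (‖x - X j‖ ^ (-b)) ∂(ν j) := by
          rw [Finset.mul_sum, ENNReal.ofReal_sum_of_nonneg (fun i _ => by positivity)]
          refine Finset.sum_congr rfl fun j _ => ?_
          rw [lintegral_const, h.mass, ENNReal.ofReal_mul (by positivity), one_div,
            ENNReal.ofReal_inv_of_pos hN', ENNReal.ofReal_natCast, mul_comm]
      _ ≤ ∑ j ∈ J', ∫⁻ z, ENNReal.ofReal ((3 / 2) ^ b * ‖x - z‖ ^ (-b)) ∂(ν j) := by
          refine Finset.sum_le_sum fun j hj => lintegral_mono_ae ?_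
          simp only [hJ', Finset.mem_filter, Finset.mem_univ, true_and] at hj
          have hxne : ∀ᵐ z ∂(ν j), z ≠ x := by
            rw [ae_iff]
            simp only [not_not]
            exact le_antisymm ((h.le j _).trans_eq hμ0) zero_le
          filter_upwards [h.near j, hxne] with z hz hzx
          apply ENNReal.ofReal_le_ofReal
          have h3 := norm_sub_le_norm_sub_add_norm_sub x (X j) z
          have h4 : 0 < ‖x - z‖ := norm_pos_iff.2 (sub_ne_zero.2 hzx.symm)
          have h5 : 0 < ‖x - X j‖ := lt_of_lt_of_le (by positivity) hj.1
          have h6 : (2 / 3) * ‖x - z‖ ≤ ‖x - X j‖ := by linarith [hj.2]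
          have h7 := Real.rpow_le_rpow_of_nonpos (by positivity) h6 (neg_nonpos.2 hb)
          refine h7.trans_eq ?_
          rw [Real.mul_rpow (by norm_num) h4.le, Real.rpow_neg (by norm_num : (0 : ℝ) ≤ 2 / 3),
            ← Real.inv_rpow (by norm_num : (0 : ℝ) ≤ 2 / 3)]
          norm_num
      _ ≤ ∑ j, ∫⁻ z, ENNReal.ofReal ((3 / 2) ^ b * ‖x - z‖ ^ (-b)) ∂(ν j) :=
          Finset.sum_le_sum_of_subset (Finset.subset_univ _)
      _ = ENNReal.ofReal ((3 / 2) ^ b) * ∫⁻ z, ENNReal.ofReal (‖x - z‖ ^ (-b)) ∂μ := by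
          rw [← lintegral_finsetSum_measure, h.sum, ← lintegral_const_mul _ (by fun_prop)]
          simp_rw [ENNReal.ofReal_mul (by positivity : (0 : ℝ) ≤ (3 / 2) ^ b)]
      _ ≤ _ := by
          rw [ENNReal.ofReal_mul (by positivity)]
          gcongr
          exact hpot μ hμ (h.measure_univ hN).le x
  rw [hsplit, mul_add]
  exact add_le_add hnear hfar

/-- Comparison of the mean-field force with the force of all particles except the possible one
that is much closer to `x` than the separation `δ`. Each atom is compared with its image under the
coupling, which costs `r` times the continuous and the discrete potential. The omitted particle is
closer to `x` than `δ / 2`, so that the kernel on its image is itself of the order `r` times the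
potential, as `δ` is at most a multiple of `r`. -/
theorem exists_kernel_comparison {d : ℕ} {b : ℝ} (hb : 0 ≤ b) (hbd : b < d) (M : ℝ≥0)
    {K : Eucl d → Eucl d} {Ck : ℝ} (hK : KernelBounds K b Ck) (hKm : Measurable K) :
    ∃ C : ℝ, 0 < C ∧ ∀ (N : ℕ) (X : Fin N → Eucl d) (μ : Measure (Eucl d)) (r δ : ℝ)
      (ν : Fin N → Measure (Eucl d)), AtomCoupling X μ r ν → 0 < N → 0 ≤ r → 0 < δ →
      μ ≤ (M : ℝ≥0∞) • volume → (∀ i j, i ≠ j → δ ≤ dist (X i) (X j)) →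
      r ^ ((d : ℝ) - b) ≤ δ ^ b * (N : ℝ) ^ (b / d) → δ ≤ (N : ℝ) ^ (-(1 / (d : ℝ))) → ∀ x,
      ‖∫ z, K (x - z) ∂μ - (1 / (N : ℝ)) • ∑ j with δ / 2 ≤ ‖x - X j‖, K (x - X j)‖ ≤ C * r := by
  obtain ⟨C₁, hC₁, hpot⟩ := exists_potential_le hb hbd M
  obtain ⟨C₂, hC₂, hdisc⟩ := exists_discrete_potential_le hb hbd M
  have hw := unitBallVol_pos d
  have hd' : (0 : ℝ) < d := hb.trans_lt hbd
  have hd0 : 0 < d := by exact_mod_cast hd'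
  have := nontrivial_eucl hd0
  have hCk := hK.pos
  set c : ℝ := (M * unitBallVol d) ^ (1 / (d : ℝ)) with hc
  refine ⟨Ck * (1 + c) * (C₁ + C₂), by positivity, ?_⟩
  intro N X μ r δ ν h hN hr hδ hμ hsep hθ hδN x
  have hN' : (0 : ℝ) < N := by exact_mod_cast hN
  have hδr : δ ≤ c * r := hδN.trans (h.rpow_le hd0 hN hr hμ)
  have hμ0 : μ {x} = 0 := le_antisymm ((hμ _).trans (by simp)) zero_le
  have hμ1 := h.measure_univ hN
  -- the retained discrete force and potential of the particle `j`
  set k : Fin N → Eucl d := fun j => if δ / 2 ≤ ‖x - X j‖ then K (x - X j) else 0 with hk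
  set p : Fin N → ℝ := fun j => if δ / 2 ≤ ‖x - X j‖ then ‖x - X j‖ ^ (-b) else 0 with hp
  have hp0 : ∀ j, 0 ≤ p j := fun j => by simp only [hp]; split_ifs <;> positivity
  have hpt : ∀ j, ∀ᵐ z ∂(ν j), ‖K (x - z) - k j‖ ≤
      Ck * ((1 + c) * r) * (‖x - z‖ ^ (-b) + p j) := by
    intro j
    have hxne : ∀ᵐ z ∂(ν j), z ≠ x := by
      rw [ae_iff]
      simp only [not_not]
      exact le_antisymm ((h.le j _).trans_eq hμ0) zero_le
    filter_upwards [h.near j, hxne] with z hz hzx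
    have hzx' : x - z ≠ 0 := sub_ne_zero.2 hzx.symm
    simp only [hk, hp]
    split_ifs with hj
    · have hxj : x - X j ≠ 0 := norm_pos_iff.1 (lt_of_lt_of_le (by positivity) hj)
      refine (hK.increment _ _ hzx' hxj).trans ?_
      have e : ‖x - z - (x - X j)‖ ≤ (1 + c) * r := by
        rw [show x - z - (x - X j) = X j - z by abel]
        nlinarith
      gcongr
    · rw [sub_zero, add_zero]
      refine (hK.size _ hzx').trans ?_
      have e : ‖x - z‖ ≤ (1 + c) * r := by
        have := norm_sub_le_norm_sub_add_norm_sub x (X j) z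
        push Not at hj
        linarith
      gcongr
  set B : ℝ := Ck * ((1 + c) * r) with hB
  have hB0 : 0 ≤ B := by positivity
  have hlin : ∀ j, ∫⁻ z, ‖K (x - z) - k j‖ₑ ∂(ν j) ≤ ENNReal.ofReal B *
      (∫⁻ z, ENNReal.ofReal (‖x - z‖ ^ (-b)) ∂(ν j) +
        ENNReal.ofReal ((1 / (N : ℝ)) * p j)) := by
    intro j
    calc ∫⁻ z, ‖K (x - z) - k j‖ₑ ∂(ν j) ≤
        ∫⁻ z, ENNReal.ofReal B * (ENNReal.ofReal (‖x - z‖ ^ (-b)) + ENNReal.ofReal (p j))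
          ∂(ν j) := by
          refine lintegral_mono_ae ?_
          filter_upwards [hpt j] with z hz
          rw [← ofReal_norm, ← ENNReal.ofReal_add (by positivity) (hp0 j),
            ← ENNReal.ofReal_mul hB0]
          exact ENNReal.ofReal_le_ofReal hz
      _ = _ := by
          rw [lintegral_const_mul _ (by fun_prop), lintegral_add_left (by fun_prop),
            lintegral_const, h.mass, one_div,
            ENNReal.ofReal_mul (by positivity : (0 : ℝ) ≤ (N : ℝ)⁻¹),
            ENNReal.ofReal_inv_of_pos hN', ENNReal.ofReal_natCast, mul_comm (ENNReal.ofReal (p j))]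
  have hfin : ∀ j, IsFiniteMeasure (ν j) := fun j =>
    ⟨(h.le j univ).trans_lt (by rw [hμ1]; exact ENNReal.one_lt_top)⟩
  have hint : ∀ j, Integrable (fun z => K (x - z)) (ν j) := by
    intro j
    have h1 : Integrable (fun z => K (x - z) - k j) (ν j) := by
      refine ⟨((hKm.comp (measurable_const.sub measurable_id)).sub_const _).aestronglyMeasurable,
        (hlin j).trans_lt ?_⟩
      refine ENNReal.mul_lt_top ENNReal.ofReal_lt_top (ENNReal.add_lt_top.2
        ⟨((lintegral_mono' (h.le j) le_rfl).trans (hpot μ hμ hμ1.le x)).trans_lt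
          ENNReal.ofReal_lt_top, ENNReal.ofReal_lt_top⟩)
    have h2 := h1.add (integrable_const (k j))
    simpa only [Pi.add_def, sub_add_cancel] using h2
  have hsumk : (1 / (N : ℝ)) • ∑ j with δ / 2 ≤ ‖x - X j‖, K (x - X j) =
      ∑ j, ∫ _, k j ∂(ν j) := by
    rw [Finset.sum_filter, Finset.smul_sum]
    refine Finset.sum_congr rfl fun j _ => ?_
    rw [integral_const, measureReal_def, h.mass, ENNReal.toReal_inv, ENNReal.toReal_natCast,
      one_div]
  have hmain : ∫ z, K (x - z) ∂μ - (1 / (N : ℝ)) • ∑ j with δ / 2 ≤ ‖x - X j‖, K (x - X j) =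
      ∑ j, ∫ z, (K (x - z) - k j) ∂(ν j) := by
    rw [hsumk, ← h.sum, integral_finsetSum_measure (fun j _ => hint j), ← Finset.sum_sub_distrib]
    exact Finset.sum_congr rfl fun j _ => (integral_sub (hint j) (integrable_const _)).symm
  rw [hmain]
  have hsump : (1 / (N : ℝ)) * ∑ j, p j ≤ C₂ := by
    simp only [hp, ← Finset.sum_filter]
    exact hdisc N X μ r δ ν h hN hr hδ hμ hsep hθ x
  rw [← ENNReal.ofReal_le_ofReal_iff (by positivity), ofReal_norm]
  calc ‖∑ j, ∫ z, (K (x - z) - k j) ∂(ν j)‖ₑ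
      ≤ ∑ j, ‖∫ z, (K (x - z) - k j) ∂(ν j)‖ₑ := enorm_sum_le _ _
    _ ≤ ∑ j, ENNReal.ofReal B * (∫⁻ z, ENNReal.ofReal (‖x - z‖ ^ (-b)) ∂(ν j) +
        ENNReal.ofReal ((1 / (N : ℝ)) * p j)) :=
        Finset.sum_le_sum fun j _ => (enorm_integral_le_lintegral_enorm _).trans (hlin j)
    _ = ENNReal.ofReal B * (∫⁻ z, ENNReal.ofReal (‖x - z‖ ^ (-b)) ∂μ +
        ENNReal.ofReal ((1 / (N : ℝ)) * ∑ j, p j)) := by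
        rw [← Finset.mul_sum, Finset.sum_add_distrib, ← lintegral_finsetSum_measure, h.sum,
          Finset.mul_sum, ENNReal.ofReal_sum_of_nonneg (fun j _ => by have := hp0 j; positivity)]
    _ ≤ ENNReal.ofReal B * (ENNReal.ofReal C₁ + ENNReal.ofReal C₂) := by
        gcongr
        exact hpot μ hμ hμ1.le x
    _ = _ := by
        rw [← ENNReal.ofReal_add hC₁.le hC₂.le, ← ENNReal.ofReal_mul hB0]
        congr 1
        rw [hB]; ring

/-! ### Flows of Carathéodory velocity fields -/

/-- A velocity field that is Lipschitz in space and merely measurable in time (the setting of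
Carathéodory differential equations). -/
structure IsVelocity {d : ℕ} (u : ℝ → Eucl d → Eucl d) (L B : ℝ) : Prop where
  nonneg : 0 ≤ L
  measurable : Measurable (Function.uncurry u)
  lipschitz : ∀ t x y, ‖u t x - u t y‖ ≤ L * ‖x - y‖
  bounded : ∀ t, ‖u t 0‖ ≤ B

namespace IsVelocity

variable {d : ℕ} {u : ℝ → Eucl d → Eucl d} {L B : ℝ}

theorem norm_le (hu : IsVelocity u L B) (t : ℝ) (x : Eucl d) : ‖u t x‖ ≤ B + L * ‖x‖ := by
  have h1 := hu.lipschitz t x 0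
  rw [sub_zero] at h1
  have h2 := norm_sub_norm_le (u t x) (u t 0)
  linarith [hu.bounded t]

theorem intervalIntegrable (hu : IsVelocity u L B) {Y : ℝ → Eucl d} (hY : Continuous Y)
    (a b : ℝ) : IntervalIntegrable (fun s => u s (Y s)) volume a b := by
  have hc : Continuous fun s => B + L * ‖Y s‖ := by fun_prop
  refine (hc.intervalIntegrable a b).mono_fun
    (hu.measurable.comp (measurable_id.prodMk hY.measurable)).aestronglyMeasurable
    (ae_of_all _ fun s => ?_)
  exact (hu.norm_le s (Y s)).trans (le_abs_self _)

/-- Carathéodory's existence theorem. With the weight `exp (-c t)`, `c = 2 L + 1`, the Picard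
operator is a contraction on the whole time interval. -/
theorem exists_trajectory (hu : IsVelocity u L B) {T : ℝ} (hT : 0 ≤ T) (y : Eucl d) :
    ∃ Y : ℝ → Eucl d, Continuous Y ∧
      ∀ t ∈ Icc 0 T, Y t = y + ∫ s in (0 : ℝ)..t, u s (Y s) := by
  have hL := hu.nonneg
  set c : ℝ := 2 * L + 1 with hc
  have hc0 : 0 < c := by positivity
  let ext : C(Icc 0 T, Eucl d) → ℝ → Eucl d := fun Z s => Real.exp (c * s) • IccExtend hT Z s
  have hext : ∀ Z, Continuous (ext Z) := fun Z => by
    have : Continuous (IccExtend hT Z) := Z.continuous.Icc_extend'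
    fun_prop
  let P : C(Icc 0 T, Eucl d) → C(Icc 0 T, Eucl d) := fun Z =>
    { toFun := fun t => Real.exp (-c * t) • (y + ∫ s in (0 : ℝ)..t, u s (ext Z s))
      continuous_toFun := by
        have h1 : Continuous fun t : ℝ => ∫ s in (0 : ℝ)..t, u s (ext Z s) :=
          intervalIntegral.continuous_primitive (fun a b => hu.intervalIntegrable (hext Z) a b) 0
        fun_prop }
  have hPapp : ∀ Z (t : Icc 0 T), P Z t =
      Real.exp (-c * t) • (y + ∫ s in (0 : ℝ)..t, u s (ext Z s)) := fun _ _ => rfl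
  have hexp : ∀ t : ℝ, (∫ s in (0 : ℝ)..t, Real.exp (c * s)) ≤ Real.exp (c * t) / c := by
    intro t
    have : (∫ s in (0 : ℝ)..t, Real.exp (c * s)) = Real.exp (c * t) / c - Real.exp (c * 0) / c := by
      refine intervalIntegral.integral_eq_sub_of_hasDerivAt (f := fun s => Real.exp (c * s) / c)
        (fun s _ => ?_) (Continuous.intervalIntegrable (by fun_prop) _ _)
      have h2 : HasDerivAt (fun s : ℝ => c * s) c s := by
        simpa using (hasDerivAt_id s).const_mul c
      have h3 := h2.exp.div_const c
      rwa [mul_div_assoc, div_self hc0.ne', mul_one] at h3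
    rw [this]
    have : 0 ≤ Real.exp (c * 0) / c := by positivity
    linarith
  have hP : ContractingWith (1 / 2) P := by
    refine ⟨by norm_num, LipschitzWith.of_dist_le_mul fun Z Z' => ?_⟩
    rw [ContinuousMap.dist_le (by positivity)]
    intro t
    have ht := t.2
    rw [dist_eq_norm]
    have h1 : P Z t - P Z' t = Real.exp (-c * t) •
        ∫ s in (0 : ℝ)..t, (u s (ext Z s) - u s (ext Z' s)) := by
      rw [hPapp, hPapp, ← smul_sub,
        intervalIntegral.integral_sub (hu.intervalIntegrable (hext Z) _ _)
          (hu.intervalIntegrable (hext Z') _ _)]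
      congr 1
      abel
    have h2 : ‖∫ s in (0 : ℝ)..t, (u s (ext Z s) - u s (ext Z' s))‖ ≤
        ∫ s in (0 : ℝ)..t, L * dist Z Z' * Real.exp (c * s) := by
      refine intervalIntegral.norm_integral_le_of_norm_le ht.1 (ae_of_all _ fun s _ => ?_)
        (Continuous.intervalIntegrable (by fun_prop) _ _)
      refine (hu.lipschitz _ _ _).trans ?_
      simp only [ext, ← smul_sub, norm_smul, Real.norm_eq_abs, Real.abs_exp]
      have h3 : ‖IccExtend hT Z s - IccExtend hT Z' s‖ ≤ dist Z Z' := by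
        rw [← dist_eq_norm]
        exact ContinuousMap.dist_apply_le_dist _
      calc L * (Real.exp (c * s) * _) ≤ L * (Real.exp (c * s) * dist Z Z') := by gcongr
        _ = _ := by ring
    rw [intervalIntegral.integral_const_mul] at h2
    rw [h1, norm_smul, Real.norm_eq_abs, Real.abs_exp]
    calc Real.exp (-c * t) * _ ≤
        Real.exp (-c * t) * (L * dist Z Z' * (Real.exp (c * t) / c)) := by
          gcongr
          exact h2.trans (by gcongr; exact hexp t)
      _ = (L / c) * dist Z Z' * (Real.exp (-c * t) * Real.exp (c * t)) := by ring
      _ = (L / c) * dist Z Z' := by rw [← Real.exp_add]; simp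
      _ ≤ ((1 / 2 : ℝ≥0) : ℝ) * dist Z Z' := by
          gcongr
          rw [div_le_iff₀ hc0]
          push_cast
          linarith
  have hfix := hP.fixedPoint_isFixedPt
  set Z := hP.fixedPoint P
  refine ⟨ext Z, hext Z, fun t ht => ?_⟩
  have h1 : Z ⟨t, ht⟩ = P Z ⟨t, ht⟩ := by rw [hfix]
  have h2 : IccExtend hT Z t = Z ⟨t, ht⟩ := IccExtend_of_mem _ _ ht
  change Real.exp (c * t) • IccExtend hT Z t = _
  rw [h2, h1, hPapp, smul_smul, ← Real.exp_add]
  simp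

/-- The forward flow of a velocity field, with its Lipschitz dependence on the initial point. -/
theorem exists_flow (hu : IsVelocity u L B) {T : ℝ} (hT : 0 ≤ T) :
    ∃ Φ : ℝ → Eucl d → Eucl d, (∀ y, Continuous fun t => Φ t y) ∧
      (∀ y, ∀ t ∈ Icc 0 T, Φ t y = y + ∫ s in (0 : ℝ)..t, u s (Φ s y)) ∧
      ∀ t ∈ Icc 0 T, ∀ y y', ‖Φ t y - Φ t y'‖ ≤ Real.exp (L * t) * ‖y - y'‖ := by
  choose Y hY hode using fun y => hu.exists_trajectory hT y
  refine ⟨fun t y => Y y t, hY, hode, fun t ht y y' => ?_⟩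
  have hcont : Continuous fun t => ‖Y y t - Y y' t‖ := by
    have h1 := hY y
    have h2 := hY y'
    fun_prop
  rw [mul_comm]
  refine le_mul_exp_of_continuous hu.nonneg ht.1 hcont fun s hs => ?_
  have hsT : s ∈ Icc 0 T := ⟨hs.1, hs.2.trans ht.2⟩
  have h1 : Y y s - Y y' s = (y - y') + ∫ x in (0 : ℝ)..s, (u x (Y y x) - u x (Y y' x)) := by
    rw [intervalIntegral.integral_sub (hu.intervalIntegrable (hY y) _ _)
      (hu.intervalIntegrable (hY y') _ _), hode y s hsT, hode y' s hsT]
    abel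
  rw [h1]
  refine (norm_add_le _ _).trans (add_le_add le_rfl ?_)
  rw [← intervalIntegral.integral_const_mul]
  refine intervalIntegral.norm_integral_le_of_norm_le hs.1
    (ae_of_all _ fun x _ => hu.lipschitz x _ _)
    ((hcont.const_mul L).intervalIntegrable _ _)

end IsVelocity

/-! ### Weak solutions of the continuity equation tested with moving functions -/

/-- A curve `m` of locally finite measures that solves `∂ₜ m + div (u m) = 0` on `[0,T]` in the
weak sense. Probability densities and Lebesgue measure are treated alike. -/
structure IsWeakSolution {d : ℕ} (u : ℝ → Eucl d → Eucl d) (m : ℝ → Measure (Eucl d))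
    (T : ℝ) : Prop where
  local_mass : ∀ R : ℝ, ∃ C : ℝ, 0 ≤ C ∧
    ∀ t ∈ Icc 0 T, m t (Metric.closedBall 0 R) ≤ ENNReal.ofReal C
  measurable_integral : ∀ h : ℝ → Eucl d → ℝ, Measurable (Function.uncurry h) →
    Measurable fun s => ∫ x, h s x ∂(m s)
  weak_eq : ∀ ψ : Eucl d → ℝ, ContDiff ℝ ∞ ψ → HasCompactSupport ψ → ∀ t ∈ Icc 0 T,
    ∫ x, ψ x ∂(m t) = ∫ x, ψ x ∂(m 0) +
      ∫ s in (0 : ℝ)..t, ∫ x, fderiv ℝ ψ x (u s x) ∂(m s)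

theorem norm_integral_le_of_support {d : ℕ} {m : Measure (Eucl d)} {R c C : ℝ} (hc : 0 ≤ c)
    (hC : 0 ≤ C) (hm : m (Metric.closedBall 0 R) ≤ ENNReal.ofReal C) {f : Eucl d → ℝ}
    (hf : ∀ x, ‖f x‖ ≤ c) (hf0 : ∀ x, R < ‖x‖ → f x = 0) : ‖∫ x, f x ∂m‖ ≤ c * C := by
  rw [← setIntegral_eq_integral_of_forall_compl_eq_zero (s := Metric.closedBall 0 R)
    (fun x hx => hf0 x (by simpa using hx))]
  refine (norm_setIntegral_le_of_norm_le_const (hm.trans_lt ENNReal.ofReal_lt_top)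
    (fun x _ => hf x)).trans ?_
  gcongr
  exact ENNReal.toReal_le_of_le_ofReal hC hm

theorem integrable_of_support {d : ℕ} {m : Measure (Eucl d)} {R c C : ℝ}
    (hm : m (Metric.closedBall 0 R) ≤ ENNReal.ofReal C) {F : Type*} [NormedAddCommGroup F]
    {f : Eucl d → F} (hfm : AEStronglyMeasurable f m)
    (hf : ∀ x, ‖f x‖ ≤ c) (hf0 : ∀ x, R < ‖x‖ → f x = 0) : Integrable f m := by
  rw [← integrableOn_iff_integrable_of_support_subset (s := Metric.closedBall 0 R)]
  · exact Measure.integrableOn_of_bounded (M := c) (hm.trans_lt ENNReal.ofReal_lt_top).ne hfm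
      (ae_of_all _ hf)
  · intro x hx
    by_contra h
    exact hx (hf0 x (by simpa using h))

/-- On a product of balls, a smooth function has a bounded and Lipschitz differential. -/
theorem exists_fderiv_bounds {P E : Type*} [NormedAddCommGroup P] [NormedSpace ℝ P]
    [FiniteDimensional ℝ P] [NormedAddCommGroup E] [NormedSpace ℝ E] [FiniteDimensional ℝ E]
    {G : P × E → ℝ} (hG : ContDiff ℝ ∞ G) (ρ R : ℝ) :
    ∃ A : ℝ, 0 ≤ A ∧
      (∀ z ∈ Metric.closedBall (0 : P) ρ ×ˢ Metric.closedBall (0 : E) R, ‖fderiv ℝ G z‖ ≤ A) ∧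
      ∀ z ∈ Metric.closedBall (0 : P) ρ ×ˢ Metric.closedBall (0 : E) R,
      ∀ z' ∈ Metric.closedBall (0 : P) ρ ×ˢ Metric.closedBall (0 : E) R,
        ‖fderiv ℝ G z - fderiv ℝ G z'‖ ≤ A * ‖z - z'‖ := by
  set S := Metric.closedBall (0 : P) ρ ×ˢ Metric.closedBall (0 : E) R
  have hS : IsCompact S := (isCompact_closedBall _ _).prod (isCompact_closedBall _ _)
  have hSc : Convex ℝ S := (convex_closedBall _ _).prod (convex_closedBall _ _)
  have h1 : ContDiff ℝ 1 (fderiv ℝ G) := hG.fderiv_right (by norm_cast)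
  obtain ⟨A₁, hA₁⟩ := hS.exists_bound_of_continuousOn h1.continuous.continuousOn
  obtain ⟨A₂, hA₂⟩ := hS.exists_bound_of_continuousOn
    (h1.continuous_fderiv (by norm_num)).continuousOn
  refine ⟨max 0 (max A₁ A₂), le_max_left _ _, fun z hz => (hA₁ z hz).trans (by simp),
    fun z hz z' hz' => ?_⟩
  exact hSc.norm_image_sub_le_of_norm_fderiv_le (𝕜 := ℝ)
    (fun w _ => (h1.differentiable (by norm_num)).differentiableAt)
    (fun w hw => (hA₂ w hw).trans (by simp)) hz' hz

/-- A function on `[0,T]` whose decrease over any interval is at most quadratic in the length of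
the interval does not decrease. -/
theorem le_of_quadratic_decrease {F : ℝ → ℝ} {C T t : ℝ}
    (h : ∀ a c, 0 ≤ a → a ≤ c → c ≤ T → -(C * (c - a) ^ 2) ≤ F c - F a) (ht : t ∈ Icc 0 T) :
    F 0 ≤ F t := by
  have hstep : ∀ n : ℕ, 0 < n → -(C * t ^ 2) * (1 / (n : ℝ)) ≤ F t - F 0 := by
    intro n hn
    have hn' : (0 : ℝ) < n := by exact_mod_cast hn
    have hk : ∀ k : ℕ, k ≤ n → -(C * (t / n) ^ 2) * k ≤ F (k * (t / n)) - F 0 := by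
      intro k
      induction k with
      | zero => intro _; simp
      | succ k ih =>
        intro hk
        have h1 := ih (by omega)
        have hkn : ((k + 1 : ℕ) : ℝ) ≤ n := by exact_mod_cast hk
        have htn : 0 ≤ t / n := div_nonneg ht.1 hn'.le
        have h2 := h (k * (t / n)) ((k + 1 : ℕ) * (t / n)) (by positivity)
          (by push_cast; nlinarith) (by
            calc ((k + 1 : ℕ) : ℝ) * (t / n) ≤ n * (t / n) := by gcongr
              _ = t := by field_simp
              _ ≤ T := ht.2)
        have h3 : ((k + 1 : ℕ) : ℝ) * (t / n) - k * (t / n) = t / n := by push_cast; ring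
        rw [h3] at h2
        push_cast at h2 ⊢
        linarith
    have h1 := hk n le_rfl
    have h2 : (n : ℝ) * (t / n) = t := by field_simp
    rw [h2] at h1
    refine le_trans (le_of_eq ?_) h1
    field_simp
  have hlim : Tendsto (fun n : ℕ => -(C * t ^ 2) * (1 / (n : ℝ))) atTop (𝓝 (-(C * t ^ 2) * 0)) :=
    tendsto_one_div_atTop_nhds_zero_nat.const_mul _
  rw [mul_zero] at hlim
  have h0 : (0 : ℝ) ≤ F t - F 0 :=
    le_of_tendsto hlim (by filter_upwards [eventually_gt_atTop 0] with n hn using hstep n hn)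
  linarith

variable {d : ℕ}

section

variable {u : ℝ → Eucl d → Eucl d} {L B T : ℝ} {m : ℝ → Measure (Eucl d)}

theorem IsWeakSolution.isFiniteMeasureOnCompacts (hm : IsWeakSolution u m T) {t : ℝ}
    (ht : t ∈ Icc 0 T) : IsFiniteMeasureOnCompacts (m t) := by
  refine ⟨fun S hS => ?_⟩
  obtain ⟨R, hR⟩ := hS.isBounded.subset_closedBall 0
  obtain ⟨C, -, hC⟩ := hm.local_mass R
  exact (measure_mono hR).trans_lt ((hC t ht).trans_lt ENNReal.ofReal_lt_top)

theorem hasCompactSupport_of_norm {F : Type*} [NormedAddCommGroup F] {f : Eucl d → F} {R : ℝ}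
    (h0 : ∀ x, R < ‖x‖ → f x = 0) : HasCompactSupport f :=
  HasCompactSupport.intro (isCompact_closedBall 0 R) fun x hx => h0 x (by simpa using hx)

theorem fderiv_eq_zero_of_norm {f : Eucl d → ℝ} {R : ℝ} (h0 : ∀ x, R < ‖x‖ → f x = 0)
    {x : Eucl d} (hx : R < ‖x‖) : fderiv ℝ f x = 0 := by
  have hev : f =ᶠ[𝓝 x] fun _ => 0 := by
    filter_upwards [continuous_norm.continuousAt.eventually (lt_mem_nhds hx)] with y hy
      using h0 y hy
  rw [hev.fderiv_eq]
  simp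

/-- The weak equation over a time interval, with the resulting Lipschitz bound in time. -/
theorem IsWeakSolution.integral_sub (hm : IsWeakSolution u m T) (hu : IsVelocity u L B)
    {ψ : Eucl d → ℝ} (hψ : ContDiff ℝ ∞ ψ) {R D U C : ℝ} (h0 : ∀ x, R < ‖x‖ → ψ x = 0)
    (hD0 : 0 ≤ D) (hD : ∀ x, ‖fderiv ℝ ψ x‖ ≤ D) (hU0 : 0 ≤ U)
    (hU : ∀ s x, ‖x‖ ≤ R → ‖u s x‖ ≤ U) (hC0 : 0 ≤ C)
    (hC : ∀ t ∈ Icc 0 T, m t (Metric.closedBall 0 R) ≤ ENNReal.ofReal C)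
    {a c : ℝ} (ha : 0 ≤ a) (hac : a ≤ c) (hc : c ≤ T) :
    IntervalIntegrable (fun s => ∫ x, fderiv ℝ ψ x (u s x) ∂(m s)) volume a c ∧
    ∫ x, ψ x ∂(m c) - ∫ x, ψ x ∂(m a) = ∫ s in a..c, ∫ x, fderiv ℝ ψ x (u s x) ∂(m s) ∧
    ‖∫ x, ψ x ∂(m c) - ∫ x, ψ x ∂(m a)‖ ≤ D * U * C * (c - a) := by
  have hb : ∀ s ∈ Icc 0 T, ‖∫ x, fderiv ℝ ψ x (u s x) ∂(m s)‖ ≤ D * U * C := by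
    intro s hs
    refine norm_integral_le_of_support (by positivity) hC0 (hC s hs) (fun x => ?_) (fun x hx => ?_)
    · by_cases hx : ‖x‖ ≤ R
      · exact (ContinuousLinearMap.le_of_opNorm_le_of_le _ (hD x) (hU s x hx))
      · rw [fderiv_eq_zero_of_norm h0 (not_le.1 hx)]
        simp only [zero_apply, norm_zero]
        positivity
    · rw [fderiv_eq_zero_of_norm h0 hx]; simp
  have hmeas : Measurable fun s => ∫ x, fderiv ℝ ψ x (u s x) ∂(m s) := by
    refine hm.measurable_integral _ ?_
    have hcont : Continuous fun z : Eucl d × Eucl d => fderiv ℝ ψ z.1 z.2 := by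
      have := hψ.continuous_fderiv (by simp)
      fun_prop
    exact hcont.measurable.comp (measurable_snd.prodMk hu.measurable)
  have hint : ∀ a c, 0 ≤ a → a ≤ c → c ≤ T →
      IntervalIntegrable (fun s => ∫ x, fderiv ℝ ψ x (u s x) ∂(m s)) volume a c := by
    intro a c ha hac hc
    refine (intervalIntegrable_const (c := D * U * C)).mono_fun hmeas.aestronglyMeasurable ?_
    refine (ae_restrict_mem measurableSet_uIoc).mono fun s hs => ?_
    rw [uIoc_of_le hac] at hs
    exact (hb s ⟨ha.trans hs.1.le, hs.2.trans hc⟩).trans (le_abs_self _)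
  have heq : ∫ x, ψ x ∂(m c) - ∫ x, ψ x ∂(m a) =
      ∫ s in a..c, ∫ x, fderiv ℝ ψ x (u s x) ∂(m s) := by
    have hcs := hasCompactSupport_of_norm h0
    rw [hm.weak_eq ψ hψ hcs c ⟨ha.trans hac, hc⟩, hm.weak_eq ψ hψ hcs a ⟨ha, hac.trans hc⟩,
      ← intervalIntegral.integral_interval_sub_left (hint 0 c le_rfl (ha.trans hac) hc)
        (hint 0 a le_rfl ha (hac.trans hc))]
    abel
  refine ⟨hint a c ha hac hc, heq, ?_⟩
  rw [heq]
  have := intervalIntegral.norm_integral_le_of_norm_le_const (a := a) (b := c)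
    (f := fun s => ∫ x, fderiv ℝ ψ x (u s x) ∂(m s)) (C := D * U * C) (fun s hs => by
      rw [uIoc_of_le hac] at hs
      exact hb s ⟨ha.trans hs.1.le, hs.2.trans hc⟩)
  rwa [abs_of_nonneg (sub_nonneg.2 hac)] at this

/-- Integrals of a smooth test function that moves with finitely many parameters `p` do not
decrease if the test function does not decrease along the velocity field. Over an interval of
length `h`, the parameters and the measure can be frozen at the cost of an error `O(h^2)`. -/
theorem IsWeakSolution.exists_increment_ge (hm : IsWeakSolution u m T) (hu : IsVelocity u L B)
    {P : Type*} [NormedAddCommGroup P] [NormedSpace ℝ P] [FiniteDimensional ℝ P]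
    [MeasurableSpace P] [BorelSpace P] {G : P × Eucl d → ℝ} (hG : ContDiff ℝ ∞ G)
    {p v : ℝ → P} {ρ R V : ℝ}
    (hsupp : ∀ q ∈ Metric.ball (0 : P) ρ, ∀ x, R < ‖x‖ → G (q, x) = 0)
    (hp : ∀ s ∈ Icc 0 T, p s ∈ Metric.ball (0 : P) ρ) (hv : Measurable v)
    (hV0 : 0 ≤ V) (hV : ∀ s ∈ Icc 0 T, ‖v s‖ ≤ V)
    (hpv : ∀ s ∈ Icc 0 T, p s = p 0 + ∫ x in (0 : ℝ)..s, v x)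
    (hsign : ∀ s ∈ Icc 0 T, ∀ x, 0 ≤ fderiv ℝ G (p s, x) (v s, u s x)) :
    ∃ C : ℝ, ∀ a c, 0 ≤ a → a ≤ c → c ≤ T →
      -(C * (c - a) ^ 2) ≤ ∫ x, G (p c, x) ∂(m c) - ∫ x, G (p a, x) ∂(m a) := by
  obtain ⟨A, hA0, hA1, hA2⟩ := exists_fderiv_bounds hG ρ (R + 1)
  obtain ⟨Cm, hCm0, hCm⟩ := hm.local_mass R
  set U : ℝ := |B| + L * |R| with hU
  have hL := hu.nonneg
  have hU0 : 0 ≤ U := by positivity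
  have hUb : ∀ s x, ‖x‖ ≤ R → ‖u s x‖ ≤ U := fun s x hx => by
    refine (hu.norm_le s x).trans ?_
    have h1 := le_abs_self B
    have h2 : ‖x‖ ≤ |R| := hx.trans (le_abs_self R)
    have h3 : L * ‖x‖ ≤ L * |R| := by gcongr
    linarith
  have hGd : ∀ z, DifferentiableAt ℝ G z := fun z => (hG.differentiable (by simp)).differentiableAt
  have hG'c : Continuous (fderiv ℝ G) := hG.continuous_fderiv (by simp)
  -- outside the ball of radius `R` the differential vanishes as well
  have hzero : ∀ q ∈ Metric.ball (0 : P) ρ, ∀ x, R < ‖x‖ → fderiv ℝ G (q, x) = 0 := by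
    intro q hq x hx
    have hev : G =ᶠ[𝓝 (q, x)] fun _ => 0 := by
      have h1 : ∀ᶠ z : P × Eucl d in 𝓝 (q, x), z.1 ∈ Metric.ball (0 : P) ρ :=
        continuous_fst.continuousAt.eventually (Metric.isOpen_ball.mem_nhds hq)
      have h2 : ∀ᶠ z : P × Eucl d in 𝓝 (q, x), R < ‖z.2‖ :=
        (continuous_snd.norm).continuousAt.eventually (lt_mem_nhds hx)
      filter_upwards [h1, h2] with z hz1 hz2 using hsupp z.1 hz1 z.2 hz2
    rw [hev.fderiv_eq]
    simp
  have hmemS : ∀ q ∈ Metric.ball (0 : P) ρ, ∀ x : Eucl d, ‖x‖ ≤ R + 1 →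
      (q, x) ∈ Metric.closedBall (0 : P) ρ ×ˢ Metric.closedBall (0 : Eucl d) (R + 1) :=
    fun q hq x hx => ⟨Metric.ball_subset_closedBall hq, by simpa using hx⟩
  have hvint : ∀ a c, 0 ≤ a → a ≤ c → c ≤ T → IntervalIntegrable v volume a c := by
    intro a c ha hac hc
    refine (intervalIntegrable_const (c := V)).mono_fun hv.aestronglyMeasurable ?_
    refine (ae_restrict_mem measurableSet_uIoc).mono fun s hs => ?_
    rw [uIoc_of_le hac] at hs
    exact (hV s ⟨ha.trans hs.1.le, hs.2.trans hc⟩).trans (le_abs_self V)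
  have hpdiff : ∀ a c, 0 ≤ a → a ≤ c → c ≤ T → p c - p a = ∫ s in a..c, v s := by
    intro a c ha hac hc
    rw [hpv c ⟨ha.trans hac, hc⟩, hpv a ⟨ha, hac.trans hc⟩,
      ← intervalIntegral.integral_interval_sub_left (hvint 0 c le_rfl (ha.trans hac) hc)
        (hvint 0 a le_rfl ha (hac.trans hc))]
    abel
  have hpLip : ∀ a c, 0 ≤ a → a ≤ c → c ≤ T → ‖p c - p a‖ ≤ V * (c - a) := by
    intro a c ha hac hc
    rw [hpdiff a c ha hac hc]
    have := intervalIntegral.norm_integral_le_of_norm_le_const (a := a) (b := c) (f := v) (C := V)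
      (fun s hs => by
        rw [uIoc_of_le hac] at hs
        exact hV s ⟨ha.trans hs.1.le, hs.2.trans hc⟩)
    rwa [abs_of_nonneg (sub_nonneg.2 hac)] at this
  refine ⟨A * V * V * Cm + A * V * U * Cm + A * V * (V + U) * Cm, fun a c ha hac hc => ?_⟩
  have haT : a ∈ Icc 0 T := ⟨ha, hac.trans hc⟩
  have hcT : c ∈ Icc 0 T := ⟨ha.trans hac, hc⟩
  have hsT : ∀ s ∈ Icc a c, s ∈ Icc 0 T := fun s hs => ⟨ha.trans hs.1, hs.2.trans hc⟩
  have := hm.isFiniteMeasureOnCompacts hcT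
  have hh : 0 ≤ c - a := sub_nonneg.2 hac
  set q := p a with hqdef
  have hq : q ∈ Metric.ball (0 : P) ρ := hp a haT
  -- the test function with parameters frozen at time `a`
  set g : Eucl d → ℝ := fun x => G (q, x) with hg
  have hgC : ContDiff ℝ ∞ g := hG.comp (contDiff_prodMk_right q)
  have hg0 : ∀ x, R < ‖x‖ → g x = 0 := hsupp q hq
  have hg' : ∀ x w, fderiv ℝ g x w = fderiv ℝ G (q, x) (0, w) := by
    intro x w
    have h1 : HasFDerivAt g _ x := (hGd (q, x)).hasFDerivAt.comp x (hasFDerivAt_prodMk_right q x)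
    rw [h1.fderiv]
    simp
  have hgb : ∀ x, ‖fderiv ℝ g x‖ ≤ A := by
    intro x
    by_cases hx : ‖x‖ ≤ R
    · refine ContinuousLinearMap.opNorm_le_bound _ hA0 fun w => ?_
      rw [hg']
      refine (ContinuousLinearMap.le_of_opNorm_le _ (hA1 _ (hmemS q hq x (by linarith))) _).trans ?_
      rw [Prod.norm_mk, norm_zero, max_eq_right (norm_nonneg _)]
    · rw [fderiv_eq_zero_of_norm hg0 (not_le.1 hx), norm_zero]
      exact hA0
  -- the derivative of the test function in the direction `w` of the parameters
  set ψ : P → Eucl d → ℝ := fun w x => fderiv ℝ G (q, x) (w, 0) with hψ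
  have hψC : ∀ w, ContDiff ℝ ∞ (ψ w) := fun w => by
    have h1 : ContDiff ℝ ∞ (fderiv ℝ G) := hG.fderiv_right (by simp)
    exact (h1.comp (contDiff_prodMk_right q)).clm_apply contDiff_const
  have hψ0 : ∀ w x, R < ‖x‖ → ψ w x = 0 := fun w x hx => by
    simp only [hψ, hzero q hq x hx, zero_apply]
  have hψb : ∀ w x, ‖fderiv ℝ (ψ w) x‖ ≤ A * ‖w‖ := by
    intro w x
    by_cases hx : ‖x‖ < R + 1
    · refine norm_fderiv_le_of_lip' ℝ (by positivity) ?_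
      filter_upwards [continuous_norm.continuousAt.eventually (gt_mem_nhds hx)] with y hy
      have h1 := hA2 _ (hmemS q hq y hy.le) _ (hmemS q hq x hx.le)
      rw [Prod.mk_sub_mk, sub_self, Prod.norm_mk, norm_zero, max_eq_right (norm_nonneg _)] at h1
      simp only [hψ]
      rw [← sub_apply]
      refine (ContinuousLinearMap.le_of_opNorm_le _ h1 _).trans_eq ?_
      rw [Prod.norm_mk, norm_zero, max_eq_left (norm_nonneg _)]
      ring
    · rw [fderiv_eq_zero_of_norm (hψ0 w) (by linarith), norm_zero]
      positivity
  set δ := p c - q with hδ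
  have hδb : ‖δ‖ ≤ V * (c - a) := hpLip a c ha hac hc
  -- Taylor expansion in the parameters
  have hpc : p c ∈ Metric.ball (0 : P) ρ := hp c hcT
  have hGint : ∀ q' ∈ Metric.ball (0 : P) ρ, Integrable (fun x => G (q', x)) (m c) := fun q' hq' =>
    (hG.continuous.comp (by fun_prop : Continuous fun x : Eucl d => (q', x))
      ).integrable_of_hasCompactSupport (hasCompactSupport_of_norm (hsupp q' hq'))
  have hψint : ∀ w, Integrable (ψ w) (m c) := fun w =>
    (hψC w).continuous.integrable_of_hasCompactSupport (hasCompactSupport_of_norm (hψ0 w))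
  have hT1 : ‖∫ x, G (p c, x) ∂(m c) - ∫ x, g x ∂(m c) - ∫ x, ψ δ x ∂(m c)‖ ≤
      A * (V * (c - a)) * (V * (c - a)) * Cm := by
    rw [← MeasureTheory.integral_sub (hGint _ hpc) (hGint _ hq),
      ← MeasureTheory.integral_sub (f := fun x => G (p c, x) - G (q, x))
        ((hGint _ hpc).sub (hGint _ hq)) (hψint δ)]
    refine norm_integral_le_of_support (by positivity) hCm0 (hCm c hcT) (fun x => ?_)
      (fun x hx => ?_)
    · by_cases hx : ‖x‖ ≤ R
      · set S := (Metric.closedBall (0 : P) ρ ×ˢ Metric.closedBall (0 : Eucl d) (R + 1)) ∩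
          Metric.closedBall (q, x) ‖δ‖
        have hSc : Convex ℝ S :=
          ((convex_closedBall _ _).prod (convex_closedBall _ _)).inter (convex_closedBall _ _)
        have hxR : ‖x‖ ≤ R + 1 := by linarith
        have h1 := hSc.norm_image_sub_le_of_norm_fderiv_le' (𝕜 := ℝ) (f := G)
          (φ := fderiv ℝ G (q, x)) (C := A * ‖δ‖) (fun z _ => hGd z) (fun z hz => by
            refine (hA2 z hz.1 _ (hmemS q hq x hxR)).trans ?_
            have := mem_closedBall_iff_norm.1 hz.2
            gcongr)
          (x := (q, x)) (y := (p c, x))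
          ⟨hmemS q hq x hxR, Metric.mem_closedBall_self (norm_nonneg _)⟩
          ⟨hmemS _ hpc x hxR, by
            rw [mem_closedBall_iff_norm, Prod.mk_sub_mk, sub_self, Prod.norm_mk, norm_zero,
              max_eq_left (norm_nonneg _)]⟩
        rw [Prod.mk_sub_mk, sub_self, Prod.norm_mk, norm_zero, max_eq_left (norm_nonneg _)] at h1
        refine h1.trans ?_
        gcongr
      · rw [hsupp _ hpc x (not_le.1 hx), hsupp _ hq x (not_le.1 hx), hψ0 δ x (not_le.1 hx)]
        simp only [sub_self, norm_zero]
        positivity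
    · rw [hsupp _ hpc x hx, hsupp _ hq x hx, hψ0 δ x hx]; simp
  -- the increment of the parameters is the integral of their velocity
  have hT2 : ∫ x, ψ δ x ∂(m c) = ∫ s in a..c, ∫ x, ψ (v s) x ∂(m c) ∧
      IntervalIntegrable (fun s => ∫ x, ψ (v s) x ∂(m c)) volume a c := by
    set Λ : Eucl d → P →L[ℝ] ℝ := fun x => (fderiv ℝ G (q, x)).comp
      (ContinuousLinearMap.inl ℝ P (Eucl d)) with hΛ
    have hΛc : Continuous Λ := by fun_prop
    have hΛi : Integrable Λ (m c) := hΛc.integrable_of_hasCompactSupport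
      (hasCompactSupport_of_norm (R := R) fun x hx => by
        simp only [hΛ, hzero q hq x hx, ContinuousLinearMap.zero_comp])
    have hl : ∀ w, ∫ x, ψ w x ∂(m c) = (∫ x, Λ x ∂(m c)) w := fun w => by
      rw [ContinuousLinearMap.integral_apply hΛi]
      rfl
    simp only [hl]
    rw [hδ, hpdiff a c ha hac hc]
    exact ⟨((∫ x, Λ x ∂(m c)).intervalIntegral_comp_comm (hvint a c ha hac hc)).symm,
      ContinuousLinearMap.integrable_comp _ (hvint a c ha hac hc).1,
      ContinuousLinearMap.integrable_comp _ (hvint a c ha hac hc).2⟩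
  obtain ⟨hI2, hT4, -⟩ := hm.integral_sub hu hgC hg0 hA0 hgb hU0 hUb hCm0 hCm ha hac hc
  -- lower bound of the integrand
  have hlow : ∀ s ∈ Icc a c, -((A * V * U * Cm + A * V * (V + U) * Cm) * (c - a)) ≤
      ∫ x, ψ (v s) x ∂(m c) + ∫ x, fderiv ℝ g x (u s x) ∂(m s) := by
    intro s hs
    have hs' := hsT s hs
    have := hm.isFiniteMeasureOnCompacts hs'
    have hsa : s - a ≤ c - a := by linarith [hs.2]
    have hsa0 : 0 ≤ s - a := by linarith [hs.1]
    obtain ⟨-, -, h3⟩ := hm.integral_sub hu (hψC (v s)) (hψ0 (v s)) (by positivity) (hψb (v s))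
      hU0 hUb hCm0 hCm hs'.1 hs.2 hc
    have h3' : ‖∫ x, ψ (v s) x ∂(m c) - ∫ x, ψ (v s) x ∂(m s)‖ ≤ A * V * U * Cm * (c - a) := by
      refine h3.trans ?_
      have := hV s hs'
      have : c - s ≤ c - a := by linarith [hs.1]
      gcongr
      exact sub_nonneg.2 hs.2
    have hus : Measurable (u s) := hu.measurable.comp (measurable_const.prodMk measurable_id)
    have hmeas : ∀ q', Measurable fun x => fderiv ℝ G (q', x) (v s, u s x) := fun q' => by
      have hcc : Continuous fun z : Eucl d × Eucl d => fderiv ℝ G (q', z.1) (v s, z.2) := by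
        fun_prop
      exact hcc.measurable.comp (measurable_id.prodMk hus)
    have hvu : ∀ x, ‖x‖ ≤ R → ‖(v s, u s x)‖ ≤ V + U := fun x hx => by
      rw [Prod.norm_mk]
      exact max_le ((hV s hs').trans (by linarith)) ((hUb s x hx).trans (by linarith))
    have hi : ∀ q' ∈ Metric.ball (0 : P) ρ,
        Integrable (fun x => fderiv ℝ G (q', x) (v s, u s x)) (m s) := by
      intro q' hq'
      refine integrable_of_support (R := R) (c := A * (V + U)) (hCm s hs')
        (hmeas q').aestronglyMeasurable (fun x => ?_) (fun x hx => by rw [hzero q' hq' x hx]; simp)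
      by_cases hx : ‖x‖ ≤ R
      · exact ContinuousLinearMap.le_of_opNorm_le_of_le _ (hA1 _ (hmemS q' hq' x (by linarith)))
          (hvu x hx)
      · rw [hzero q' hq' x (not_le.1 hx)]
        simp only [zero_apply, norm_zero]
        positivity
    have hsum : ∫ x, ψ (v s) x ∂(m s) + ∫ x, fderiv ℝ g x (u s x) ∂(m s) =
        ∫ x, fderiv ℝ G (q, x) (v s, u s x) ∂(m s) := by
      have h5 : Integrable (ψ (v s)) (m s) :=
        (hψC (v s)).continuous.integrable_of_hasCompactSupport
          (hasCompactSupport_of_norm (hψ0 (v s)))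
      have hpt : ∀ x, fderiv ℝ g x (u s x) = fderiv ℝ G (q, x) (v s, u s x) - ψ (v s) x := by
        intro x
        rw [hg', hψ, ← map_sub]
        simp
      simp only [hpt]
      rw [MeasureTheory.integral_sub (hi q hq) h5]
      ring
    have hps := hp s hs'
    have hdiff : ‖∫ x, fderiv ℝ G (q, x) (v s, u s x) ∂(m s) -
        ∫ x, fderiv ℝ G (p s, x) (v s, u s x) ∂(m s)‖ ≤ A * (V * (c - a)) * (V + U) * Cm := by
      rw [← MeasureTheory.integral_sub (hi q hq) (hi _ hps)]
      refine norm_integral_le_of_support (by positivity) hCm0 (hCm s hs') (fun x => ?_)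
        (fun x hx => by rw [hzero q hq x hx, hzero _ hps x hx]; simp)
      rw [← sub_apply]
      by_cases hx : ‖x‖ ≤ R
      · refine ContinuousLinearMap.le_of_opNorm_le_of_le _ ?_ (hvu x hx)
        refine (hA2 _ (hmemS q hq x (by linarith)) _ (hmemS _ hps x (by linarith))).trans ?_
        rw [Prod.mk_sub_mk, sub_self, Prod.norm_mk, norm_zero, max_eq_left (norm_nonneg _),
          norm_sub_rev]
        have h6 := hpLip a s ha hs.1 hs'.2
        have h7 : V * (s - a) ≤ V * (c - a) := by gcongr
        gcongr
        exact h6.trans h7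
      · rw [hzero q hq x (not_le.1 hx), hzero _ hps x (not_le.1 hx)]
        simp only [sub_self, zero_apply, norm_zero]
        positivity
    have hpos : 0 ≤ ∫ x, fderiv ℝ G (p s, x) (v s, u s x) ∂(m s) :=
      integral_nonneg fun x => hsign s hs' x
    have e1 := abs_le.1 h3'
    have e2 := abs_le.1 hdiff
    linarith [e1.1, e2.1]
  have hint : -((A * V * U * Cm + A * V * (V + U) * Cm) * (c - a)) * (c - a) ≤
      ∫ s in a..c, (∫ x, ψ (v s) x ∂(m c) + ∫ x, fderiv ℝ g x (u s x) ∂(m s)) := by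
    have h1 := intervalIntegral.integral_mono_on hac (μ := volume)
      (intervalIntegrable_const (c := -((A * V * U * Cm + A * V * (V + U) * Cm) * (c - a))))
      (hT2.2.add hI2) hlow
    rw [intervalIntegral.integral_const, smul_eq_mul] at h1
    rwa [mul_comm]
  rw [intervalIntegral.integral_add hT2.2 hI2, ← hT2.1, ← hT4] at hint
  have e1 := abs_le.1 hT1
  nlinarith [e1.1]

end

/-! ### Comparison of masses along the flow -/

/-- A smooth function that equals `1` on a union of balls and vanishes outside the union of the
balls of twice the radius. The parameters are the centres `q.1` and a number `q.2`, the radius being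
`exp (-q.2 / 2)`; the logarithmic scale keeps the balls bounded for bounded parameters. -/
noncomputable def ballBump {ι : Type} [Fintype ι] (z : ((ι → Eucl d) × ℝ) × Eucl d) : ℝ :=
  Real.smoothTransition (∑ i, Real.smoothTransition (2 - Real.exp z.1.2 * ‖z.2 - z.1.1 i‖ ^ 2))

section

variable {ι : Type} [Fintype ι]

theorem contDiff_ballBump : ContDiff ℝ ∞ (ballBump (d := d) (ι := ι)) := by
  have h : ContDiff ℝ ∞ Real.smoothTransition := Real.smoothTransition.contDiff
  refine h.comp (ContDiff.sum fun i _ => h.comp (contDiff_const.sub (ContDiff.mul ?_ ?_)))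
  · exact Real.contDiff_exp.comp (contDiff_snd.comp contDiff_fst)
  · refine ContDiff.norm_sq ℝ (contDiff_snd.sub ?_)
    exact (contDiff_apply ℝ (Eucl d) i).comp (contDiff_fst.comp contDiff_fst)

theorem ballBump_eq_one {q : (ι → Eucl d) × ℝ} {x : Eucl d} (i : ι)
    (h : Real.exp q.2 * ‖x - q.1 i‖ ^ 2 ≤ 1) : ballBump (q, x) = 1 := by
  refine Real.smoothTransition.one_of_one_le ?_
  have h1 : Real.smoothTransition (2 - Real.exp q.2 * ‖x - q.1 i‖ ^ 2) = 1 :=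
    Real.smoothTransition.one_of_one_le (by linarith)
  rw [← h1]
  exact Finset.single_le_sum (f := fun i => Real.smoothTransition
    (2 - Real.exp q.2 * ‖x - q.1 i‖ ^ 2)) (fun i _ => Real.smoothTransition.nonneg _)
    (Finset.mem_univ i)

theorem ballBump_eq_zero {q : (ι → Eucl d) × ℝ} {x : Eucl d}
    (h : ∀ i, 2 ≤ Real.exp q.2 * ‖x - q.1 i‖ ^ 2) : ballBump (q, x) = 0 := by
  refine Real.smoothTransition.zero_of_nonpos (le_of_eq (Finset.sum_eq_zero fun i _ => ?_))
  exact Real.smoothTransition.zero_of_nonpos (by linarith [h i])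

theorem ballBump_eq_zero_of_norm {ρ : ℝ} {q : (ι → Eucl d) × ℝ} (hq : q ∈ Metric.ball 0 ρ)
    {x : Eucl d} (hx : ρ + 2 * Real.exp ρ < ‖x‖) : ballBump (q, x) = 0 := by
  refine ballBump_eq_zero fun i => ?_
  rw [mem_ball_zero_iff] at hq
  have h1 : ‖q.1 i‖ ≤ ‖q‖ := (norm_le_pi_norm q.1 i).trans (norm_fst_le q)
  have h2 : |q.2| ≤ ‖q‖ := norm_snd_le q
  have h3 : 2 * Real.exp ρ ≤ ‖x - q.1 i‖ := by
    have := norm_sub_norm_le x (q.1 i)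
    linarith
  have h4 : Real.exp (-ρ) ≤ Real.exp q.2 := Real.exp_le_exp.2 (by linarith [neg_abs_le q.2])
  have hρ : 0 ≤ ρ := (norm_nonneg q).trans hq.le
  have h5 : 1 ≤ Real.exp ρ := Real.one_le_exp hρ
  calc (2 : ℝ) ≤ 4 * Real.exp ρ := by linarith
    _ = Real.exp (-ρ) * (2 * Real.exp ρ) ^ 2 := by
      have : Real.exp (-ρ) * Real.exp ρ = 1 := by rw [← Real.exp_add]; simp
      linear_combination (-4 * Real.exp ρ) * this
    _ ≤ Real.exp q.2 * ‖x - q.1 i‖ ^ 2 := by gcongr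

/-- If the squared distances to the centres, in units of the squared radius, are not increasing
along a direction, then the bump function is not decreasing along it. -/
theorem fderiv_ballBump_nonneg {L : ℝ} {q : (ι → Eucl d) × ℝ} {x w : Eucl d} {v : ι → Eucl d}
    (h : ∀ i, ‖w - v i‖ ≤ L * ‖x - q.1 i‖) :
    0 ≤ fderiv ℝ ballBump (q, x) ((v, -2 * L), w) := by
  have hG := ((contDiff_ballBump (d := d) (ι := ι)).differentiable (by simp)).differentiableAt
    (x := (q, x))
  have hline : HasDerivAt (fun s : ℝ => (q, x) + s • (((v, -2 * L), w) :
      ((ι → Eucl d) × ℝ) × Eucl d)) ((v, -2 * L), w) 0 := by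
    simpa using ((hasDerivAt_id (0 : ℝ)).smul_const
      (((v, -2 * L), w) : ((ι → Eucl d) × ℝ) × Eucl d)).const_add (q, x)
  have h1 : HasDerivAt (fun s : ℝ => ballBump ((q, x) + s • (((v, -2 * L), w) :
      ((ι → Eucl d) × ℝ) × Eucl d))) (fderiv ℝ ballBump (q, x) ((v, -2 * L), w)) 0 := by
    refine HasFDerivAt.comp_hasDerivAt (0 : ℝ) (l := ballBump) (l' := fderiv ℝ ballBump (q, x))
      ?_ hline
    simpa using hG.hasFDerivAt
  have hH : ∀ y, HasDerivAt Real.smoothTransition (deriv Real.smoothTransition y) y := fun y =>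
    ((Real.smoothTransition.contDiffAt (n := 1)).differentiableAt (by simp)).hasDerivAt
  have hH0 : ∀ y, 0 ≤ deriv Real.smoothTransition y := fun y =>
    Real.smoothTransition.monotone.deriv_nonneg
  have hq : ∀ i, HasDerivAt (fun s : ℝ => Real.exp (q.2 + s * (-2 * L)) *
      ‖(x + s • w) - (q.1 i + s • v i)‖ ^ 2)
      (Real.exp q.2 * (-2 * L) * ‖x - q.1 i‖ ^ 2 +
        Real.exp q.2 * (2 * inner ℝ (x - q.1 i) (w - v i))) 0 := by
    intro i
    have e1 : HasDerivAt (fun s : ℝ => q.2 + s * (-2 * L)) (-2 * L) 0 := by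
      simpa using ((hasDerivAt_id (0 : ℝ)).mul_const (-2 * L)).const_add q.2
    have e2 : HasDerivAt (fun s : ℝ => (x + s • w) - (q.1 i + s • v i)) (w - v i) 0 := by
      have a1 := ((hasDerivAt_id (0 : ℝ)).smul_const w).const_add x
      have a2 := ((hasDerivAt_id (0 : ℝ)).smul_const (v i)).const_add (q.1 i)
      simpa using a1.fun_sub a2
    have := e1.exp.fun_mul e2.norm_sq
    simpa using this
  have hqneg : ∀ i, Real.exp q.2 * (-2 * L) * ‖x - q.1 i‖ ^ 2 +
        Real.exp q.2 * (2 * inner ℝ (x - q.1 i) (w - v i)) ≤ 0 := by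
    intro i
    have e1 : inner ℝ (x - q.1 i) (w - v i) ≤ ‖x - q.1 i‖ * (L * ‖x - q.1 i‖) :=
      (real_inner_le_norm _ _).trans (by gcongr; exact h i)
    have e2 := Real.exp_pos q.2
    nlinarith
  have h2 := (HasDerivAt.fun_sum (u := Finset.univ) fun i _ =>
    (hH _).comp (0 : ℝ) ((hq i).const_sub 2))
  have h3 := (hH _).comp (0 : ℝ) h2
  have h4 := h1.unique h3
  rw [h4]
  refine mul_nonneg (hH0 _) (Finset.sum_nonneg fun i _ => mul_nonneg (hH0 _) ?_)
  linarith [hqneg i]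

end

section

variable {u : ℝ → Eucl d → Eucl d} {L B T : ℝ} {m : ℝ → Measure (Eucl d)}

/-- A union of balls about trajectories whose radii grow like `exp (L t)` loses no mass, up to a
factor `2` in the radius. -/
theorem IsWeakSolution.measure_iUnion_ball_le (hm : IsWeakSolution u m T) (hu : IsVelocity u L B)
    {ι : Type} [Fintype ι] {Y : ι → ℝ → Eucl d} (hY : ∀ i, Continuous (Y i))
    (hode : ∀ i, ∀ t ∈ Icc 0 T, Y i t = Y i 0 + ∫ s in (0 : ℝ)..t, u s (Y i s))
    {ρ t : ℝ} (hρ : 0 < ρ) (ht : t ∈ Icc 0 T) :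
    m 0 (⋃ i, Metric.closedBall (Y i 0) ρ) ≤
      m t (⋃ i, Metric.closedBall (Y i t) (2 * ρ * Real.exp (L * t))) := by
  have hT : 0 ≤ T := ht.1.trans ht.2
  set k : ℝ := -2 * Real.log ρ with hk
  set p : ℝ → (ι → Eucl d) × ℝ := fun s => (fun i => Y i s, k + s * (-2 * L)) with hp
  set v : ℝ → (ι → Eucl d) × ℝ := fun s => (fun i => u s (Y i s), -2 * L) with hv
  have hpc : Continuous p := by
    refine Continuous.prodMk (continuous_pi hY) (by fun_prop)
  obtain ⟨ρ', hρ'⟩ := isCompact_Icc.exists_bound_of_continuousOn (s := Icc 0 T) hpc.continuousOn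
  have hYc : Continuous fun s => ∑ i, (|B| + L * ‖Y i s‖) := by
    have := hY
    fun_prop
  obtain ⟨V, hV⟩ := isCompact_Icc.exists_bound_of_continuousOn (s := Icc 0 T) hYc.continuousOn
  have hL := hu.nonneg
  have hvV : ∀ s ∈ Icc 0 T, ‖v s‖ ≤ max V (2 * L) := by
    intro s hs
    rw [hv, Prod.norm_mk]
    refine max_le_max ?_ ?_
    · refine (pi_norm_le_iff_of_nonneg ((norm_nonneg _).trans (hV s hs))).2 fun i => ?_
      calc ‖u s (Y i s)‖ ≤ |B| + L * ‖Y i s‖ :=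
            (hu.norm_le _ _).trans (by gcongr; exact le_abs_self B)
        _ ≤ ∑ i, (|B| + L * ‖Y i s‖) :=
            Finset.single_le_sum (f := fun i => |B| + L * ‖Y i s‖)
              (fun i _ => by positivity) (Finset.mem_univ i)
        _ ≤ V := (le_abs_self _).trans (hV s hs)
    · rw [Real.norm_eq_abs, abs_mul, abs_of_nonneg hL]
      norm_num
  have hvm : Measurable v := by
    refine Measurable.prodMk (measurable_pi_lambda _ fun i => ?_) measurable_const
    exact hu.measurable.comp (measurable_id.prodMk (hY i).measurable)
  have hpv : ∀ s ∈ Icc 0 T, p s = p 0 + ∫ x in (0 : ℝ)..s, v x := by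
    intro s hs
    have hi : IntervalIntegrable v volume 0 s := by
      refine (intervalIntegrable_const (c := max V (2 * L))).mono_fun hvm.aestronglyMeasurable ?_
      refine (ae_restrict_mem measurableSet_uIoc).mono fun x hx => ?_
      rw [uIoc_of_le hs.1] at hx
      exact (hvV x ⟨hx.1.le, hx.2.trans hs.2⟩).trans (le_abs_self _)
    refine Prod.ext ?_ ?_
    · funext i
      have e := ((ContinuousLinearMap.proj (R := ℝ) (φ := fun _ : ι => Eucl d) i).comp
        (ContinuousLinearMap.fst ℝ (ι → Eucl d) ℝ)).intervalIntegral_comp_comm hi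
      simp only [Prod.fst_add, Pi.add_apply]
      change Y i s = Y i 0 + ((ContinuousLinearMap.proj (R := ℝ) (φ := fun _ : ι => Eucl d) i).comp
        (ContinuousLinearMap.fst ℝ (ι → Eucl d) ℝ)) (∫ x in (0 : ℝ)..s, v x)
      rw [← e]
      exact hode i s hs
    · have e := (ContinuousLinearMap.snd ℝ (ι → Eucl d) ℝ).intervalIntegral_comp_comm hi
      simp only [Prod.snd_add]
      change k + s * (-2 * L) = k + 0 * (-2 * L) +
        (ContinuousLinearMap.snd ℝ (ι → Eucl d) ℝ) (∫ x in (0 : ℝ)..s, v x)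
      rw [← e]
      simp only [hv, ContinuousLinearMap.coe_snd', intervalIntegral.integral_const, smul_eq_mul]
      ring
  obtain ⟨C, hC⟩ := hm.exists_increment_ge hu contDiff_ballBump (p := p) (v := v) (ρ := ρ' + 1)
    (R := (ρ' + 1) + 2 * Real.exp (ρ' + 1)) (V := max V (2 * L))
    (fun q hq x hx => ballBump_eq_zero_of_norm hq hx)
    (fun s hs => by rw [mem_ball_zero_iff]; linarith [hρ' s hs]) hvm (by positivity) hvV hpv
    (fun s _ x => fderiv_ballBump_nonneg fun i => hu.lipschitz s x (Y i s))
  have hmono := le_of_quadratic_decrease hC ht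
  have h0T : (0 : ℝ) ∈ Icc 0 T := left_mem_Icc.2 hT
  have hint : ∀ s ∈ Icc 0 T, Integrable (fun x => ballBump (p s, x)) (m s) := by
    intro s hs
    have := hm.isFiniteMeasureOnCompacts hs
    refine (contDiff_ballBump.continuous.comp
      (by fun_prop : Continuous fun x : Eucl d => (p s, x))).integrable_of_hasCompactSupport
      (hasCompactSupport_of_norm fun x hx => ballBump_eq_zero_of_norm (ρ := ρ' + 1) ?_ hx)
    rw [mem_ball_zero_iff]; linarith [hρ' s hs]
  have hfin : ∀ s ∈ Icc 0 T, ∀ r, m s (⋃ i, Metric.closedBall (Y i s) r) ≠ ⊤ := by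
    intro s hs r
    have := hm.isFiniteMeasureOnCompacts hs
    exact (isCompact_iUnion fun i => isCompact_closedBall _ _).measure_lt_top.ne
  have hmeas : ∀ s r, MeasurableSet (⋃ i, Metric.closedBall (Y i s) r) := fun s r =>
    MeasurableSet.iUnion fun i => measurableSet_closedBall
  have hlow : (m 0).real (⋃ i, Metric.closedBall (Y i 0) ρ) ≤ ∫ x, ballBump (p 0, x) ∂(m 0) := by
    rw [← integral_indicator_one (hmeas 0 ρ)]
    refine integral_mono ((integrable_indicator_iff (hmeas 0 ρ)).2
      (integrableOn_const (hfin 0 h0T ρ))) (hint 0 h0T) fun x => ?_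
    by_cases hx : x ∈ ⋃ i, Metric.closedBall (Y i 0) ρ
    · rw [indicator_of_mem hx]
      obtain ⟨i, hi⟩ := mem_iUnion.1 hx
      rw [mem_closedBall_iff_norm] at hi
      refine (ballBump_eq_one i ?_).ge
      simp only [hp, hk, zero_mul, add_zero]
      rw [neg_mul, Real.exp_neg, two_mul, Real.exp_add, Real.exp_log hρ]
      have : ‖x - Y i 0‖ ^ 2 ≤ ρ ^ 2 := by gcongr
      rw [inv_mul_le_iff₀ (by positivity)]
      nlinarith
    · rw [indicator_of_notMem hx]
      exact Real.smoothTransition.nonneg _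
  have hup : ∫ x, ballBump (p t, x) ∂(m t) ≤
      (m t).real (⋃ i, Metric.closedBall (Y i t) (2 * ρ * Real.exp (L * t))) := by
    rw [← integral_indicator_one (hmeas t _)]
    refine integral_mono (hint t ht) ((integrable_indicator_iff (hmeas t _)).2
      (integrableOn_const (hfin t ht _))) fun x => ?_
    by_cases hx : x ∈ ⋃ i, Metric.closedBall (Y i t) (2 * ρ * Real.exp (L * t))
    · rw [indicator_of_mem hx]
      exact Real.smoothTransition.le_one _
    · rw [indicator_of_notMem hx]
      refine (ballBump_eq_zero fun i => ?_).le
      have h1 : 2 * ρ * Real.exp (L * t) ≤ ‖x - Y i t‖ := by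
        by_contra h
        exact hx (mem_iUnion.2 ⟨i, mem_closedBall_iff_norm.2 (not_le.1 h).le⟩)
      simp only [hp, hk]
      have h2 : Real.exp (-2 * Real.log ρ + t * (-2 * L)) = (ρ * Real.exp (L * t))⁻¹ ^ 2 := by
        rw [Real.exp_add, inv_pow, mul_pow, mul_inv, ← Real.exp_nat_mul, ← Real.exp_neg,
          neg_mul, Real.exp_neg (2 * Real.log ρ), two_mul (Real.log ρ), Real.exp_add,
          Real.exp_log hρ, pow_two]
        congr 2
        push_cast
        ring
      rw [h2]
      calc (2 : ℝ) ≤ ((ρ * Real.exp (L * t))⁻¹ * (2 * ρ * Real.exp (L * t))) ^ 2 := by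
            rw [mul_assoc 2, mul_left_comm, inv_mul_cancel₀ (by positivity)]
            norm_num
        _ ≤ _ := by
            rw [mul_pow]
            gcongr
  have hreal := hlow.trans (hmono.trans hup)
  exact (ENNReal.toReal_le_toReal (hfin 0 h0T _) (hfin t ht _)).1 hreal

/-- The mass of a set is not smaller than the initial mass of its preimage under the flow. For the
preimage replaced by a compact subset, cover the latter by small balls. -/
theorem IsWeakSolution.measure_preimage_le (hm : IsWeakSolution u m T) (hu : IsVelocity u L B)
    {Φ : ℝ → Eucl d → Eucl d} (hΦ : ∀ y, Continuous fun t => Φ t y)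
    (hode : ∀ y, ∀ t ∈ Icc 0 T, Φ t y = y + ∫ s in (0 : ℝ)..t, u s (Φ s y))
    {t : ℝ} (ht : t ∈ Icc 0 T) (hΦt : Continuous (Φ t)) {A : Set (Eucl d)} (hA : MeasurableSet A) :
    m 0 (Φ t ⁻¹' A) ≤ m t A := by
  have hT : 0 ≤ T := ht.1.trans ht.2
  have h0T : (0 : ℝ) ∈ Icc 0 T := left_mem_Icc.2 hT
  have := hm.isFiniteMeasureOnCompacts h0T
  have := hm.isFiniteMeasureOnCompacts ht
  have hΦ0 : ∀ y, Φ 0 y = y := fun y => by simpa using hode y 0 h0T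
  have hcompact : ∀ S : Set (Eucl d), IsCompact S → m 0 S ≤ m t (Φ t '' S) := by
    intro S hS
    have hS' : IsCompact (Φ t '' S) := hS.image hΦt
    have hlim := tendsto_measure_cthickening_of_isCompact (μ := m t) hS'
    have hlim2 : Tendsto (fun ρ : ℝ => 2 * ρ * Real.exp (L * t)) (𝓝[>] 0) (𝓝 0) := by
      have : Continuous fun ρ : ℝ => 2 * ρ * Real.exp (L * t) := by fun_prop
      have h := this.tendsto 0
      simp only [mul_zero, zero_mul] at h
      exact h.mono_left nhdsWithin_le_nhds
    refine ge_of_tendsto (hlim.comp hlim2) ?_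
    filter_upwards [self_mem_nhdsWithin] with ρ hρ
    rw [mem_Ioi] at hρ
    obtain ⟨c, hcS, hcf, hcov⟩ := hS.finite_cover_balls hρ
    have := hcf.fintype
    have key := hm.measure_iUnion_ball_le hu (ι := c) (Y := fun y s => Φ s y) (fun y => hΦ y)
      (fun y s hs => by rw [hΦ0]; exact hode y s hs) hρ ht
    refine (measure_mono ?_).trans (key.trans (measure_mono ?_))
    · refine hcov.trans fun x hx => ?_
      simp only [mem_iUnion] at hx ⊢
      obtain ⟨y, hy, hxy⟩ := hx
      refine ⟨⟨y, hy⟩, ?_⟩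
      rw [hΦ0]
      exact Metric.ball_subset_closedBall hxy
    · refine iUnion_subset fun y => ?_
      exact Metric.closedBall_subset_cthickening (mem_image_of_mem _ (hcS y.2)) _
  rw [(hΦt.measurable hA).measure_eq_iSup_isCompact]
  refine iSup₂_le fun S hSA => iSup_le fun hS => (hcompact S hS).trans (measure_mono ?_)
  exact image_subset_iff.2 hSA

end

/-! ### The kernel is divergence free in the sense of distributions -/

/-- Away from the origin, integration by parts reduces the weak divergence of the kernel to its
pointwise divergence. -/
theorem integral_fderiv_kernel_of_eq_zero {K : Eucl d → Eucl d} {α b Ck : ℝ} (hb : 0 ≤ b)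
    (hK : KernelCondition K α) (hKb : KernelBounds K b Ck) {ψ : Eucl d → ℝ}
    (hψ : ContDiff ℝ ∞ ψ) (hψc : HasCompactSupport ψ) {ε : ℝ} (hε : 0 < ε)
    (h0 : ∀ x, ‖x‖ < ε → ψ x = 0) : ∫ x, fderiv ℝ ψ x (K x) = 0 := by
  have hKm := hK.measurable
  have hCk := hKb.pos
  have hψ'c : Continuous (fderiv ℝ ψ) := hψ.continuous_fderiv (by simp)
  obtain ⟨R, hR⟩ := hψc.isCompact.isBounded.subset_closedBall 0
  have hout : ∀ x, R < ‖x‖ → ψ x = 0 := fun x hx => by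
    by_contra h
    have := hR (subset_tsupport _ h)
    rw [mem_closedBall_zero_iff] at this
    linarith
  have hts : ∀ x ∈ tsupport ψ, ε ≤ ‖x‖ := by
    have hcl : IsClosed {x : Eucl d | ε ≤ ‖x‖} := isClosed_le continuous_const continuous_norm
    intro x hx
    refine closure_minimal (fun y hy => ?_) hcl hx
    by_contra h
    exact hy (h0 y (not_le.1 h))
  have hts' : ∀ x, ¬ (ε ≤ ‖x‖ ∧ ‖x‖ ≤ R) → x ∉ tsupport ψ := fun x hx hx' =>
    hx ⟨hts x hx', by simpa using hR hx'⟩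
  have hψ0 : ∀ x, ¬ (ε ≤ ‖x‖ ∧ ‖x‖ ≤ R) → ψ x = 0 := fun x hx =>
    image_eq_zero_of_notMem_tsupport (hts' x hx)
  have hψ'0 : ∀ x, ¬ (ε ≤ ‖x‖ ∧ ‖x‖ ≤ R) → fderiv ℝ ψ x = 0 := fun x hx =>
    image_eq_zero_of_notMem_tsupport fun h => hts' x hx (tsupport_fderiv_subset ℝ h)
  obtain ⟨S, hS⟩ := hψ.continuous.bounded_above_of_compact_support hψc
  obtain ⟨S', hS'⟩ := hψ'c.bounded_above_of_compact_support (hψc.fderiv (𝕜 := ℝ))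
  have hS0 : 0 ≤ S := (norm_nonneg _).trans (hS 0)
  have hS'0 : 0 ≤ S' := (norm_nonneg _).trans (hS' 0)
  have hvol : (volume : Measure (Eucl d)) (Metric.closedBall 0 R) ≤
      ENNReal.ofReal ((volume : Measure (Eucl d)).real (Metric.closedBall 0 R)) := by
    rw [ofReal_measureReal measure_closedBall_lt_top.ne]
  set o := EuclideanSpace.basisFun (Fin d) ℝ
  have hne : ∀ x : Eucl d, ε ≤ ‖x‖ → x ≠ 0 := fun x hx => norm_pos_iff.1 (hε.trans_le hx)
  have hpow : ∀ x : Eucl d, ε ≤ ‖x‖ → ‖x‖ ^ (-b) ≤ ε ^ (-b) := fun x hx =>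
    Real.rpow_le_rpow_of_nonpos hε hx (neg_nonpos.2 hb)
  have hKx : ∀ x, ε ≤ ‖x‖ → ‖x‖ ≤ R → ‖K x‖ ≤ Ck * |R| * ε ^ (-b) := fun x hx hx' =>
    (hKb.size x (hne x hx)).trans (by
      have := hpow x hx
      have := hx'.trans (le_abs_self R)
      gcongr)
  have hKx' : ∀ x, ε ≤ ‖x‖ → ‖fderiv ℝ K x‖ ≤ Ck * ε ^ (-b) := fun x hx =>
    (hKb.deriv x (hne x hx)).trans (by have := hpow x hx; gcongr)
  have hinner : ∀ i (y : Eucl d), |inner ℝ (o i) y| ≤ ‖y‖ := fun i y => by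
    simpa using abs_real_inner_le_norm (o i) y
  -- integration by parts in each coordinate
  have hi1 : ∀ i, Integrable fun x => fderiv ℝ ψ x (o i) * inner ℝ (o i) (K x) := by
    intro i
    refine integrable_of_support (R := R) (c := S' * (Ck * |R| * ε ^ (-b))) hvol ?_ ?_ ?_
    · have h1 : Continuous fun x => fderiv ℝ ψ x (o i) := by fun_prop
      exact (h1.measurable.mul (measurable_const.inner hKm)).aestronglyMeasurable
    · intro x
      by_cases hx : ε ≤ ‖x‖ ∧ ‖x‖ ≤ R
      · rw [norm_mul]
        have h1 : ‖fderiv ℝ ψ x (o i)‖ ≤ S' := by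
          simpa using ContinuousLinearMap.le_of_opNorm_le _ (hS' x) (o i)
        have h2 : ‖inner ℝ (o i) (K x)‖ ≤ Ck * |R| * ε ^ (-b) :=
          (hinner i _).trans (hKx x hx.1 hx.2)
        gcongr
      · rw [hψ'0 x hx]
        simp only [zero_apply, zero_mul, norm_zero]
        positivity
    · intro x hx
      rw [hψ'0 x (fun h => not_lt.2 h.2 hx)]
      simp
  have hi2 : ∀ i, Integrable fun x => ψ x * inner ℝ (o i) (fderiv ℝ K x (o i)) := by
    intro i
    refine integrable_of_support (R := R) (c := S * (Ck * ε ^ (-b))) hvol ?_ ?_ ?_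
    · exact (hψ.continuous.measurable.mul
        (measurable_const.inner (measurable_fderiv_apply_const ℝ K (o i)))).aestronglyMeasurable
    · intro x
      by_cases hx : ε ≤ ‖x‖ ∧ ‖x‖ ≤ R
      · rw [norm_mul]
        have h2 : ‖inner ℝ (o i) (fderiv ℝ K x (o i))‖ ≤ Ck * ε ^ (-b) :=
          (hinner i _).trans (by
            simpa using ContinuousLinearMap.le_of_opNorm_le _ (hKx' x hx.1) (o i))
        gcongr
        exact hS x
      · rw [hψ0 x hx]
        simp only [zero_mul, norm_zero]
        positivity
    · intro x hx
      rw [hout x hx, zero_mul]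
  have hi3 : ∀ i, Integrable fun x => ψ x * inner ℝ (o i) (K x) := by
    intro i
    refine integrable_of_support (R := R) (c := S * (Ck * |R| * ε ^ (-b))) hvol ?_ ?_ ?_
    · exact (hψ.continuous.measurable.mul (measurable_const.inner hKm)).aestronglyMeasurable
    · intro x
      by_cases hx : ε ≤ ‖x‖ ∧ ‖x‖ ≤ R
      · rw [norm_mul]
        have h2 : ‖inner ℝ (o i) (K x)‖ ≤ Ck * |R| * ε ^ (-b) :=
          (hinner i _).trans (hKx x hx.1 hx.2)
        gcongr
        exact hS x
      · rw [hψ0 x hx]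
        simp only [zero_mul, norm_zero]
        positivity
    · intro x hx
      rw [hout x hx, zero_mul]
  have hibp : ∀ i, ∫ x, ψ x * inner ℝ (o i) (fderiv ℝ K x (o i)) =
      - ∫ x, fderiv ℝ ψ x (o i) * inner ℝ (o i) (K x) := by
    intro i
    exact integral_bilinear_hasFDerivAt_right_eq_neg_left_of_integrable (μ := volume)
      (f := ψ) (f' := fderiv ℝ ψ) (g := fun x => inner ℝ (o i) (K x))
      (g' := fun x => (innerSL ℝ (o i)).comp (fderiv ℝ K x)) (v := o i)
      (B := ContinuousLinearMap.mul ℝ ℝ) (hi1 i) (hi2 i) (hi3 i)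
      (fun x _ => ((hψ.differentiable (by simp)).differentiableAt).hasFDerivAt)
      (fun x hx => (innerSL ℝ (o i)).hasFDerivAt.comp x
        (hK.1 x (hne x (hts x hx))).hasFDerivAt)
  have hpt : ∀ x, fderiv ℝ ψ x (K x) = ∑ i, fderiv ℝ ψ x (o i) * inner ℝ (o i) (K x) := by
    intro x
    conv_lhs => rw [← o.sum_repr' (K x)]
    rw [map_sum]
    refine Finset.sum_congr rfl fun i _ => ?_
    rw [map_smul, smul_eq_mul, mul_comm]
  have htr : ∀ x, ∑ i, ψ x * inner ℝ (o i) (fderiv ℝ K x (o i)) = 0 := by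
    intro x
    by_cases hx : ε ≤ ‖x‖ ∧ ‖x‖ ≤ R
    · rw [← Finset.mul_sum]
      have := hK.2.1 x (hne x hx.1)
      rw [LinearMap.trace_eq_sum_inner _ o] at this
      simp only [ContinuousLinearMap.coe_coe] at this
      rw [this, mul_zero]
    · simp [hψ0 x hx]
  simp_rw [hpt]
  rw [integral_finsetSum _ fun i _ => hi1 i]
  have : ∀ i, ∫ x, fderiv ℝ ψ x (o i) * inner ℝ (o i) (K x) =
      -∫ x, ψ x * inner ℝ (o i) (fderiv ℝ K x (o i)) := fun i => by rw [hibp i, neg_neg]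
  simp_rw [this]
  rw [Finset.sum_neg_distrib, ← integral_finsetSum _ fun i _ => hi2 i]
  simp_rw [htr]
  simp

/-- The kernel is divergence free in the sense of distributions on the whole space: the flux
through small spheres around the origin tends to zero because `b < d`. -/
theorem integral_fderiv_kernel {K : Eucl d → Eucl d} {α b Ck : ℝ} (hb : 0 ≤ b) (hbd : b < d)
    (hK : KernelCondition K α) (hKb : KernelBounds K b Ck) {ψ : Eucl d → ℝ}
    (hψ : ContDiff ℝ ∞ ψ) (hψc : HasCompactSupport ψ) : ∫ x, fderiv ℝ ψ x (K x) = 0 := by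
  have hKm := hK.measurable
  have hCk := hKb.pos
  have hd' : (0 : ℝ) < d := hb.trans_lt hbd
  have hd0 : 0 < d := by exact_mod_cast hd'
  have := nontrivial_eucl hd0
  have hψ'c : Continuous (fderiv ℝ ψ) := hψ.continuous_fderiv (by simp)
  obtain ⟨R, hR⟩ := hψc.isCompact.isBounded.subset_closedBall 0
  have hout : ∀ x, R < ‖x‖ → ψ x = 0 := fun x hx => by
    by_contra h
    have := hR (subset_tsupport _ h)
    rw [mem_closedBall_zero_iff] at this
    linarith
  obtain ⟨S, hS⟩ := hψ.continuous.bounded_above_of_compact_support hψc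
  obtain ⟨S', hS'⟩ := hψ'c.bounded_above_of_compact_support (hψc.fderiv (𝕜 := ℝ))
  have hS0 : 0 ≤ S := (norm_nonneg _).trans (hS 0)
  have hS'0 : 0 ≤ S' := (norm_nonneg _).trans (hS' 0)
  -- a cutoff that vanishes on the unit ball and equals one outside the ball of radius two
  set χ : Eucl d → ℝ := fun y => Real.smoothTransition (‖y‖ ^ 2 - 1) with hχ
  have hχC : ContDiff ℝ ∞ χ := (Real.smoothTransition.contDiff (n := ⊤)).comp
    ((contDiff_norm_sq ℝ).sub contDiff_const)
  have hχ0 : ∀ y, ‖y‖ < 1 → χ y = 0 := fun y hy =>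
    Real.smoothTransition.zero_of_nonpos (by nlinarith [norm_nonneg y])
  have hχ1 : ∀ y, 3 / 2 < ‖y‖ → χ y = 1 := fun y hy =>
    Real.smoothTransition.one_of_one_le (by nlinarith [norm_nonneg y])
  have hχ' : ∀ y, 3 / 2 < ‖y‖ → fderiv ℝ χ y = 0 := by
    intro y hy
    have hev : χ =ᶠ[𝓝 y] fun _ => 1 := by
      filter_upwards [continuous_norm.continuousAt.eventually (lt_mem_nhds hy)] with z hz
        using hχ1 z hz
    rw [hev.fderiv_eq]
    simp
  obtain ⟨c, hc⟩ : ∃ c, ∀ y, ‖y‖ * ‖fderiv ℝ χ y‖ ≤ c := by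
    have h1 := hχC.continuous_fderiv (by simp)
    have h2 : Continuous fun y => ‖y‖ * ‖fderiv ℝ χ y‖ := by fun_prop
    obtain ⟨c, hc⟩ := h2.bounded_above_of_compact_support
      (hasCompactSupport_of_norm (R := 3 / 2) fun y hy => by rw [hχ' y hy, norm_zero, mul_zero])
    exact ⟨c, fun y => (le_abs_self _).trans (hc y)⟩
  have hc0 : 0 ≤ c := le_trans (by positivity) (hc 0)
  set f : ℕ → Eucl d → ℝ := fun n x => ψ x * χ (((n : ℝ) + 1) • x) with hf
  have hfC : ∀ n, ContDiff ℝ ∞ (f n) := fun n => hψ.mul (hχC.comp (contDiff_const_smul _))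
  have hfd : ∀ n x w, fderiv ℝ (f n) x w =
      ψ x * (((n : ℝ) + 1) * fderiv ℝ χ (((n : ℝ) + 1) • x) w) +
        χ (((n : ℝ) + 1) • x) * fderiv ℝ ψ x w := by
    intro n x w
    have e1 : HasFDerivAt (fun x : Eucl d => ((n : ℝ) + 1) • x)
        (((n : ℝ) + 1) • ContinuousLinearMap.id ℝ (Eucl d)) x :=
      (hasFDerivAt_id x).fun_const_smul _
    have e2 : HasFDerivAt (fun x => χ (((n : ℝ) + 1) • x)) _ x :=
      ((hχC.differentiable (by simp)).differentiableAt.hasFDerivAt).comp x e1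
    have e3 : HasFDerivAt ψ (fderiv ℝ ψ x) x :=
      (hψ.differentiable (by simp)).differentiableAt.hasFDerivAt
    have e4 : HasFDerivAt (f n) _ x := e3.mul e2
    rw [e4.fderiv]
    simp
  have hzero : ∀ n, ∫ x, fderiv ℝ (f n) x (K x) = 0 := by
    intro n
    have hn : (0 : ℝ) < n + 1 := by positivity
    refine integral_fderiv_kernel_of_eq_zero hb hK hKb (hfC n) (hψc.mul_right)
      (ε := 1 / ((n : ℝ) + 1)) (by positivity) fun x hx => ?_
    simp only [hf]
    rw [hχ0, mul_zero]
    rw [norm_smul, Real.norm_of_nonneg hn.le]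
    rwa [lt_div_iff₀ hn, mul_comm] at hx
  set g : Eucl d → ℝ := (Metric.ball (0 : Eucl d) (|R| + 1)).indicator
    fun x => (S * c + S' * |R|) * Ck * ‖x‖ ^ (-b) with hg
  have hgint : Integrable g := by
    rw [hg, integrable_indicator_iff measurableSet_ball]
    refine Integrable.const_mul ?_ _
    exact integrableOn_ball_of_norm_le_rpow (μ := (volume : Measure (Eucl d))) (C := 1)
      (f := fun z : Eucl d => ‖z‖ ^ (-b)) (α := b) (by simpa using Nat.succ_le_of_lt hd0)
      (by simpa using hbd)
      (ae_of_all _ fun z => by rw [one_mul, Real.norm_of_nonneg (by positivity)])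
      (by fun_prop : Measurable fun z : Eucl d => ‖z‖ ^ (-b)).aestronglyMeasurable
  have hae : ∀ᵐ x : Eucl d, x ≠ 0 := by
    rw [ae_iff]; simp
  have hbound : ∀ n, ∀ᵐ x, ‖fderiv ℝ (f n) x (K x)‖ ≤ g x := by
    intro n
    have hn : (0 : ℝ) < n + 1 := by positivity
    filter_upwards [hae] with x hx
    by_cases hxR : ‖x‖ ≤ R
    · have hxR' : ‖x‖ ≤ |R| := hxR.trans (le_abs_self R)
      have hmem : x ∈ Metric.ball (0 : Eucl d) (|R| + 1) := by
        rw [mem_ball_zero_iff]; linarith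
      rw [hg, indicator_of_mem hmem, hfd]
      have hKs := hKb.size x hx
      set y := ((n : ℝ) + 1) • x with hy
      have hyn : ‖y‖ = ((n : ℝ) + 1) * ‖x‖ := by rw [hy, norm_smul, Real.norm_of_nonneg hn.le]
      have t1 : ‖ψ x * (((n : ℝ) + 1) * fderiv ℝ χ y (K x))‖ ≤
          S * (c * (Ck * ‖x‖ ^ (-b))) := by
        rw [norm_mul]
        refine mul_le_mul (hS x) ?_ (norm_nonneg _) hS0
        rw [norm_mul, Real.norm_of_nonneg hn.le]
        calc ((n : ℝ) + 1) * ‖fderiv ℝ χ y (K x)‖ ≤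
            ((n : ℝ) + 1) * (‖fderiv ℝ χ y‖ * (Ck * ‖x‖ * ‖x‖ ^ (-b))) := by
              gcongr
              exact ContinuousLinearMap.le_opNorm_of_le _ hKs
          _ = (‖y‖ * ‖fderiv ℝ χ y‖) * (Ck * ‖x‖ ^ (-b)) := by rw [hyn]; ring
          _ ≤ c * (Ck * ‖x‖ ^ (-b)) := by gcongr; exact hc y
      have t2 : ‖χ y * fderiv ℝ ψ x (K x)‖ ≤ S' * (Ck * |R| * ‖x‖ ^ (-b)) := by
        rw [norm_mul]
        have h1 : ‖χ y‖ ≤ 1 := by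
          rw [Real.norm_of_nonneg (Real.smoothTransition.nonneg _)]
          exact Real.smoothTransition.le_one _
        have h2 : ‖fderiv ℝ ψ x (K x)‖ ≤ S' * (Ck * |R| * ‖x‖ ^ (-b)) :=
          ContinuousLinearMap.le_of_opNorm_le_of_le _ (hS' x) (hKs.trans (by gcongr))
        calc ‖χ y‖ * ‖fderiv ℝ ψ x (K x)‖ ≤ 1 * ‖fderiv ℝ ψ x (K x)‖ := by gcongr
          _ ≤ _ := by rwa [one_mul]
      calc _ ≤ _ := norm_add_le _ _
        _ ≤ _ := add_le_add t1 t2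
        _ = _ := by ring
    · have h1 : fderiv ℝ (f n) x = 0 :=
        fderiv_eq_zero_of_norm (R := R) (fun z hz => by simp only [hf, hout z hz, zero_mul])
          (not_le.1 hxR)
      rw [h1, zero_apply, norm_zero]
      exact indicator_nonneg (fun z _ => by positivity) x
  have hlim : ∀ᵐ x, Tendsto (fun n => fderiv ℝ (f n) x (K x)) atTop
      (𝓝 (fderiv ℝ ψ x (K x))) := by
    filter_upwards [hae] with x hx
    have hx' : 0 < ‖x‖ := norm_pos_iff.2 hx
    refine tendsto_const_nhds.congr' ?_
    obtain ⟨n₀, hn₀⟩ := exists_nat_gt (3 / 2 / ‖x‖)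
    filter_upwards [eventually_ge_atTop n₀] with n hn
    have hnn : (n₀ : ℝ) ≤ n := by exact_mod_cast hn
    have h1 : 3 / 2 < ‖((n : ℝ) + 1) • x‖ := by
      rw [norm_smul, Real.norm_of_nonneg (by positivity)]
      rw [div_lt_iff₀ hx'] at hn₀
      nlinarith
    rw [hfd, hχ' _ h1, hχ1 _ h1]
    simp
  have hmeas : ∀ n, AEStronglyMeasurable (fun x => fderiv ℝ (f n) x (K x)) := by
    intro n
    have h1 := (hfC n).continuous_fderiv (by simp)
    have hcc : Continuous fun z : Eucl d × Eucl d => fderiv ℝ (f n) z.1 z.2 := by fun_prop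
    exact (hcc.measurable.comp (measurable_id.prodMk hKm)).aestronglyMeasurable
  have hconv := tendsto_integral_of_dominated_convergence g hmeas hgint hbound hlim
  simp only [hzero] at hconv
  exact (tendsto_nhds_unique hconv tendsto_const_nhds)

/-! ### Lagrangian representation of the mean-field density -/

theorem lintegral_densityMeasure {f : Eucl d → ℝ} (hf : Measurable f) (g : Eucl d → ℝ≥0∞) :
    ∫⁻ x, g x ∂(densityMeasure f) = ∫⁻ x, ENNReal.ofReal (f x) * g x :=
  lintegral_withDensity_eq_lintegral_mul_non_measurable _ hf.ennreal_ofReal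
    (ae_of_all _ fun _ => ENNReal.ofReal_lt_top) g

theorem integral_densityMeasure {F : Type*} [NormedAddCommGroup F] [NormedSpace ℝ F]
    {f : Eucl d → ℝ} (hf : Measurable f) (hf0 : ∀ᵐ x, 0 ≤ f x) (g : Eucl d → F) :
    ∫ x, g x ∂(densityMeasure f) = ∫ x, f x • g x := by
  rw [densityMeasure, integral_withDensity_eq_integral_toReal_smul hf.ennreal_ofReal
    (ae_of_all _ fun _ => ENNReal.ofReal_lt_top)]
  refine integral_congr_ae ?_
  filter_upwards [hf0] with x hx
  rw [ENNReal.toReal_ofReal hx]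

theorem IsProbDensity.isProbabilityMeasure {f : Eucl d → ℝ} (hf : IsProbDensity f) :
    IsProbabilityMeasure (densityMeasure f) :=
  ⟨by rw [densityMeasure, withDensity_apply _ MeasurableSet.univ, Measure.restrict_univ, hf.mass]⟩

theorem densityMeasure_le {f : Eucl d → ℝ} {B : ℝ} (hB : ∀ᵐ x, f x ≤ B) :
    densityMeasure f ≤ ENNReal.ofReal B • volume := by
  rw [densityMeasure, ← withDensity_const]
  refine withDensity_mono ?_
  filter_upwards [hB] with x hx using ENNReal.ofReal_le_ofReal hx

/-- Convolution of the kernel with a probability measure of bounded density is Lipschitz. -/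
theorem norm_integral_kernel_sub_le {K : Eucl d → Eucl d} {b Ck C : ℝ}
    (hKb : KernelBounds K b Ck) (hC : 0 ≤ C) {μ : Measure (Eucl d)}
    (hμ : ∀ x, μ {x} = 0)
    (hpot : ∀ x, ∫⁻ z, ENNReal.ofReal (‖x - z‖ ^ (-b)) ∂μ ≤ ENNReal.ofReal C)
    (hint : ∀ x, Integrable (fun z => K (x - z)) μ) (x y : Eucl d) :
    ‖∫ z, K (x - z) ∂μ - ∫ z, K (y - z) ∂μ‖ ≤ 2 * Ck * C * ‖x - y‖ := by
  have hCk := hKb.pos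
  rw [← integral_sub (hint x) (hint y), ← ENNReal.ofReal_le_ofReal_iff (by positivity), ofReal_norm]
  refine (enorm_integral_le_lintegral_enorm _).trans ?_
  have hne : ∀ x, ∀ᵐ z ∂μ, z ≠ x := fun x => by
    rw [ae_iff]; simpa using hμ x
  calc ∫⁻ z, ‖K (x - z) - K (y - z)‖ₑ ∂μ ≤
      ∫⁻ z, ENNReal.ofReal (Ck * ‖x - y‖) *
        (ENNReal.ofReal (‖x - z‖ ^ (-b)) + ENNReal.ofReal (‖y - z‖ ^ (-b))) ∂μ := by
        refine lintegral_mono_ae ?_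
        filter_upwards [hne x, hne y] with z hzx hzy
        rw [← ofReal_norm, ← ENNReal.ofReal_add (by positivity) (by positivity),
          ← ENNReal.ofReal_mul (by positivity)]
        apply ENNReal.ofReal_le_ofReal
        have h1 := hKb.increment _ _ (sub_ne_zero.2 hzx.symm) (sub_ne_zero.2 hzy.symm)
        rwa [sub_sub_sub_cancel_right] at h1
    _ ≤ ENNReal.ofReal (Ck * ‖x - y‖) * (ENNReal.ofReal C + ENNReal.ofReal C) := by
        rw [lintegral_const_mul _ (by fun_prop), lintegral_add_left (by fun_prop)]
        gcongr
        · exact hpot x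
        · exact hpot y
    _ = _ := by
        rw [← ENNReal.ofReal_add hC hC, ← ENNReal.ofReal_mul (by positivity)]
        congr 1
        ring

section

variable {K : Eucl d → Eucl d} {α b Ck : ℝ} {φ : ℝ → Eucl d → Eucl d} {τ₀ : Eucl d → ℝ}
  {τ : ℝ → Eucl d → ℝ}

theorem IsTransportSolution.integrable_smul_kernel (hτ : IsTransportSolution K φ τ₀ τ)
    (hKm : Measurable K) {t : ℝ} (ht : 0 ≤ t) (x : Eucl d) :
    Integrable fun y => τ t y • K (x - y) := by
  obtain ⟨B, hB⟩ := hτ.conv_finite t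
  refine ⟨?_, (hB t ⟨ht, le_rfl⟩ x).trans_lt ENNReal.ofReal_lt_top⟩
  exact ((hτ.density t ht).measurable.smul
    (hKm.comp (measurable_const.sub measurable_id))).aestronglyMeasurable

theorem IsTransportSolution.kernelConv_eq (hτ : IsTransportSolution K φ τ₀ τ) {t : ℝ}
    (ht : 0 ≤ t) (x : Eucl d) :
    kernelConv K (τ t) x = ∫ z, K (x - z) ∂(densityMeasure (τ t)) :=
  (integral_densityMeasure (hτ.density t ht).measurable (hτ.density t ht).nonneg _).symm

theorem IsTransportSolution.integrable_kernel (hτ : IsTransportSolution K φ τ₀ τ)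
    (hKm : Measurable K) {t : ℝ} (ht : 0 ≤ t) (x : Eucl d) :
    Integrable (fun z => K (x - z)) (densityMeasure (τ t)) := by
  refine ⟨(hKm.comp (measurable_const.sub measurable_id)).aestronglyMeasurable, ?_⟩
  rw [HasFiniteIntegral, lintegral_densityMeasure (hτ.density t ht).measurable]
  refine lt_of_le_of_lt (lintegral_mono fun y => ?_) (hτ.integrable_smul_kernel hKm ht x).2
  rw [enorm_smul]
  gcongr
  rw [Real.enorm_eq_ofReal_abs]
  exact ENNReal.ofReal_le_ofReal (le_abs_self _)

theorem IsTransportSolution.kernelConv_lipschitz (hτ : IsTransportSolution K φ τ₀ τ)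
    (hb : 0 ≤ b) (hbd : b < d) (hKm : Measurable K) (hKb : KernelBounds K b Ck) (M : ℝ≥0) :
    ∃ L : ℝ, 0 ≤ L ∧ ∀ t, 0 ≤ t → densityMeasure (τ t) ≤ (M : ℝ≥0∞) • volume → ∀ x y,
      ‖kernelConv K (τ t) x - kernelConv K (τ t) y‖ ≤ L * ‖x - y‖ := by
  obtain ⟨C, hC, hpot⟩ := exists_potential_le hb hbd M
  have hd' : (0 : ℝ) < d := hb.trans_lt hbd
  have hd0 : 0 < d := by exact_mod_cast hd'
  have := nontrivial_eucl hd0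
  have hCk := hKb.pos
  refine ⟨2 * Ck * C, by positivity, fun t ht hM x y => ?_⟩
  have := (hτ.density t ht).isProbabilityMeasure
  rw [hτ.kernelConv_eq ht, hτ.kernelConv_eq ht]
  exact norm_integral_kernel_sub_le hKb hC.le
    (fun x => le_antisymm ((hM _).trans (by simp)) zero_le)
    (hpot _ hM (by simp)) (hτ.integrable_kernel hKm ht) x y

theorem IsTransportSolution.measurable_kernelConv (hτ : IsTransportSolution K φ τ₀ τ)
    (hKm : Measurable K) : Measurable fun p : ℝ × Eucl d => kernelConv K (τ p.1) p.2 := by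
  have h : StronglyMeasurable fun q : (ℝ × Eucl d) × Eucl d => τ q.1.1 q.2 • K (q.1.2 - q.2) := by
    have h1 : Measurable fun q : (ℝ × Eucl d) × Eucl d => τ q.1.1 q.2 :=
      hτ.measurable.comp ((measurable_fst.comp measurable_fst).prodMk measurable_snd)
    have h2 : Measurable fun q : (ℝ × Eucl d) × Eucl d => K (q.1.2 - q.2) :=
      hKm.comp ((measurable_snd.comp measurable_fst).sub measurable_snd)
    exact (h1.smul h2).stronglyMeasurable
  exact h.integral_prod_right'.measurable

/-- Fubini's theorem transfers the distributional divergence freeness from the kernel to the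
convolution. -/
theorem IsTransportSolution.integral_fderiv_kernelConv (hτ : IsTransportSolution K φ τ₀ τ)
    (hb : 0 ≤ b) (hbd : b < d) (hK : KernelCondition K α) (hKb : KernelBounds K b Ck) {t : ℝ}
    (ht : 0 ≤ t) {ψ : Eucl d → ℝ} (hψ : ContDiff ℝ ∞ ψ) (hψc : HasCompactSupport ψ) :
    Integrable (fun x => fderiv ℝ ψ x (kernelConv K (τ t) x)) ∧
      ∫ x, fderiv ℝ ψ x (kernelConv K (τ t) x) = 0 := by
  have hKm := hK.measurable
  have hψ'c : Continuous (fderiv ℝ ψ) := hψ.continuous_fderiv (by simp)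
  obtain ⟨B, hB⟩ := hτ.conv_finite t
  have hτm : Measurable (τ t) := (hτ.density t ht).measurable
  have hcc : Continuous fun z : Eucl d × Eucl d => fderiv ℝ ψ z.1 z.2 := by fun_prop
  have hm : AEStronglyMeasurable (Function.uncurry fun x y => fderiv ℝ ψ x (τ t y • K (x - y)))
      ((volume : Measure (Eucl d)).prod (volume : Measure (Eucl d))) := by
    have h1 : Measurable fun p : Eucl d × Eucl d => τ t p.2 • K (p.1 - p.2) :=
      (hτm.comp measurable_snd).smul (hKm.comp (measurable_fst.sub measurable_snd))
    have h2 : Measurable fun p : Eucl d × Eucl d => fderiv ℝ ψ p.1 (τ t p.2 • K (p.1 - p.2)) :=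
      hcc.measurable.comp (measurable_fst.prodMk h1)
    exact h2.aestronglyMeasurable
  have hint : Integrable (Function.uncurry fun x y => fderiv ℝ ψ x (τ t y • K (x - y)))
      ((volume : Measure (Eucl d)).prod (volume : Measure (Eucl d))) := by
    refine ⟨hm, ?_⟩
    rw [HasFiniteIntegral, lintegral_prod _ hm.enorm]
    have h1 : ∀ x, ∫⁻ y, ‖Function.uncurry (fun x y => fderiv ℝ ψ x (τ t y • K (x - y))) (x, y)‖ₑ ≤
        ENNReal.ofReal (‖fderiv ℝ ψ x‖ * (|B| * (1 + ‖x‖))) := by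
      intro x
      calc _ ≤ ∫⁻ y, ‖fderiv ℝ ψ x‖ₑ * ‖τ t y • K (x - y)‖ₑ :=
            lintegral_mono fun y => ContinuousLinearMap.le_opENorm _ _
        _ = ‖fderiv ℝ ψ x‖ₑ * ∫⁻ y, ‖τ t y • K (x - y)‖ₑ :=
            lintegral_const_mul' _ _ enorm_ne_top
        _ ≤ ‖fderiv ℝ ψ x‖ₑ * ENNReal.ofReal (|B| * (1 + ‖x‖)) := by
            gcongr
            refine (hB t ⟨ht, le_rfl⟩ x).trans (ENNReal.ofReal_le_ofReal ?_)
            gcongr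
            exact le_abs_self B
        _ = _ := by rw [ENNReal.ofReal_mul (norm_nonneg _), ofReal_norm]
    refine (lintegral_mono h1).trans_lt ?_
    have h2 : Continuous fun x => ‖fderiv ℝ ψ x‖ * (|B| * (1 + ‖x‖)) := by fun_prop
    exact (h2.integrable_of_hasCompactSupport ((hψc.fderiv (𝕜 := ℝ)).norm.mul_right)
      ).lintegral_lt_top
  have hcomm : ∀ x, fderiv ℝ ψ x (kernelConv K (τ t) x) =
      ∫ y, fderiv ℝ ψ x (τ t y • K (x - y)) := fun x =>
    (ContinuousLinearMap.integral_comp_comm _ (hτ.integrable_smul_kernel hKm ht x)).symm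
  simp only [hcomm]
  refine ⟨hint.integral_prod_left, ?_⟩
  rw [integral_integral_swap hint]
  have hin : ∀ y, ∫ x, fderiv ℝ ψ x (τ t y • K (x - y)) = 0 := by
    intro y
    simp only [map_smul]
    rw [integral_smul]
    have h1 : ∫ x, fderiv ℝ ψ x (K (x - y)) = ∫ z, fderiv ℝ (fun w => ψ (w + y)) z (K z) := by
      rw [← integral_add_right_eq_self (fun x => fderiv ℝ ψ x (K (x - y))) y]
      refine integral_congr_ae (ae_of_all _ fun z => ?_)
      simp only [add_sub_cancel_right]
      rw [fderiv_comp_add_right]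
    have h2 : ∫ z, fderiv ℝ (fun w => ψ (w + y)) z (K z) = 0 :=
      integral_fderiv_kernel hb hbd hK hKb (hψ.comp (contDiff_id.add contDiff_const))
        (hψc.comp_homeomorph (Homeomorph.addRight y))
    rw [h1, h2, smul_zero]
  simp only [hin, integral_zero]

theorem IsDrift.bound_nonneg {M : ℝ} (hφ : IsDrift φ M) : 0 ≤ M := by
  have : (volume.restrict (Ioi (0 : ℝ))) ≠ 0 := by
    simp [Measure.restrict_eq_zero]
  have : NeZero (volume.restrict (Ioi (0 : ℝ))) := ⟨this⟩
  obtain ⟨t, ht⟩ := hφ.bounded.exists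
  exact (norm_nonneg _).trans (ht 0)

/-- The weak solution at time zero is the initial datum. -/
theorem IsTransportSolution.ae_eq_initial (hτ : IsTransportSolution K φ τ₀ τ)
    (hτ₀ : IsProbDensity τ₀) : τ 0 =ᵐ[volume] τ₀ := by
  have hint : ∀ f : Eucl d → ℝ, IsProbDensity f → Integrable f := by
    intro f hf
    refine ⟨hf.measurable.aestronglyMeasurable, ?_⟩
    have : ∫⁻ x, ‖f x‖ₑ = 1 := by
      rw [← hf.mass]
      refine lintegral_congr_ae ?_
      filter_upwards [hf.nonneg] with x hx
      rw [Real.enorm_eq_ofReal hx]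
    rw [HasFiniteIntegral, this]
    exact ENNReal.one_lt_top
  refine ae_eq_of_integral_contDiff_smul_eq (hint _ (hτ.density 0 le_rfl)).locallyIntegrable
    (hint _ hτ₀).locallyIntegrable fun g hg hgc => ?_
  have := hτ.weak_eq g hg hgc 0 le_rfl
  simpa [mul_comm] using this

theorem IsTransportSolution.densityMeasure_initial_le (hτ : IsTransportSolution K φ τ₀ τ)
    (hτ₀ : IsProbDensity τ₀) {Mτ : ℝ} (hMτ : ∀ᵐ x, τ₀ x ≤ Mτ) :
    densityMeasure (τ 0) ≤ ENNReal.ofReal Mτ • volume := by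
  refine densityMeasure_le ?_
  filter_upwards [hτ.ae_eq_initial hτ₀, hMτ] with x hx hx'
  rwa [hx]

/-- Lagrangian representation of the weak solution: it is transported by the flow of its velocity
field, and since this flow does not increase volumes of preimages, the bound of the initial density
is preserved. Both facts follow from the comparison of masses with preimages under the flow, applied
to the solution and to Lebesgue measure, which is a weak solution for a divergence-free field. -/
theorem IsTransportSolution.exists_flow (hτ : IsTransportSolution K φ τ₀ τ)
    (hb : 0 ≤ b) (hbd : b < d) (hK : KernelCondition K α) (hKb : KernelBounds K b Ck)
    {Mφ Mτ : ℝ} (hφ : IsDrift φ Mφ) (hτ₀ : IsProbDensity τ₀) (hMτ : ∀ᵐ x, τ₀ x ≤ Mτ) {T : ℝ}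
    (hT : 0 ≤ T) :
    ∃ Φ : ℝ → Eucl d → Eucl d, (∀ y, Continuous fun t => Φ t y) ∧
      (∀ y, ∀ t ∈ Icc 0 T,
        IntervalIntegrable (fun s => kernelConv K (τ s) (Φ s y) + φ s (Φ s y)) volume 0 t ∧
        Φ t y = y + ∫ s in (0 : ℝ)..t, (kernelConv K (τ s) (Φ s y) + φ s (Φ s y))) ∧
      (∃ L : ℝ, ∀ t ∈ Icc 0 T, ∀ y y', ‖Φ t y - Φ t y'‖ ≤ L * ‖y - y'‖) ∧
      ∀ t ∈ Icc 0 T, (densityMeasure (τ 0)).map (Φ t) = densityMeasure (τ t) ∧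
        densityMeasure (τ t) ≤ ENNReal.ofReal Mτ • volume := by
  have hKm := hK.measurable
  have hMφ := hφ.bound_nonneg
  obtain ⟨B, hB⟩ := hτ.bounded T
  obtain ⟨Lk, hLk0, hLk⟩ := hτ.kernelConv_lipschitz hb hbd hKm hKb (Real.toNNReal B)
  obtain ⟨B', hB'⟩ := hτ.conv_finite T
  -- the times at which the drift is bounded, Lipschitz and divergence free
  have hgood := (hφ.bounded.and hφ.lipschitz).and hφ.div_free
  obtain ⟨Z, hZsub, hZm, hZ0⟩ := exists_measurable_superset_of_null (ae_iff.1 hgood)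
  set Gd : Set ℝ := Ioc 0 T \ Z with hGd
  have hGdm : MeasurableSet Gd := measurableSet_Ioc.diff hZm
  have hGdgood : ∀ t ∈ Gd, ((∀ x, ‖φ t x‖ ≤ Mφ) ∧ ∀ x y, ‖φ t x - φ t y‖ ≤ Mφ * ‖x - y‖) ∧
      ∀ ψ : Eucl d → ℝ, ContDiff ℝ ∞ ψ → HasCompactSupport ψ →
        ∫ x, fderiv ℝ ψ x (φ t x) = 0 := by
    intro t ht
    by_contra h
    exact ht.2 (hZsub h)
  have hGdT : ∀ t ∈ Gd, t ∈ Icc 0 T := fun t ht => ⟨ht.1.1.le, ht.1.2⟩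
  have hGdae : ∀ᵐ t, t ∈ Ioc 0 T → t ∈ Gd := by
    have h1 : ∀ᵐ t ∂(volume.restrict (Ioi (0 : ℝ))), t ∉ Z := by
      rw [ae_iff]; simpa using hZ0
    filter_upwards [(ae_restrict_iff' measurableSet_Ioi).1 h1] with t ht ht'
    exact ⟨ht', ht ht'.1⟩
  classical
  set u : ℝ → Eucl d → Eucl d := fun t x =>
    if t ∈ Gd then kernelConv K (τ t) x + φ t x else 0 with hu
  have hum : Measurable (Function.uncurry u) := by
    refine Measurable.ite (hGdm.preimage measurable_fst) ?_ measurable_const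
    exact (hτ.measurable_kernelConv hKm).add hφ.measurable
  have hvel : IsVelocity u (Lk + Mφ) (|B'| + Mφ) := by
    refine ⟨by positivity, hum, fun t x y => ?_, fun t => ?_⟩
    · by_cases ht : t ∈ Gd
      · simp only [hu, if_pos ht]
        have h1 := hLk t (hGdT t ht).1 (densityMeasure_le (hB t (hGdT t ht))) x y
        have h2 := (hGdgood t ht).1.2 x y
        calc _ = ‖(kernelConv K (τ t) x - kernelConv K (τ t) y) + (φ t x - φ t y)‖ := by
              congr 1; abel
          _ ≤ _ := norm_add_le _ _
          _ ≤ _ := by linarith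
      · simp only [hu, if_neg ht, sub_self, norm_zero]
        positivity
    · by_cases ht : t ∈ Gd
      · simp only [hu, if_pos ht]
        refine (norm_add_le _ _).trans (add_le_add ?_ ((hGdgood t ht).1.1 0))
        rw [← ENNReal.ofReal_le_ofReal_iff (by positivity), ofReal_norm]
        refine (enorm_integral_le_lintegral_enorm _).trans ((hB' t (hGdT t ht) 0).trans ?_)
        rw [norm_zero, add_zero, mul_one]
        exact ENNReal.ofReal_le_ofReal (le_abs_self B')
      · simp only [hu, if_neg ht, norm_zero]
        positivity
  have hsolτ : IsWeakSolution u (fun t => densityMeasure (τ t)) T := by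
    refine ⟨fun R => ⟨1, zero_le_one, fun t ht => ?_⟩, fun h hh => ?_, fun ψ hψ hψc t ht => ?_⟩
    · have := (hτ.density t ht.1).isProbabilityMeasure
      rw [ENNReal.ofReal_one]
      exact prob_le_one
    · have h1 : ∀ s, ∫ x, h s x ∂(densityMeasure (τ s)) =
          ∫ x, (ENNReal.ofReal (τ s x)).toReal • h s x := fun s =>
        integral_withDensity_eq_integral_toReal_smul
          (hτ.measurable.comp (measurable_const.prodMk measurable_id)).ennreal_ofReal
          (ae_of_all _ fun _ => ENNReal.ofReal_lt_top) _
      simp only [h1]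
      have h2 : StronglyMeasurable fun p : ℝ × Eucl d =>
          (ENNReal.ofReal (τ p.1 p.2)).toReal • h p.1 p.2 :=
        Measurable.stronglyMeasurable
          ((hτ.measurable.ennreal_ofReal.ennreal_toReal).smul hh)
      exact h2.integral_prod_right'.measurable
    · have hconv : ∀ t, 0 ≤ t → ∀ g : Eucl d → ℝ, ∫ x, g x ∂(densityMeasure (τ t)) =
          ∫ x, τ t x * g x := fun t ht g => by
        simpa using integral_densityMeasure (hτ.density t ht).measurable
          (hτ.density t ht).nonneg g
      have h0 := hτ.weak_eq ψ hψ hψc 0 le_rfl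
      rw [intervalIntegral.integral_same, add_zero] at h0
      rw [hconv t ht.1, hconv 0 le_rfl, hτ.weak_eq ψ hψ hψc t ht.1, h0]
      congr 1
      refine intervalIntegral.integral_congr_ae ?_
      filter_upwards [hGdae] with s hs hs'
      rw [uIoc_of_le ht.1] at hs'
      have hsG := hs ⟨hs'.1, hs'.2.trans ht.2⟩
      rw [hconv s hs'.1.le]
      simp only [hu, if_pos hsG]
  have hsolL : IsWeakSolution u (fun _ => (volume : Measure (Eucl d))) T := by
    refine ⟨fun R => ⟨volume.real (Metric.closedBall (0 : Eucl d) R), measureReal_nonneg,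
      fun t _ => ?_⟩, fun h hh => ?_,
      fun ψ hψ hψc t ht => ?_⟩
    · exact (ofReal_measureReal (μ := volume) (s := Metric.closedBall (0 : Eucl d) R)
        measure_closedBall_lt_top.ne).ge
    · exact hh.stronglyMeasurable.integral_prod_right.measurable
    · have hz : ∀ s, ∫ x, fderiv ℝ ψ x (u s x) = 0 := by
        intro s
        by_cases hs : s ∈ Gd
        · simp only [hu, if_pos hs, map_add]
          obtain ⟨h1, h2⟩ := hτ.integral_fderiv_kernelConv hb hbd hK hKb (hGdT s hs).1 hψ hψc
          have h3 := (hGdgood s hs).2 ψ hψ hψc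
          have h4 : Integrable fun x => fderiv ℝ ψ x (φ s x) := by
            have hψ'c : Continuous (fderiv ℝ ψ) := hψ.continuous_fderiv (by simp)
            have hcc : Continuous fun z : Eucl d × Eucl d => fderiv ℝ ψ z.1 z.2 := by fun_prop
            have hφs : Measurable (φ s) :=
              hφ.measurable.comp (measurable_const.prodMk measurable_id)
            refine Integrable.mono' (g := fun x => ‖fderiv ℝ ψ x‖ * Mφ) ?_
              (hcc.measurable.comp (measurable_id.prodMk hφs)).aestronglyMeasurable
              (ae_of_all _ fun x => ContinuousLinearMap.le_opNorm_of_le _ ((hGdgood s hs).1.1 x))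
            exact ((hψ'c.norm).integrable_of_hasCompactSupport
              ((hψc.fderiv (𝕜 := ℝ)).norm)).mul_const _
          rw [integral_add h1 h4, h2, h3, add_zero]
        · simp only [hu, if_neg hs, map_zero, integral_zero]
      simp only [hz, intervalIntegral.integral_zero, add_zero]
  obtain ⟨Φ, hΦc, hΦode, hΦL⟩ := hvel.exists_flow hT
  have hΦt : ∀ t ∈ Icc 0 T, Continuous (Φ t) := fun t ht =>
    (LipschitzWith.of_dist_le_mul (K := Real.toNNReal (Real.exp ((Lk + Mφ) * t))) fun y y' => by
      rw [dist_eq_norm, dist_eq_norm, Real.coe_toNNReal _ (Real.exp_pos _).le]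
      exact hΦL t ht y y').continuous
  refine ⟨Φ, hΦc, fun y t ht => ?_, ⟨Real.exp ((Lk + Mφ) * T), fun t ht y y' => ?_⟩,
    fun t ht => ?_⟩
  · have hcongr : ∀ᵐ s, s ∈ uIoc 0 t →
        u s (Φ s y) = kernelConv K (τ s) (Φ s y) + φ s (Φ s y) := by
      filter_upwards [hGdae] with s hs hs'
      rw [uIoc_of_le ht.1] at hs'
      have hsG := hs ⟨hs'.1, hs'.2.trans ht.2⟩
      simp only [hu, if_pos hsG]
    refine ⟨(hvel.intervalIntegrable (hΦc y) 0 t).congr_ae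
      ((ae_restrict_iff' measurableSet_uIoc).2 hcongr), ?_⟩
    rw [hΦode y t ht, intervalIntegral.integral_congr_ae hcongr]
  · refine (hΦL t ht y y').trans ?_
    gcongr
    exact ht.2
  · have hp0 := (hτ.density 0 le_rfl).isProbabilityMeasure
    have hpt := (hτ.density t ht.1).isProbabilityMeasure
    have hpm := Measure.isProbabilityMeasure_map (μ := densityMeasure (τ 0))
      (hΦt t ht).aemeasurable
    have hmap : (densityMeasure (τ 0)).map (Φ t) = densityMeasure (τ t) := by
      refine Measure.eq_of_le_of_isProbabilityMeasure (Measure.le_iff.2 fun A hA => ?_)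
      rw [Measure.map_apply (hΦt t ht).measurable hA]
      exact hsolτ.measure_preimage_le hvel hΦc hΦode ht (hΦt t ht) hA
    refine ⟨hmap, Measure.le_iff.2 fun A hA => ?_⟩
    have h0 := hτ.densityMeasure_initial_le hτ₀ hMτ
    rw [← hmap, Measure.map_apply (hΦt t ht).measurable hA]
    refine (h0 _).trans ?_
    rw [Measure.smul_apply, Measure.smul_apply, smul_eq_mul, smul_eq_mul]
    refine mul_le_mul' le_rfl ?_
    exact hsolL.measure_preimage_le hvel hΦc hΦode ht (hΦt t ht) hA

end

/-! ### Tools for the bootstrap argument -/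

/-- Continuous induction on an interval: `P` is the weak bound to be improved, `Q` the strong
one. -/
theorem forall_mem_Icc_of_bootstrap {T : ℝ} {P Q : ℝ → Prop}
    (hPQ : ∀ t ∈ Icc 0 T, (∀ s ∈ Ico 0 t, P s) → Q t)
    (hQP : ∀ t ∈ Icc 0 T, Q t → ∀ᶠ s in 𝓝[Icc 0 T] t, t ≤ s → P s) :
    ∀ t ∈ Icc 0 T, Q t := by
  intro t₀ ht₀
  have hT : 0 ≤ T := ht₀.1.trans ht₀.2
  set A : Set ℝ := {t | t ∈ Icc 0 T ∧ ∀ s ∈ Ico 0 t, P s} with hA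
  have h0A : (0 : ℝ) ∈ A := ⟨⟨le_rfl, hT⟩, fun s hs => absurd hs.2 hs.1.not_gt⟩
  have hAb : BddAbove A := ⟨T, fun t ht => ht.1.2⟩
  have hcA : sSup A ∈ A := by
    refine ⟨⟨le_csSup hAb h0A, csSup_le ⟨0, h0A⟩ fun t ht => ht.1.2⟩, fun s hs => ?_⟩
    obtain ⟨t, ht, hst⟩ := exists_lt_of_lt_csSup ⟨0, h0A⟩ hs.2
    exact ht.2 s ⟨hs.1, hst⟩
  set c := sSup A with hc
  have hcT : T ≤ c := by
    by_contra hlt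
    push Not at hlt
    obtain ⟨ε, hε, hball⟩ := Metric.mem_nhdsWithin_iff.1 (hQP c hcA.1 (hPQ c hcA.1 hcA.2))
    have hmem : min (c + ε) T ∈ A := by
      refine ⟨⟨le_min (by linarith [hcA.1.1]) hT, min_le_right _ _⟩, fun s hs => ?_⟩
      rcases lt_or_ge s c with hsc | hsc
      · exact hcA.2 s ⟨hs.1, hsc⟩
      · have h1 := hs.2.trans_le (min_le_left _ _)
        refine hball ⟨?_, hs.1, (hs.2.trans_le (min_le_right _ _)).le⟩ hsc
        rw [Metric.mem_ball, Real.dist_eq, abs_of_nonneg (by linarith)]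
        linarith
    have := le_csSup hAb hmem
    have h2 : c < min (c + ε) T := lt_min (by linarith) hlt
    linarith
  exact hPQ t₀ ht₀ fun s hs => hcA.2 s ⟨hs.1, hs.2.trans_le (ht₀.2.trans hcT)⟩

theorem continuousOn_iSup_of_compactSpace {ι : Type*} [TopologicalSpace ι] [CompactSpace ι]
    {f : ℝ → ι → ℝ} {T : ℝ} (hf : ContinuousOn (fun q : ℝ × ι => f q.1 q.2) (Icc 0 T ×ˢ univ)) :
    ContinuousOn (fun s => ⨆ p, f s p) (Icc 0 T) := by
  rcases lt_or_ge T 0 with hT | hT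
  · rw [Icc_eq_empty hT.not_ge]; exact continuousOn_empty _
  have hg : Continuous fun q : ℝ × ι => f (projIcc 0 T hT q.1) q.2 := by
    refine hf.comp_continuous (f := fun q : ℝ × ι => ((projIcc 0 T hT q.1 : ℝ), q.2)) ?_
      fun q => ⟨(projIcc 0 T hT q.1).2, mem_univ _⟩
    exact (continuous_subtype_val.comp (continuous_projIcc.comp continuous_fst)).prodMk
      continuous_snd
  have h := isCompact_univ.continuous_sSup (f := fun s p => f (projIcc 0 T hT s) p) hg
  refine h.continuousOn.congr fun s hs => ?_
  simp only [image_univ, projIcc_of_mem hT hs]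
  rfl

theorem le_iSup_of_compactSpace {ι : Type*} [TopologicalSpace ι] [CompactSpace ι]
    {f : ℝ → ι → ℝ} {A : Set ℝ} (hf : ContinuousOn (fun q : ℝ × ι => f q.1 q.2) (A ×ˢ univ))
    {s : ℝ} (hs : s ∈ A) (p : ι) : f s p ≤ ⨆ q, f s q := by
  have hc : Continuous fun q => f s q :=
    hf.comp_continuous (continuous_const.prodMk continuous_id) fun q => ⟨hs, mem_univ _⟩
  exact le_ciSup (isCompact_range hc).bddAbove p

/-- Grönwall's lemma for the largest of a compact family of trajectories. -/
theorem norm_le_of_velocity_le_iSup {ι : Type*} [TopologicalSpace ι] [CompactSpace ι]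
    {E : Type*} [NormedAddCommGroup E] [NormedSpace ℝ E] {Z z : ℝ → ι → E} {a L e t : ℝ}
    (hL : 0 ≤ L) (he : 0 ≤ e) (ht : 0 ≤ t)
    (hZ : ContinuousOn (fun q : ℝ × ι => Z q.1 q.2) (Icc 0 t ×ˢ univ))
    (h0 : ∀ p, ‖Z 0 p‖ ≤ a)
    (hode : ∀ p, ∀ s ∈ Icc 0 t, Z s p = Z 0 p + ∫ x in (0 : ℝ)..s, z x p)
    (hz : ∀ p, ∀ᵐ s, s ∈ Ioc 0 t → ‖z s p‖ ≤ L * (⨆ q, ‖Z s q‖) + e) (p : ι) :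
    ‖Z t p‖ ≤ (a + t * e) * Real.exp (L * t) := by
  have hr : ContinuousOn (fun s => ⨆ q, ‖Z s q‖) (Icc 0 t) :=
    continuousOn_iSup_of_compactSpace hZ.norm
  have hsup : ∀ s ∈ Icc 0 t, ∀ q, ‖Z s q‖ ≤ ⨆ q, ‖Z s q‖ := fun s hs =>
    le_iSup_of_compactSpace (f := fun s q => ‖Z s q‖) hZ.norm hs
  have : Nonempty ι := ⟨p⟩
  refine (hsup t (right_mem_Icc.2 ht) p).trans
    (le_mul_exp_of_le_add_integral hL ht hr fun s hs => ciSup_le fun q => ?_)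
  have hsub : Icc 0 s ⊆ Icc 0 t := Icc_subset_Icc_right hs.2
  have hri : IntervalIntegrable (fun s => ⨆ q, ‖Z s q‖) volume 0 s := by
    refine ContinuousOn.intervalIntegrable ?_
    rw [uIcc_of_le hs.1]; exact hr.mono hsub
  have h1 : ‖∫ x in (0 : ℝ)..s, z x q‖ ≤ ∫ x in (0 : ℝ)..s, (L * (⨆ q, ‖Z x q‖) + e) := by
    refine intervalIntegral.norm_integral_le_of_norm_le hs.1 ?_
      ((hri.const_mul L).add intervalIntegrable_const)
    filter_upwards [hz q] with x hx hx'
    exact hx ⟨hx'.1, hx'.2.trans hs.2⟩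
  rw [intervalIntegral.integral_add (hri.const_mul L) intervalIntegrable_const,
    intervalIntegral.integral_const_mul, intervalIntegral.integral_const, sub_zero,
    smul_eq_mul] at h1
  rw [hode q s hs]
  have h2 := mul_le_mul_of_nonneg_right hs.2 he
  linarith [norm_add_le (Z 0 q) (∫ x in (0 : ℝ)..s, z x q), h0 q]

theorem AtomCoupling.map {N : ℕ} {X X' : Fin N → Eucl d} {μ : Measure (Eucl d)} {r r' : ℝ}
    {ν : Fin N → Measure (Eucl d)} (h : AtomCoupling X μ r ν) {Φ : Eucl d → Eucl d}
    (hΦ : Measurable Φ) (hr : ∀ i y, ‖X i - y‖ ≤ r → ‖X' i - Φ y‖ ≤ r') :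
    AtomCoupling X' (μ.map Φ) r' fun i => (ν i).map Φ := by
  refine ⟨fun i => ?_, fun i => ?_, ?_⟩
  · rw [Measure.map_apply hΦ MeasurableSet.univ, preimage_univ, h.mass]
  · rw [ae_map_iff hΦ.aemeasurable (measurableSet_le (by fun_prop) measurable_const)]
    filter_upwards [h.near i] with y hy using hr i y hy
  · ext s hs
    rw [Measure.map_apply hΦ hs, ← h.sum]
    simp only [Measure.coe_finsetSum, Finset.sum_apply, Measure.map_apply hΦ hs]

theorem AtomCoupling.mono {N : ℕ} {X : Fin N → Eucl d} {μ : Measure (Eucl d)} {r r' : ℝ}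
    {ν : Fin N → Measure (Eucl d)} (h : AtomCoupling X μ r ν) (hr : r ≤ r') :
    AtomCoupling X μ r' ν :=
  ⟨h.mass, fun i => (h.near i).mono fun _ hy => hy.trans hr, h.sum⟩

theorem continuousOn_uncurry_of_lipschitz {Φ : ℝ → Eucl d → Eucl d} {T L : ℝ}
    (hΦ : ∀ y, Continuous fun t => Φ t y)
    (hL : ∀ t ∈ Icc 0 T, ∀ y y', ‖Φ t y - Φ t y'‖ ≤ L * ‖y - y'‖) :
    ContinuousOn (fun q : ℝ × Eucl d => Φ q.1 q.2) (Icc 0 T ×ˢ univ) := by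
  have h : ContinuousOn (fun q : Eucl d × ℝ => Φ q.2 q.1) (univ ×ˢ Icc 0 T) := by
    refine continuousOn_prod_of_continuousOn_lipschitzOnWith _ (Real.toNNReal |L|)
      (fun y _ => (hΦ y).continuousOn) fun t ht => ?_
    refine LipschitzOnWith.of_dist_le_mul fun y _ y' _ => ?_
    rw [dist_eq_norm, dist_eq_norm, Real.coe_toNNReal _ (abs_nonneg L)]
    refine (hL t ht y y').trans ?_
    gcongr
    exact le_abs_self L
  exact h.comp continuous_swap.continuousOn fun q hq => ⟨hq.2, hq.1⟩

section

variable {N : ℕ} {K : Eucl d → Eucl d} {φ : ℝ → Eucl d → Eucl d} {E : Fin N → ℝ → Eucl d}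
  {X : ℝ → Fin N → Eucl d} {S : EReal} {α Mφ : ℝ}

theorem IsParticleSolution.continuousOn_Icc (hX : IsParticleSolution K φ E X S) {t : ℝ}
    (htS : (t : EReal) < S) (i : Fin N) : ContinuousOn (fun s => X s i) (Icc 0 t) :=
  (hX.continuous i).mono fun s hs =>
    ⟨hs.1, lt_of_le_of_lt (by exact_mod_cast hs.2) htS⟩

theorem IsParticleSolution.intervalIntegrable_velocity (hX : IsParticleSolution K φ E X S)
    (hK : KernelCondition K α) (hφ : IsDrift φ Mφ) {t : ℝ} (ht : 0 ≤ t) (htS : (t : EReal) < S)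
    (i : Fin N) :
    IntervalIntegrable (fun s => φ s (X s i) +
      (1 / (N : ℝ)) • (∑ j ∈ Finset.univ.erase i, K (X s i - X s j)) + E i s) volume 0 t := by
  refine (IntervalIntegrable.add ?_ ?_).add (hX.integrable_error i t ht htS)
  · have hXm : AEMeasurable (fun s => X s i) (volume.restrict (Ioc 0 t)) :=
      ((hX.continuousOn_Icc htS i).mono Ioc_subset_Icc_self).aemeasurable measurableSet_Ioc
    rw [intervalIntegrable_iff_integrableOn_Ioc_of_le ht]
    refine Integrable.mono' (g := fun _ => Mφ) (integrable_const _)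
      (hφ.measurable.comp_aemeasurable (aemeasurable_id.prodMk hXm)).aestronglyMeasurable ?_
    filter_upwards [ae_restrict_of_ae_restrict_of_subset Ioc_subset_Ioi_self hφ.bounded]
      with s hs using hs _
  · refine ContinuousOn.intervalIntegrable ?_
    rw [uIcc_of_le ht]
    have hsum : ContinuousOn (fun s => ∑ j ∈ Finset.univ.erase i, K (X s i - X s j))
        (Icc 0 t) := by
      refine continuousOn_finsetSum _ fun j hj s hs => ?_
      have hne : X s i - X s j ≠ 0 := by
        rw [sub_ne_zero]
        exact (hX.no_collision s hs.1 (lt_of_le_of_lt (by exact_mod_cast hs.2) htS)).ne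
          (Finset.ne_of_mem_erase hj).symm
      exact (hK.1 _ hne).continuousAt.comp_continuousWithinAt
        (f := fun s => X s i - X s j)
        ((hX.continuousOn_Icc htS i s hs).sub (hX.continuousOn_Icc htS j s hs))
    exact hsum.const_smul (1 / (N : ℝ))

end

/-- The particles at distance at least `δ / 2` from a particle are the other ones. -/
theorem filter_le_eq_erase {N : ℕ} {X : Fin N → Eucl d} {δ : ℝ} (hδ : 0 < δ)
    (hsep : ∀ i j, i ≠ j → δ ≤ dist (X i) (X j)) (i : Fin N) :
    (Finset.univ.filter fun j => δ / 2 ≤ ‖X i - X j‖) = Finset.univ.erase i := by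
  ext j
  simp only [Finset.mem_filter, Finset.mem_univ, true_and, Finset.mem_erase, and_true]
  constructor
  · rintro h rfl
    rw [sub_self, norm_zero] at h
    linarith
  · intro h
    rw [← dist_eq_norm]
    linarith [hsep i j h.symm]

/-- Two particles see nearly the same force: the difference is at most proportional to their
distance, by the bound on the discrete potential. -/
theorem norm_force_sub_le {N : ℕ} {K : Eucl d → Eucl d} {b Ck C : ℝ} (hKb : KernelBounds K b Ck)
    {X : Fin N → Eucl d} (hX : Function.Injective X)
    (hpot : ∀ i, (1 / (N : ℝ)) * ∑ j ∈ Finset.univ.erase i, ‖X i - X j‖ ^ (-b) ≤ C)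
    {i k : Fin N} (hik : i ≠ k) :
    ‖(1 / (N : ℝ)) • (∑ j ∈ Finset.univ.erase i, K (X i - X j)) -
      (1 / (N : ℝ)) • (∑ j ∈ Finset.univ.erase k, K (X k - X j))‖ ≤
      4 * Ck * C * ‖X i - X k‖ := by
  have hCk := hKb.pos
  have hki : k ∈ Finset.univ.erase i := Finset.mem_erase.2 ⟨hik.symm, Finset.mem_univ _⟩
  have hik' : i ∈ Finset.univ.erase k := Finset.mem_erase.2 ⟨hik, Finset.mem_univ _⟩
  have hsub : ∀ {p q : Fin N}, p ≠ q → X p - X q ≠ 0 := fun h => sub_ne_zero.2 (hX.ne h)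
  set D := ‖X i - X k‖ with hD
  set w : ℝ := 1 / (N : ℝ) with hw
  have hw0 : 0 ≤ w := by positivity
  set U := (Finset.univ.erase i).erase k with hU
  have hU' : (Finset.univ.erase k).erase i = U := Finset.erase_right_comm
  have h1 : ‖∑ j ∈ U, (K (X i - X j) - K (X k - X j))‖ ≤
      Ck * D * (∑ j ∈ U, ‖X i - X j‖ ^ (-b) + ∑ j ∈ U, ‖X k - X j‖ ^ (-b)) := by
    rw [← Finset.sum_add_distrib, Finset.mul_sum]
    refine norm_sum_le_of_le _ fun j hj => ?_
    have hjk : k ≠ j := (Finset.ne_of_mem_erase hj).symm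
    have hji : i ≠ j := (Finset.ne_of_mem_erase (Finset.mem_of_mem_erase hj)).symm
    have := hKb.increment _ _ (hsub hji) (hsub hjk)
    rwa [sub_sub_sub_cancel_right] at this
  have hDs : ‖X k - X i‖ = D := norm_sub_rev _ _
  have h2 := hKb.size _ (hsub hik)
  have h3 := hKb.size _ (hsub hik.symm)
  have h4 := hpot i
  have h5 := hpot k
  rw [← Finset.sum_erase_add _ _ hki] at h4 ⊢
  rw [← Finset.sum_erase_add _ _ hik', hU'] at h5 ⊢
  rw [hDs] at h3 h5
  rw [← hD] at h2 h4
  rw [← smul_sub, norm_smul, Real.norm_of_nonneg hw0]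
  have e1 : ∑ j ∈ U, K (X i - X j) + K (X i - X k) - (∑ j ∈ U, K (X k - X j) + K (X k - X i)) =
      ∑ j ∈ U, (K (X i - X j) - K (X k - X j)) + (K (X i - X k) - K (X k - X i)) := by
    rw [Finset.sum_sub_distrib]; abel
  rw [e1]
  set s1 := ∑ j ∈ U, ‖X i - X j‖ ^ (-b)
  set s2 := ∑ j ∈ U, ‖X k - X j‖ ^ (-b)
  set g := D ^ (-b)
  have h6 : ‖∑ j ∈ U, (K (X i - X j) - K (X k - X j)) + (K (X i - X k) - K (X k - X i))‖ ≤
      Ck * D * ((s1 + g) + (s2 + g)) := by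
    calc _ ≤ Ck * D * (s1 + s2) + (Ck * D * g + Ck * D * g) :=
          (norm_add_le _ _).trans
            (add_le_add h1 ((norm_sub_le _ _).trans (add_le_add h2 h3)))
      _ = _ := by ring
  have hD0 : 0 ≤ Ck * D := mul_nonneg hCk.le (norm_nonneg _)
  have hC : 0 ≤ C := le_trans (mul_nonneg hw0 (Finset.sum_nonneg fun j _ => by positivity)) (hpot i)
  calc _ ≤ w * (Ck * D * ((s1 + g) + (s2 + g))) := mul_le_mul_of_nonneg_left h6 hw0
    _ = Ck * D * (w * (s1 + g) + w * (s2 + g)) := by ring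
    _ ≤ Ck * D * (C + C) := mul_le_mul_of_nonneg_left (add_le_add h4 h5) hD0
    _ ≤ 4 * (Ck * D * C) := by linarith [mul_nonneg hD0 hC]
    _ = 4 * Ck * C * D := by ring

/-! ### Static bounds and separation of the particles -/

/-- `C` is a constant for the time-independent estimates behind the mean-field limit, for measures
of density at most `M`: the convolution with the kernel is Lipschitz, the typical distance
`N^(-1/d)` is bounded by the transport distance `r`, and for `δ`-separated particles the discrete
potential is bounded and the discrete field is within `C r` of the continuous one, up to the force
exerted by particles closer than `δ / 2`. -/
structure MeanFieldBounds (K : Eucl d → Eucl d) (b : ℝ) (M : ℝ≥0) (C : ℝ) : Prop where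
  pos : 0 < C
  lipschitz : ∀ μ : Measure (Eucl d), μ ≤ (M : ℝ≥0∞) • volume → μ univ ≤ 1 →
    (∀ x, Integrable (fun z => K (x - z)) μ) → ∀ x y,
    ‖∫ z, K (x - z) ∂μ - ∫ z, K (y - z) ∂μ‖ ≤ C * ‖x - y‖
  spacing : ∀ {N : ℕ} {X : Fin N → Eucl d} {μ : Measure (Eucl d)} {r : ℝ}
    {ν : Fin N → Measure (Eucl d)}, AtomCoupling X μ r ν → 0 < N → 0 ≤ r →
    μ ≤ (M : ℝ≥0∞) • volume → (N : ℝ) ^ (-(1 / (d : ℝ))) ≤ C * r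
  potential : ∀ {N : ℕ} {X : Fin N → Eucl d} {μ : Measure (Eucl d)} {r δ : ℝ}
    {ν : Fin N → Measure (Eucl d)}, AtomCoupling X μ r ν → 0 < N → 0 ≤ r → 0 < δ →
    μ ≤ (M : ℝ≥0∞) • volume → (∀ i j, i ≠ j → δ ≤ dist (X i) (X j)) →
    r ^ ((d : ℝ) - b) ≤ δ ^ b * (N : ℝ) ^ (b / d) → ∀ x,
    (1 / (N : ℝ)) * ∑ j with δ / 2 ≤ ‖x - X j‖, ‖x - X j‖ ^ (-b) ≤ C
  comparison : ∀ {N : ℕ} {X : Fin N → Eucl d} {μ : Measure (Eucl d)} {r δ : ℝ}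
    {ν : Fin N → Measure (Eucl d)}, AtomCoupling X μ r ν → 0 < N → 0 ≤ r → 0 < δ →
    μ ≤ (M : ℝ≥0∞) • volume → (∀ i j, i ≠ j → δ ≤ dist (X i) (X j)) →
    r ^ ((d : ℝ) - b) ≤ δ ^ b * (N : ℝ) ^ (b / d) → δ ≤ (N : ℝ) ^ (-(1 / (d : ℝ))) → ∀ x,
    ‖∫ z, K (x - z) ∂μ - (1 / (N : ℝ)) • ∑ j with δ / 2 ≤ ‖x - X j‖, K (x - X j)‖ ≤ C * r

theorem exists_meanFieldBounds {K : Eucl d → Eucl d} {b Ck : ℝ} (hb : 0 ≤ b) (hbd : b < d)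
    (hKb : KernelBounds K b Ck) (hKm : Measurable K) (M : ℝ≥0) :
    ∃ C, MeanFieldBounds K b M C := by
  obtain ⟨C₁, hC₁, h1⟩ := exists_potential_le hb hbd M
  obtain ⟨C₂, hC₂, h2⟩ := exists_discrete_potential_le hb hbd M
  obtain ⟨C₃, hC₃, h3⟩ := exists_kernel_comparison hb hbd M hKb hKm
  have hd0 : 0 < d := by exact_mod_cast hb.trans_lt hbd
  have := nontrivial_eucl hd0
  have hCk := hKb.pos
  have hw := unitBallVol_pos d
  set c : ℝ := (M * unitBallVol d) ^ (1 / (d : ℝ)) with hc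
  have hc0 : 0 ≤ c := by positivity
  have hl : 0 < 2 * Ck * C₁ := by positivity
  refine ⟨2 * Ck * C₁ + C₂ + C₃ + c, by positivity, fun μ hμ hμ1 hint x y => ?_,
    fun h hN hr hμ => ?_, fun h hN hr hδ hμ hsep hrδ x => ?_,
    fun h hN hr hδ hμ hsep hrδ hδN x => ?_⟩
  · refine (norm_integral_kernel_sub_le hKb hC₁.le
      (fun x => le_antisymm ((hμ _).trans (by simp)) zero_le) (h1 μ hμ hμ1) hint x y).trans ?_
    gcongr
    linarith
  · refine (h.rpow_le hd0 hN hr hμ).trans ?_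
    gcongr
    linarith
  · exact (h2 _ _ _ _ _ _ h hN hr hδ hμ hsep hrδ x).trans (by linarith)
  · refine (h3 _ _ _ _ _ _ h hN hr hδ hμ hsep hrδ hδN x).trans ?_
    gcongr
    linarith

section

variable {N : ℕ} {K : Eucl d → Eucl d} {φ : ℝ → Eucl d → Eucl d} {E : Fin N → ℝ → Eucl d}
  {X : ℝ → Fin N → Eucl d} {S : EReal} {τ₀ : Eucl d → ℝ} {τ : ℝ → Eucl d → ℝ}
  {α b Ck C Mφ Mτ : ℝ}

/-- If the particles have stayed separated, and the velocities of two particles are not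
torn apart by the errors, their distance shrinks at most exponentially. -/
theorem IsParticleSolution.mul_exp_neg_le_dist (hX : IsParticleSolution K φ E X S)
    (hK : KernelCondition K α) (hKb : KernelBounds K b Ck) (hφ : IsDrift φ Mφ) (hC : 0 ≤ C)
    {C₁ L t : ℝ} (ht : 0 ≤ t) (htS : (t : EReal) < S) (hL : Mφ + |C₁| + 4 * Ck * C ≤ L)
    {i k : Fin N} (hik : i ≠ k)
    (hpot : ∀ s ∈ Ico 0 t, ∀ i,
      (1 / (N : ℝ)) * ∑ j ∈ Finset.univ.erase i, ‖X s i - X s j‖ ^ (-b) ≤ C)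
    (hE : ∀ s ∈ Ico 0 t, ‖E i s - E k s‖ ≤ C₁ * ‖X s i - X s k‖) :
    dist (X 0 i) (X 0 k) * Real.exp (-L * t) ≤ dist (X t i) (X t k) := by
  have hCk := hKb.pos
  have hMφ := hφ.bound_nonneg
  have hL0 : 0 ≤ L := le_trans (by positivity) hL
  rw [dist_eq_norm, dist_eq_norm]
  have hi := hX.intervalIntegrable_velocity hK hφ ht htS
  refine mul_exp_neg_le_norm (Z := fun s => X s i - X s k) hL0 ht
    ((hX.continuousOn_Icc htS i).sub (hX.continuousOn_Icc htS k)) ((hi i).sub (hi k))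
    (fun s hs => ?_) ?_
  · have hsS : (s : EReal) < S := lt_of_le_of_lt (by exact_mod_cast hs.2) htS
    have hi := hX.intervalIntegrable_velocity hK hφ hs.1 hsS
    have h1 := hX.ode i s hs.1 hsS
    have h2 := hX.ode k s hs.1 hsS
    have h3 := intervalIntegral.integral_sub (hi i) (hi k)
    show X s i - X s k = _
    rw [h3, h1, h2]
    abel
  · have hlip : ∀ᵐ s ∂(volume.restrict (Ioc 0 t)), ∀ x y, ‖φ s x - φ s y‖ ≤ Mφ * ‖x - y‖ :=
      ae_restrict_of_ae_restrict_of_subset Ioc_subset_Ioi_self hφ.lipschitz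
    have hne : ∀ᵐ s ∂(volume.restrict (Ioc 0 t)), s ≠ t :=
      ae_restrict_of_ae (Measure.ae_ne volume t)
    filter_upwards [hlip, hne, ae_restrict_mem measurableSet_Ioc] with s h1 h2 h3
    have hs : s ∈ Ico 0 t := ⟨h3.1.le, lt_of_le_of_ne h3.2 h2⟩
    have hsS : (s : EReal) < S := lt_of_le_of_lt (by exact_mod_cast h3.2) htS
    have h4 := norm_force_sub_le hKb (hX.no_collision s hs.1 hsS) (hpot s hs) hik
    have h5 := h1 (X s i) (X s k)
    have h6 : ‖E i s - E k s‖ ≤ |C₁| * ‖X s i - X s k‖ :=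
      (hE s hs).trans (by gcongr; exact le_abs_self _)
    set Fi := (1 / (N : ℝ)) • (∑ j ∈ Finset.univ.erase i, K (X s i - X s j))
    set Fk := (1 / (N : ℝ)) • (∑ j ∈ Finset.univ.erase k, K (X s k - X s j))
    calc _ = ‖(φ s (X s i) - φ s (X s k)) + (Fi - Fk) + (E i s - E k s)‖ := by
          congr 1; abel
      _ ≤ ‖φ s (X s i) - φ s (X s k)‖ + ‖Fi - Fk‖ + ‖E i s - E k s‖ := norm_add₃_le
      _ ≤ Mφ * ‖X s i - X s k‖ + 4 * Ck * C * ‖X s i - X s k‖ + |C₁| * ‖X s i - X s k‖ := by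
          gcongr
      _ = (Mφ + |C₁| + 4 * Ck * C) * ‖X s i - X s k‖ := by ring
      _ ≤ L * ‖X s i - X s k‖ := by gcongr

end

/-! ### The bootstrap for a fixed number of particles -/

section

variable {N : ℕ} {K : Eucl d → Eucl d} {φ : ℝ → Eucl d → Eucl d} {E : Fin N → ℝ → Eucl d}
  {X : ℝ → Fin N → Eucl d} {S : EReal} {τ₀ : Eucl d → ℝ} {τ : ℝ → Eucl d → ℝ}
  {α b Ck C Mφ Mτ : ℝ}

theorem IsParticleSolution.continuousOn_sub_flow (hX : IsParticleSolution K φ E X S) {t : ℝ}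
    (htS : (t : EReal) < S) {Φ : ℝ → Eucl d → Eucl d}
    (hΦ : ContinuousOn (fun q : ℝ × Eucl d => Φ q.1 q.2) (Icc 0 t ×ˢ univ)) (r₀ : ℝ) :
    ContinuousOn (fun q : ℝ × (Fin N × Metric.closedBall (0 : Eucl d) r₀) =>
      X q.1 q.2.1 - Φ q.1 (X 0 q.2.1 + q.2.2)) (Icc 0 t ×ˢ univ) := by
  refine ContinuousOn.sub ?_ ?_
  · have h1 : ContinuousOn (fun q : ℝ × Fin N => X q.1 q.2) (Icc 0 t ×ˢ univ) := by
      refine continuousOn_prod_of_discrete_right.2 fun i => ?_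
      refine (hX.continuousOn_Icc htS i).mono fun s hs => hs.1
    exact h1.comp (f := fun q : ℝ × (Fin N × Metric.closedBall (0 : Eucl d) r₀) => (q.1, q.2.1))
      (by fun_prop) fun q hq => ⟨hq.1, mem_univ _⟩
  · have h2 : Continuous fun i : Fin N => X 0 i := continuous_of_discreteTopology
    refine hΦ.comp (f := fun q : ℝ × (Fin N × Metric.closedBall (0 : Eucl d) r₀) =>
      (q.1, X 0 q.2.1 + (q.2.2 : Eucl d))) (Continuous.continuousOn ?_)
      fun q hq => ⟨hq.1, mem_univ _⟩
    exact continuous_fst.prodMk ((h2.comp (continuous_fst.comp continuous_snd)).add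
      (continuous_subtype_val.comp (continuous_snd.comp continuous_snd)))

/-- Grönwall estimate for the distance of the particles from the trajectories of the mean-field
flow that start within `r₀` of them. -/
theorem IsParticleSolution.norm_sub_flow_le (hX : IsParticleSolution K φ E X S)
    (hK : KernelCondition K α) (hφ : IsDrift φ Mφ) (hC : 0 ≤ C)
    {r₀ e L t : ℝ} (he : 0 ≤ e) (ht : 0 ≤ t) (htS : (t : EReal) < S) (hL : Mφ + 2 * C ≤ L)
    {Φ : ℝ → Eucl d → Eucl d}
    (hΦc : ContinuousOn (fun q : ℝ × Eucl d => Φ q.1 q.2) (Icc 0 t ×ˢ univ))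
    (hΦ : ∀ y, ∀ s ∈ Icc 0 t,
      IntervalIntegrable (fun x => kernelConv K (τ x) (Φ x y) + φ x (Φ x y)) volume 0 s ∧
        Φ s y = y + ∫ x in (0 : ℝ)..s, (kernelConv K (τ x) (Φ x y) + φ x (Φ x y)))
    (hlip : ∀ s ∈ Icc 0 t, ∀ x y,
      ‖kernelConv K (τ s) x - kernelConv K (τ s) y‖ ≤ C * ‖x - y‖)
    (hcomp : ∀ s ∈ Ico 0 t, ∀ i, ‖kernelConv K (τ s) (X s i) -
      (1 / (N : ℝ)) • ∑ j ∈ Finset.univ.erase i, K (X s i - X s j)‖ ≤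
        C * ⨆ p : Fin N × Metric.closedBall (0 : Eucl d) r₀, ‖X s p.1 - Φ s (X 0 p.1 + p.2)‖)
    (hE : ∀ s ∈ Ico 0 t, ∀ i, ‖E i s‖ ≤ e)
    (p : Fin N × Metric.closedBall (0 : Eucl d) r₀) :
    ‖X t p.1 - Φ t (X 0 p.1 + p.2)‖ ≤ (r₀ + t * e) * Real.exp (L * t) := by
  have hMφ := hφ.bound_nonneg
  have hL0 : 0 ≤ L := le_trans (by positivity) hL
  have h00 : ∀ y, Φ 0 y = y := fun y => by
    simpa using (hΦ y 0 ⟨le_rfl, ht⟩).2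
  have hZ := hX.continuousOn_sub_flow htS hΦc r₀
  have hsup := fun s hs => le_iSup_of_compactSpace (s := s)
    (f := fun s (q : Fin N × Metric.closedBall (0 : Eucl d) r₀) =>
      ‖X s q.1 - Φ s (X 0 q.1 + q.2)‖) hZ.norm hs
  refine norm_le_of_velocity_le_iSup
    (Z := fun s (q : Fin N × Metric.closedBall (0 : Eucl d) r₀) => X s q.1 - Φ s (X 0 q.1 + q.2))
    (z := fun s q => (φ s (X s q.1) +
      (1 / (N : ℝ)) • (∑ j ∈ Finset.univ.erase q.1, K (X s q.1 - X s j)) + E q.1 s) -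
      (kernelConv K (τ s) (Φ s (X 0 q.1 + q.2)) + φ s (Φ s (X 0 q.1 + q.2))))
    hL0 he ht hZ (fun q => ?_) (fun q s hs => ?_) (fun q => ?_) p
  · rw [h00, sub_add_cancel_left, norm_neg]
    exact mem_closedBall_zero_iff.1 q.2.2
  · have hsS : (s : EReal) < S := lt_of_le_of_lt (by exact_mod_cast hs.2) htS
    obtain ⟨h1, h2⟩ := hΦ (X 0 q.1 + q.2) s hs
    rw [intervalIntegral.integral_sub (hX.intervalIntegrable_velocity hK hφ hs.1 hsS q.1) h1, h00]
    have h3 := hX.ode q.1 s hs.1 hsS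
    rw [h2, h3]
    abel
  · have hφl := (ae_restrict_iff' measurableSet_Ioi).1 hφ.lipschitz
    filter_upwards [hφl, Measure.ae_ne volume t] with s h1 h2 h3
    have hs : s ∈ Ico 0 t := ⟨h3.1.le, lt_of_le_of_ne h3.2 h2⟩
    have hs' : s ∈ Icc 0 t := ⟨hs.1, hs.2.le⟩
    have hZs := hsup s hs' q
    have h4 := hcomp s hs q.1
    set r := ⨆ q : Fin N × Metric.closedBall (0 : Eucl d) r₀, ‖X s q.1 - Φ s (X 0 q.1 + q.2)‖
    set Y := Φ s (X 0 q.1 + q.2)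
    set F := (1 / (N : ℝ)) • (∑ j ∈ Finset.univ.erase q.1, K (X s q.1 - X s j))
    have h5 := h1 h3.1 (X s q.1) Y
    have h6 := hlip s hs' (X s q.1) Y
    have h7 : ‖φ s (X s q.1) - φ s Y‖ ≤ Mφ * r := h5.trans (by gcongr)
    have h8 : ‖kernelConv K (τ s) (X s q.1) - kernelConv K (τ s) Y‖ ≤ C * r :=
      h6.trans (by gcongr)
    have hr0 : 0 ≤ r := (norm_nonneg _).trans hZs
    calc _ = ‖(φ s (X s q.1) - φ s Y) + (kernelConv K (τ s) (X s q.1) - kernelConv K (τ s) Y) -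
          (kernelConv K (τ s) (X s q.1) - F) + E q.1 s‖ := by congr 1; abel
      _ ≤ Mφ * r + C * r + C * r + e :=
          norm_add_le_of_le (norm_sub_le_of_le (norm_add_le_of_le h7 h8) h4) (hE s hs q.1)
      _ = (Mφ + 2 * C) * r + e := by ring
      _ ≤ L * r + e := by gcongr

/-- The bootstrap argument for a fixed number of particles. As long as the transport distance and
the minimal distance of the particles stay within twice the bounds in the conclusion, the
mean-field force and the particle forces are close and Lipschitz, and Grönwall's lemma restores the
bounds themselves. -/
theorem IsParticleSolution.exists_coupling_and_separation (hN : 0 < N)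
    (hX : IsParticleSolution K φ E X S) (hτ : IsTransportSolution K φ τ₀ τ)
    (hb : 0 ≤ b) (hbd : b < d) (hK : KernelCondition K α) (hKb : KernelBounds K b Ck)
    (hB : MeanFieldBounds K b (Real.toNNReal Mτ) C) (hφ : IsDrift φ Mφ)
    (hτ₀ : IsProbDensity τ₀) (hMτ : ∀ᵐ x, τ₀ x ≤ Mτ) {T : ℝ} (hT : 0 ≤ T)
    {e : ℝ → ℝ} (he0 : ∀ t, 0 ≤ e t) (he : MonotoneOn e (Ici 0))
    {r₀ D δ C₁ L : ℝ} (hr₀ : 0 < r₀) {ν : Fin N → Measure (Eucl d)}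
    (hν : AtomCoupling (X 0) (densityMeasure (τ 0)) r₀ ν) (hD : 0 < D)
    (hD' : ∀ i j, i ≠ j → D ≤ dist (X 0 i) (X 0 j)) (hδ : 0 < δ)
    (hδD : 2 * δ ≤ D * Real.exp (-L * T)) (hδN : δ ≤ (N : ℝ) ^ (-(1 / (d : ℝ))))
    (hR : (2 * (Real.exp (L * T) * (r₀ + e T))) ^ ((d : ℝ) - b) ≤ δ ^ b * (N : ℝ) ^ (b / d))
    (hL : Mφ + 2 * C + 1 ≤ L) (hL' : Mφ + |C₁| + 4 * Ck * C ≤ L)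
    (hE : ∀ t ∈ Icc 0 T, (t : EReal) < S →
      wInf (empirical (X t)) (densityMeasure (τ t)) ≤
        ENNReal.ofReal (2 * (Real.exp (L * t) * (r₀ + e t))) →
      (∀ i j, i ≠ j → D * Real.exp (-L * t) ≤ 2 * dist (X t i) (X t j)) →
      (∀ i, ‖E i t‖ ≤ e t) ∧ ∀ i j, i ≠ j → ‖E i t - E j t‖ ≤ C₁ * ‖X t i - X t j‖) :
    ∀ t ∈ Icc 0 T, (t : EReal) < S →
      densityMeasure (τ t) ≤ (Real.toNNReal Mτ : ℝ≥0∞) • volume ∧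
      (∃ ν, AtomCoupling (X t) (densityMeasure (τ t)) (Real.exp (L * t) * (r₀ + e t)) ν) ∧
      ∀ i j, i ≠ j → D * Real.exp (-L * t) ≤ dist (X t i) (X t j) := by
  obtain ⟨Φ, hΦc, hΦode, ⟨LΦ, hLΦ⟩, hΦμ⟩ := hτ.exists_flow hb hbd hK hKb hφ hτ₀ hMτ hT
  have hKm := hK.measurable
  have hMφ := hφ.bound_nonneg
  have hC := hB.pos
  have hL0 : 0 ≤ L := le_trans (by positivity) hL
  have hΦj := continuousOn_uncurry_of_lipschitz hΦc hLΦ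
  have hΦm : ∀ t ∈ Icc 0 T, Measurable (Φ t) := fun t ht =>
    (hΦj.comp_continuous (f := fun y => (t, y)) (by fun_prop)
      fun y => ⟨ht, mem_univ _⟩).measurable
  have hdb : 0 ≤ (d : ℝ) - b := by linarith
  -- the bound to be proved for the transport distance
  set β : ℝ → ℝ := fun t => Real.exp (L * t) * (r₀ + e t) with hβ
  have hβ0 : ∀ t, 0 < β t := fun t => mul_pos (Real.exp_pos _) (by linarith [he0 t])
  have hβm : ∀ s t, 0 ≤ s → s ≤ t → β s ≤ β t := fun s t hs hst => by
    have h1 := he (mem_Ici.2 hs) (mem_Ici.2 (hs.trans hst)) hst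
    have h2 : Real.exp (L * s) ≤ Real.exp (L * t) := by gcongr
    exact mul_le_mul h2 (by linarith) (by linarith [he0 s]) (Real.exp_pos _).le
  have hcoup : ∀ t ∈ Icc 0 T, ∀ r, (∀ p : Fin N × Metric.closedBall (0 : Eucl d) r₀,
      ‖X t p.1 - Φ t (X 0 p.1 + p.2)‖ ≤ r) →
      AtomCoupling (X t) (densityMeasure (τ t)) r fun i => (ν i).map (Φ t) := by
    intro t ht r hr
    rw [← (hΦμ t ht).1]
    refine hν.map (hΦm t ht) fun i y hy => ?_
    have := hr (i, ⟨y - X 0 i, by rwa [mem_closedBall_zero_iff, norm_sub_rev]⟩)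
    simpa using this
  intro t₁ ht₁ ht₁S
  suffices h : (∀ p : Fin N × Metric.closedBall (0 : Eucl d) r₀,
      ‖X t₁ p.1 - Φ t₁ (X 0 p.1 + p.2)‖ ≤ β t₁) ∧
      ∀ i j, i ≠ j → D * Real.exp (-L * t₁) ≤ dist (X t₁ i) (X t₁ j) from
    ⟨(hΦμ t₁ ht₁).2, ⟨_, hcoup t₁ ht₁ _ h.1⟩, h.2⟩
  have hsubT : Icc 0 t₁ ⊆ Icc 0 T := Icc_subset_Icc_right ht₁.2
  have hltS : ∀ s ∈ Icc 0 t₁, (s : EReal) < S := fun s hs =>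
    lt_of_le_of_lt (by exact_mod_cast hs.2) ht₁S
  have hZ := hX.continuousOn_sub_flow ht₁S (hΦj.mono (prod_mono hsubT le_rfl)) r₀
  have hsup := fun s hs => le_iSup_of_compactSpace (s := s)
    (f := fun s (q : Fin N × Metric.closedBall (0 : Eucl d) r₀) =>
      ‖X s q.1 - Φ s (X 0 q.1 + q.2)‖) hZ.norm hs
  have hne : Nonempty (Fin N × Metric.closedBall (0 : Eucl d) r₀) :=
    ⟨(⟨0, hN⟩, ⟨0, Metric.mem_closedBall_self hr₀.le⟩)⟩
  have hlip : ∀ s ∈ Icc 0 T, ∀ x y,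
      ‖kernelConv K (τ s) x - kernelConv K (τ s) y‖ ≤ C * ‖x - y‖ := fun s hs x y => by
    have := (hτ.density s hs.1).isProbabilityMeasure
    rw [hτ.kernelConv_eq hs.1, hτ.kernelConv_eq hs.1]
    exact hB.lipschitz _ (hΦμ s hs).2 prob_le_one (hτ.integrable_kernel hKm hs.1) x y
  refine forall_mem_Icc_of_bootstrap (T := t₁)
    (Q := fun t => (∀ p : Fin N × Metric.closedBall (0 : Eucl d) r₀,
      ‖X t p.1 - Φ t (X 0 p.1 + p.2)‖ ≤ β t) ∧
      ∀ i j, i ≠ j → D * Real.exp (-L * t) ≤ dist (X t i) (X t j))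
    (P := fun t => (∀ p : Fin N × Metric.closedBall (0 : Eucl d) r₀,
      ‖X t p.1 - Φ t (X 0 p.1 + p.2)‖ ≤ 2 * β t) ∧
      ∀ i j, i ≠ j → D * Real.exp (-L * t) ≤ 2 * dist (X t i) (X t j))
    (fun t ht hP => ?_) (fun t ht hQ => ?_) t₁ ⟨ht₁.1, le_rfl⟩
  · have hstat : ∀ s ∈ Ico 0 t,
        ((∀ i, (1 / (N : ℝ)) * ∑ j ∈ Finset.univ.erase i, ‖X s i - X s j‖ ^ (-b) ≤ C) ∧
        ∀ i, ‖kernelConv K (τ s) (X s i) -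
          (1 / (N : ℝ)) • ∑ j ∈ Finset.univ.erase i, K (X s i - X s j)‖ ≤ C *
            ⨆ p : Fin N × Metric.closedBall (0 : Eucl d) r₀, ‖X s p.1 - Φ s (X 0 p.1 + p.2)‖) ∧
        (∀ i, ‖E i s‖ ≤ e s) ∧ ∀ i j, i ≠ j → ‖E i s - E j s‖ ≤ C₁ * ‖X s i - X s j‖ := by
      intro s hs
      have hs₁ : s ∈ Icc 0 t₁ := ⟨hs.1, hs.2.le.trans ht.2⟩
      have hsT := hsubT hs₁
      obtain ⟨hP1, hP2⟩ := hP s hs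
      have hc := hcoup s hsT _ (hsup s hs₁)
      have hr2 := ciSup_le hP1
      have hr0 := (norm_nonneg _).trans (hsup s hs₁ hne.some)
      set r := ⨆ p : Fin N × Metric.closedBall (0 : Eucl d) r₀, ‖X s p.1 - Φ s (X 0 p.1 + p.2)‖
      have hsep : ∀ i j, i ≠ j → δ ≤ dist (X s i) (X s j) := fun i j hij => by
        have h1 : D * Real.exp (-L * T) ≤ D * Real.exp (-L * s) := by
          gcongr D * Real.exp ?_
          nlinarith [hsT.2]
        linarith [hP2 i j hij]
      have hrR : r ^ ((d : ℝ) - b) ≤ δ ^ b * (N : ℝ) ^ (b / d) := by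
        refine le_trans (Real.rpow_le_rpow hr0 ?_ hdb) hR
        linarith [hβm s T hsT.1 hsT.2]
      refine ⟨⟨fun i => ?_, fun i => ?_⟩, hE s hsT (hltS s hs₁)
        (hc.wInf_le.trans (ENNReal.ofReal_le_ofReal hr2)) hP2⟩
      · have := hB.potential hc hN hr0 hδ (hΦμ s hsT).2 hsep hrR (X s i)
        rwa [filter_le_eq_erase hδ hsep] at this
      · have := hB.comparison hc hN hr0 hδ (hΦμ s hsT).2 hsep hrR hδN (X s i)
        rwa [filter_le_eq_erase hδ hsep, ← hτ.kernelConv_eq hs.1] at this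
    have hsubt : Icc 0 t ⊆ Icc 0 T := (Icc_subset_Icc_right ht.2).trans hsubT
    refine ⟨fun p => ?_, fun i j hij => ?_⟩
    · have h1 := hX.norm_sub_flow_le (L := Mφ + 2 * C) hK hφ hC.le (he0 t) ht.1 (hltS t ht) le_rfl
        (hΦj.mono (prod_mono hsubt le_rfl)) (fun y s hs => hΦode y s (hsubt hs))
        (fun s hs => hlip s (hsubt hs)) (fun s hs => (hstat s hs).1.2)
        (fun s hs i => ((hstat s hs).2.1 i).trans (he hs.1 ht.1 hs.2.le)) p
      have h2 : t + 1 ≤ Real.exp t := Real.add_one_le_exp t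
      have h3 : Real.exp t * Real.exp ((Mφ + 2 * C) * t) ≤ Real.exp (L * t) := by
        rw [← Real.exp_add]
        gcongr
        nlinarith [ht.1]
      have h4 := he0 t
      calc _ ≤ (r₀ + t * e t) * Real.exp ((Mφ + 2 * C) * t) := h1
        _ ≤ ((t + 1) * (r₀ + e t)) * Real.exp ((Mφ + 2 * C) * t) := by
            gcongr
            nlinarith [ht.1, mul_nonneg ht.1 hr₀.le]
        _ ≤ (Real.exp t * (r₀ + e t)) * Real.exp ((Mφ + 2 * C) * t) := by gcongr
        _ = (Real.exp t * Real.exp ((Mφ + 2 * C) * t)) * (r₀ + e t) := by ring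
        _ ≤ _ := mul_le_mul_of_nonneg_right h3 (by linarith)
    · have h1 := hX.mul_exp_neg_le_dist hK hKb hφ hC.le ht.1 (hltS t ht) hL' hij
        (fun s hs => (hstat s hs).1.1) (fun s hs => (hstat s hs).2.2 i j hij)
      refine le_trans ?_ h1
      gcongr
      exact hD' i j hij
  · have hr : ∀ᶠ s in 𝓝[Icc 0 t₁] t, (⨆ p : Fin N × Metric.closedBall (0 : Eucl d) r₀,
        ‖X s p.1 - Φ s (X 0 p.1 + p.2)‖) < 2 * β t := by
      refine (continuousOn_iSup_of_compactSpace hZ.norm t ht).eventually_lt continuousWithinAt_const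
        ((ciSup_le hQ.1).trans_lt ?_)
      linarith [hβ0 t]
    have hsep : ∀ᶠ s in 𝓝[Icc 0 t₁] t, ∀ i j, i ≠ j →
        D * Real.exp (-L * t) < 2 * dist (X s i) (X s j) := by
      simp only [eventually_all]
      intro i j hij
      refine continuousWithinAt_const.eventually_lt (((hX.continuousOn_Icc ht₁S i t ht).dist
        (hX.continuousOn_Icc ht₁S j t ht)).const_mul 2) ?_
      have := hQ.2 i j hij
      have h0 : 0 < D * Real.exp (-L * t) := by positivity
      linarith
    filter_upwards [hr, hsep, self_mem_nhdsWithin] with s h1 h2 h3 hts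
    refine ⟨fun p => (hsup s h3 p).trans (h1.le.trans ?_),
      fun i j hij => le_trans ?_ (h2 i j hij).le⟩
    · linarith [hβm t s ht.1 hts]
    · gcongr D * Real.exp ?_
      nlinarith

end

/-! ### Estimates on the whole time interval -/

theorem dMin_le {N : ℕ} (X : Fin N → Eucl d) {i j : Fin N} (hij : i ≠ j) :
    dMin X ≤ dist (X i) (X j) :=
  ciInf_le (f := fun p : {p : Fin N × Fin N // p.1 ≠ p.2} => dist (X p.1.1) (X p.1.2))
    (Set.finite_range _).bddBelow ⟨(i, j), hij⟩

theorem nonempty_pairs {N : ℕ} (hN : 2 ≤ N) : Nonempty {p : Fin N × Fin N // p.1 ≠ p.2} :=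
  ⟨⟨(⟨0, by omega⟩, ⟨1, by omega⟩), by simp⟩⟩

theorem le_dMin {N : ℕ} (hN : 2 ≤ N) {X : Fin N → Eucl d} {c : ℝ}
    (h : ∀ i j, i ≠ j → c ≤ dist (X i) (X j)) : c ≤ dMin X :=
  have := nonempty_pairs hN
  le_ciInf fun p => h _ _ p.2

theorem dMin_pos {N : ℕ} (hN : 2 ≤ N) {X : Fin N → Eucl d} (hX : Function.Injective X) :
    0 < dMin X := by
  have := nonempty_pairs hN
  obtain ⟨p, hp⟩ := exists_eq_ciInf_of_finite
    (f := fun p : {p : Fin N × Fin N // p.1 ≠ p.2} => dist (X p.1.1) (X p.1.2))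
  rw [dMin, ← hp]
  exact dist_pos.2 (hX.ne p.2)

/-- At most one of `δ`-separated particles is closer to `x` than `δ / 2`; it is then the one that
realizes the distance of `x` to the particles. -/
theorem norm_sum_near_le {N : ℕ} {K : Eucl d → Eucl d} {α Ck : ℝ} (hCk : 0 ≤ Ck)
    (hK : ∀ x, x ≠ 0 → ‖K x‖ ≤ Ck / ‖x‖ ^ α) {X : Fin N → Eucl d} {δ : ℝ}
    (hsep : ∀ i j, i ≠ j → δ ≤ dist (X i) (X j)) {x : Eucl d} (hx : x ∉ range X) :
    ‖(1 / (N : ℝ)) • ∑ j with ¬ δ / 2 ≤ ‖x - X j‖, K (x - X j)‖ ≤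
      Ck / (N * Metric.infDist x (range X) ^ α) := by
  have hnn : 0 ≤ Ck / (N * Metric.infDist x (range X) ^ α) :=
    div_nonneg hCk (mul_nonneg (Nat.cast_nonneg _) (Real.rpow_nonneg Metric.infDist_nonneg _))
  rcases Finset.eq_empty_or_nonempty (Finset.univ.filter fun j => ¬ δ / 2 ≤ ‖x - X j‖)
    with h | ⟨k, hk⟩
  · rw [h, Finset.sum_empty, smul_zero, norm_zero]
    exact hnn
  · have hk' : dist x (X k) < δ / 2 := by
      rw [dist_eq_norm]; simpa using hk
    have hfar : ∀ j, j ≠ k → δ / 2 ≤ dist x (X j) := fun j hj => by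
      have h1 := hsep j k hj
      have h2 := dist_triangle_left (X j) (X k) x
      linarith
    have hone : (Finset.univ.filter fun j => ¬ δ / 2 ≤ ‖x - X j‖) = {k} := by
      refine Finset.eq_singleton_iff_unique_mem.2 ⟨hk, fun j hj => ?_⟩
      by_contra hjk
      have := hfar j hjk
      rw [dist_eq_norm] at this
      exact (Finset.mem_filter.1 hj).2 this
    have hinf : Metric.infDist x (range X) = ‖x - X k‖ := by
      rw [← dist_eq_norm]
      refine le_antisymm (Metric.infDist_le_dist_of_mem (mem_range_self k))
        ((Metric.le_infDist ⟨_, mem_range_self k⟩).2 ?_)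
      rintro _ ⟨j, rfl⟩
      by_cases hj : j = k
      · rw [hj]
      · exact hk'.le.trans (hfar j hj)
    have hxk : x - X k ≠ 0 := sub_ne_zero.2 fun h => hx ⟨k, h.symm⟩
    rw [hone, Finset.sum_singleton, norm_smul, hinf, Real.norm_of_nonneg (by positivity)]
    calc _ ≤ 1 / (N : ℝ) * (Ck / ‖x - X k‖ ^ α) := by
          gcongr
          exact hK _ hxk
      _ = _ := by rw [div_mul_div_comm, one_mul]

section

variable {N : ℕ} {K : Eucl d → Eucl d} {φ : ℝ → Eucl d → Eucl d} {E : Fin N → ℝ → Eucl d}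
  {X : ℝ → Fin N → Eucl d} {S : EReal} {τ₀ : Eucl d → ℝ} {τ : ℝ → Eucl d → ℝ}
  {α b Ck C Mφ Mτ : ℝ}

/-- The empirical measure has positive transport distance from a bounded density. -/
theorem MeanFieldBounds.etaDist_pos {M : ℝ≥0} (hB : MeanFieldBounds K b M C) (hN : 0 < N)
    {x : Fin N → Eucl d} (hx : Function.Injective x) {f : Eucl d → ℝ}
    (hf : densityMeasure f ≤ (M : ℝ≥0∞) • volume) : 0 < etaDist x f := by
  have hC := hB.pos
  have hN' : (0 : ℝ) < N := by exact_mod_cast hN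
  by_contra h
  have h0 : etaDist x f = 0 := by simpa using h
  set r : ℝ := (N : ℝ) ^ (-(1 / (d : ℝ))) / (2 * C) with hr
  have hp : 0 < (N : ℝ) ^ (-(1 / (d : ℝ))) := by positivity
  have hr0 : 0 < r := by positivity
  obtain ⟨ν, hν⟩ := exists_atomCoupling (r := r) hx
    (μ := densityMeasure f) (by rw [← etaDist, h0]; exact ENNReal.ofReal_pos.2 hr0)
  have := hB.spacing hν hN hr0.le hf
  have h2 : C * r = (N : ℝ) ^ (-(1 / (d : ℝ))) / 2 := by rw [hr]; field_simp
  linarith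

/-- The estimates for a fixed number of particles, under an explicit smallness condition in place of
the limit `N → ∞`. -/
theorem IsParticleSolution.mean_field_estimates (hN : 2 ≤ N)
    (hX : IsParticleSolution K φ E X S) (hτ : IsTransportSolution K φ τ₀ τ)
    (hb : 0 ≤ b) (hbd : b < d) (hK : KernelCondition K α) (hKb : KernelBounds K b Ck)
    (hKα : ∀ x, x ≠ 0 → ‖K x‖ ≤ Ck / ‖x‖ ^ α)
    (hB : MeanFieldBounds K b (Real.toNNReal Mτ) C) (hφ : IsDrift φ Mφ)
    (hτ₀ : IsProbDensity τ₀) (hMτ : ∀ᵐ x, τ₀ x ≤ Mτ) {T : ℝ} (hT : 0 ≤ T)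
    {e : ℝ → ℝ≥0} (he : MonotoneOn e (Ici 0)) {C₁ L C₂ : ℝ}
    (hη : etaDist (X 0) (τ 0) ≠ ⊤)
    (hR : (4 * Real.exp (L * T) * ((etaDist (X 0) (τ 0)).toReal + e T)) ^ ((d : ℝ) - b) ≤
      min (dMin (X 0) * Real.exp (-L * T) / 2) ((N : ℝ) ^ (-(1 / (d : ℝ)))) ^ b *
        (N : ℝ) ^ (b / d))
    (hL : Mφ + 2 * C + 1 ≤ L) (hL' : Mφ + |C₁| + 4 * Ck * C ≤ L)
    (hC₂ : L ≤ C₂) (hC₂' : 2 * C ≤ C₂) (hC₂k : Ck ≤ C₂)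
    (hE : ∀ t ∈ Icc 0 T, (t : EReal) < S →
      etaDist (X t) (τ t) / (etaDist (X 0) (τ 0) + (e t : ℝ≥0∞)) +
        ENNReal.ofReal (dMin (X 0) / dMin (X t)) ≤ ENNReal.ofReal (6 * Real.exp (L * T)) →
      (∀ i, ‖E i t‖ ≤ e t) ∧ ∀ i j, i ≠ j → ‖E i t - E j t‖ / ‖X t i - X t j‖ ≤ C₁) :
    (T : EReal) < S ∧ ∀ t ∈ Icc 0 T,
      etaDist (X t) (τ t) ≤
        ENNReal.ofReal (Real.exp (C₂ * t)) * (etaDist (X 0) (τ 0) + (e t : ℝ≥0∞)) ∧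
      dMin (X 0) * Real.exp (-C₂ * t) ≤ dMin (X t) ∧
      ∀ x, x ∉ range (X t) →
        ‖kernelConv K (τ t) x - (1 / (N : ℝ)) • ∑ i, K (x - X t i)‖ₑ ≤
          ENNReal.ofReal (C₂ / (N * Metric.infDist x (range (X t)) ^ α)) +
          ENNReal.ofReal (C₂ * Real.exp (C₂ * t)) *
            (etaDist (X 0) (τ 0) + (e t : ℝ≥0∞)) := by
  have hN0 : 0 < N := by omega
  have hN' : (0 : ℝ) < N := by exact_mod_cast hN0
  have hinj := hX.no_collision 0 le_rfl hX.pos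
  have hMφ := hφ.bound_nonneg
  have hC := hB.pos
  have hL0 : 0 ≤ L := le_trans (by positivity) hL
  have hdb : 0 ≤ (d : ℝ) - b := by linarith
  set D := dMin (X 0) with hDdef
  have hD : 0 < D := dMin_pos hN hinj
  -- a separation that persists up to time `T`, even with a loss of a factor `2`
  set δ := min (D * Real.exp (-L * T) / 2) ((N : ℝ) ^ (-(1 / (d : ℝ)))) with hδdef
  have hδ : 0 < δ := lt_min (by positivity) (by positivity)
  have hδD : 2 * δ ≤ D * Real.exp (-L * T) := by
    linarith [min_le_left (D * Real.exp (-L * T) / 2) ((N : ℝ) ^ (-(1 / (d : ℝ))))]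
  have hη0 : 0 < (etaDist (X 0) (τ 0)).toReal := ENNReal.toReal_pos
    (hB.etaDist_pos hN0 hinj (hτ.densityMeasure_initial_le hτ₀ hMτ)).ne' hη
  set η := (etaDist (X 0) (τ 0)).toReal with hηdef
  have hηe : ∀ t, etaDist (X 0) (τ 0) + (e t : ℝ≥0∞) = ENNReal.ofReal (η + e t) := fun t => by
    rw [ENNReal.ofReal_add hη0.le (e t).coe_nonneg, ENNReal.ofReal_toReal hη,
      ENNReal.ofReal_coe_nnreal]
  have hexp : ∀ t ∈ Icc 0 T, Real.exp (L * t) ≤ Real.exp (L * T) := fun t ht => by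
    gcongr; exact ht.2
  have hexp' : ∀ t ∈ Icc 0 T, D * Real.exp (-L * T) ≤ D * Real.exp (-L * t) := fun t ht => by
    gcongr D * Real.exp ?_
    nlinarith [ht.2]
  have hRr : ∀ r ∈ Ioc η (2 * η),
      (2 * (Real.exp (L * T) * (r + e T))) ^ ((d : ℝ) - b) ≤ δ ^ b * (N : ℝ) ^ (b / d) := by
    intro r hr
    have h1 : 0 ≤ r + e T := by linarith [hr.1, (e T).coe_nonneg]
    refine le_trans (Real.rpow_le_rpow (by positivity) ?_ hdb) hR
    calc 2 * (Real.exp (L * T) * (r + e T)) ≤ 2 * (Real.exp (L * T) * (2 * (η + e T))) := by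
          gcongr
          linarith [hr.2, (e T).coe_nonneg]
      _ = _ := by ring
  -- a coupling of transport distance exactly `η` need not be available, only of each `r > η`
  have key : ∀ r ∈ Ioc η (2 * η), ∀ t ∈ Icc 0 T, (t : EReal) < S →
      densityMeasure (τ t) ≤ (Real.toNNReal Mτ : ℝ≥0∞) • volume ∧
      (∃ ν, AtomCoupling (X t) (densityMeasure (τ t)) (Real.exp (L * t) * (r + e t)) ν) ∧
      ∀ i j, i ≠ j → D * Real.exp (-L * t) ≤ dist (X t i) (X t j) := by
    intro r hr
    obtain ⟨ν, hν⟩ := exists_atomCoupling (r := r) hinj (μ := densityMeasure (τ 0))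
      (by rw [← etaDist]; exact (ENNReal.lt_ofReal_iff_toReal_lt hη).2 hr.1)
    refine hX.exists_coupling_and_separation (e := fun t => (e t : ℝ)) hN0 hτ hb hbd hK hKb hB hφ
      hτ₀ hMτ hT (fun t => (e t).coe_nonneg) (fun s hs t ht hst => by exact_mod_cast he hs ht hst)
      (hη0.trans hr.1) hν hD (fun i j hij => dMin_le _ hij) hδ hδD (min_le_right _ _) (hRr r hr)
      hL hL' fun t ht htS h1 h2 => ?_
    have hDt : D * Real.exp (-L * t) / 2 ≤ dMin (X t) :=
      le_dMin hN fun i j hij => by linarith [h2 i j hij]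
    have hinjt := hX.no_collision t ht.1 htS
    -- within the slack, the transport distance contributes at most `4 exp (L T)` and the minimal
    -- distance at most `2 exp (L T)` to the quantity that controls the errors
    obtain ⟨h3, h4⟩ := hE t ht htS (by
      rw [hηe]
      have he0 := (e t).coe_nonneg
      have h5 : etaDist (X t) (τ t) / ENNReal.ofReal (η + e t) ≤
          ENNReal.ofReal (4 * Real.exp (L * T)) := by
        refine ENNReal.div_le_of_le_mul (h1.trans ?_)
        rw [← ENNReal.ofReal_mul (by positivity)]
        apply ENNReal.ofReal_le_ofReal
        have h6 : r + e t ≤ 2 * (η + e t) := by linarith [hr.2]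
        have h7 := hexp t ht
        have h8 : 0 ≤ r + e t := by linarith [hr.1]
        calc 2 * (Real.exp (L * t) * (r + e t)) ≤ 2 * (Real.exp (L * T) * (2 * (η + e t))) := by
              gcongr
          _ = _ := by ring
      have h8 : ENNReal.ofReal (D / dMin (X t)) ≤ ENNReal.ofReal (2 * Real.exp (L * T)) := by
        apply ENNReal.ofReal_le_ofReal
        rw [div_le_iff₀ (dMin_pos hN hinjt)]
        have h9 := (hexp' t ht).trans (by linarith : _ ≤ 2 * dMin (X t))
        have h10 : Real.exp (L * T) * Real.exp (-L * T) = 1 := by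
          rw [← Real.exp_add]; simp
        calc D = Real.exp (L * T) * (D * Real.exp (-L * T)) := by
              linear_combination (-D) * h10
          _ ≤ Real.exp (L * T) * (2 * dMin (X t)) := by gcongr
          _ = _ := by ring
      refine (add_le_add h5 h8).trans ?_
      rw [← ENNReal.ofReal_add (by positivity) (by positivity)]
      apply ENNReal.ofReal_le_ofReal
      linarith)
    refine ⟨h3, fun i j hij => ?_⟩
    rw [← div_le_iff₀ (norm_pos_iff.2 (sub_ne_zero.2 (hinjt.ne hij)))]
    exact h4 i j hij
  have h2η : 2 * η ∈ Ioc η (2 * η) := ⟨by linarith, le_rfl⟩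
  -- the maximal solution cannot end before time `T`, since the particles stay separated
  have hTS : (T : EReal) < S := by
    by_contra hST
    push Not at hST
    rcases hX.maximal with h | h
    · rw [h, top_le_iff] at hST
      exact EReal.coe_ne_top T hST
    · obtain ⟨t, ht0, htS, ht⟩ := h (D * Real.exp (-L * T)) (by positivity)
      have htT : t ∈ Icc 0 T := ⟨ht0, by exact_mod_cast (htS.trans_le hST).le⟩
      have h1 := le_dMin hN (key _ h2η t htT htS).2.2
      linarith [hexp' t htT]
  refine ⟨hTS, fun t ht => ?_⟩
  have htS : (t : EReal) < S := lt_of_le_of_lt (by exact_mod_cast ht.2) hTS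
  have he0 := (e t).coe_nonneg
  have hexp₂ : Real.exp (L * t) ≤ Real.exp (C₂ * t) := by
    gcongr; exact ht.1
  refine ⟨?_, ?_, fun x hx => ?_⟩
  · -- let `r` decrease to `η`
    have h1 : etaDist (X t) (τ t) ≤ ENNReal.ofReal (Real.exp (L * t) * (η + e t)) := by
      have hcont : Tendsto (fun r : ℝ => ENNReal.ofReal (Real.exp (L * t) * (r + e t))) (𝓝[>] η)
          (𝓝 (ENNReal.ofReal (Real.exp (L * t) * (η + e t)))) := by
        refine Tendsto.mono_left ?_ nhdsWithin_le_nhds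
        exact (ENNReal.continuous_ofReal.comp (by fun_prop)).tendsto η
      refine ge_of_tendsto hcont ?_
      filter_upwards [Ioc_mem_nhdsGT h2η.1] with r hr
      obtain ⟨ν, hν⟩ := (key r hr t ht htS).2.1
      exact hν.wInf_le
    rw [hηe, ← ENNReal.ofReal_mul (by positivity)]
    exact h1.trans (ENNReal.ofReal_le_ofReal (by gcongr))
  · refine le_trans ?_ (le_dMin hN (key _ h2η t ht htS).2.2)
    gcongr D * Real.exp ?_
    nlinarith [ht.1]
  · obtain ⟨hμ, ⟨ν, hν⟩, hsep⟩ := key _ h2η t ht htS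
    have hsepδ : ∀ i j, i ≠ j → δ ≤ dist (X t i) (X t j) := fun i j hij => by
      linarith [hexp' t ht, hsep i j hij]
    have hr0 : 0 ≤ Real.exp (L * t) * (2 * η + e t) := by positivity
    have hrδ : (Real.exp (L * t) * (2 * η + e t)) ^ ((d : ℝ) - b) ≤
        δ ^ b * (N : ℝ) ^ (b / d) := by
      refine le_trans (Real.rpow_le_rpow hr0 ?_ hdb) (hRr _ h2η)
      have h1 : (e t : ℝ) ≤ e T := by exact_mod_cast he ht.1 (mem_Ici.2 hT) ht.2
      have h2 : Real.exp (L * t) * (2 * η + e t) ≤ Real.exp (L * T) * (2 * η + e T) := by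
        have := hexp t ht
        gcongr
      have h3 : 0 ≤ Real.exp (L * T) * (2 * η + e T) := by positivity
      linarith
    have hfar := hB.comparison hν hN0 hr0 hδ hμ hsepδ hrδ (min_le_right _ _) x
    rw [← hτ.kernelConv_eq ht.1] at hfar
    have hnear := norm_sum_near_le hKb.pos.le hKα hsepδ hx
    have hsum : ‖kernelConv K (τ t) x - (1 / (N : ℝ)) • ∑ i, K (x - X t i)‖ ≤
        Ck / (N * Metric.infDist x (range (X t)) ^ α) +
          C * (Real.exp (L * t) * (2 * η + e t)) := by
      rw [← Finset.sum_filter_add_sum_filter_not Finset.univ (fun j => δ / 2 ≤ ‖x - X t j‖),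
        smul_add, ← sub_sub]
      linarith [norm_sub_le (kernelConv K (τ t) x -
        (1 / (N : ℝ)) • ∑ j with δ / 2 ≤ ‖x - X t j‖, K (x - X t j))
        ((1 / (N : ℝ)) • ∑ j with ¬ δ / 2 ≤ ‖x - X t j‖, K (x - X t j))]
    have hC₂0 : 0 ≤ C₂ := by linarith
    have hinf : 0 ≤ (N : ℝ) * Metric.infDist x (range (X t)) ^ α :=
      mul_nonneg hN'.le (Real.rpow_nonneg Metric.infDist_nonneg _)
    rw [hηe, ← ENNReal.ofReal_mul (by positivity), ← ENNReal.ofReal_add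
      (div_nonneg hC₂0 hinf) (by positivity), ← ofReal_norm]
    refine ENNReal.ofReal_le_ofReal (hsum.trans (add_le_add ?_ ?_))
    · exact div_le_div_of_nonneg_right hC₂k hinf
    · calc C * (Real.exp (L * t) * (2 * η + e t)) ≤
            C * (Real.exp (C₂ * t) * (2 * (η + e t))) := by
            gcongr
            linarith
        _ = 2 * C * (Real.exp (C₂ * t) * (η + e t)) := by ring
        _ ≤ C₂ * (Real.exp (C₂ * t) * (η + e t)) := by gcongr
        _ = _ := by ring

end

/-- The limit assumptions imply the smallness condition for all large numbers of particles. -/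
theorem eventually_smallness {b κ c : ℝ} (hb : 0 ≤ b) (hbd : b < d) (hκ : 0 < κ)
    {η : ℕ → ℝ≥0∞} {e : ℕ → ℝ≥0} {D : ℕ → ℝ} (hD : ∀ N, 2 ≤ N → 0 < D N)
    (hQ : Tendsto (fun N : ℕ => (η N + (e N : ℝ≥0∞)) ^ ((d : ℝ) - b) /
      ENNReal.ofReal (D N ^ b * (N : ℝ) ^ (b / (d : ℝ)))) atTop (𝓝 0))
    (hc : ∀ᶠ N : ℕ in atTop, D N * (N : ℝ) ^ (1 / (d : ℝ)) ≤ c) :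
    ∀ᶠ N : ℕ in atTop, η N ≠ ⊤ ∧ (4 * κ * ((η N).toReal + e N)) ^ ((d : ℝ) - b) ≤
      min (D N * κ⁻¹ / 2) ((N : ℝ) ^ (-(1 / (d : ℝ)))) ^ b * (N : ℝ) ^ (b / d) := by
  have hd' : (0 : ℝ) < d := hb.trans_lt hbd
  have hdb : 0 < (d : ℝ) - b := by linarith
  set c' := max c 1 with hc'
  have hc'0 : 0 < c' := lt_max_of_lt_right one_pos
  -- the two entries of the minimum account for those of the minimum in the conclusion
  set θ : ℝ := ((4 * κ) ^ ((d : ℝ) - b))⁻¹ * min ((κ⁻¹ / 2) ^ b) (c' ^ b)⁻¹ with hθ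
  have hθ0 : 0 < θ := mul_pos (by positivity) (lt_min (by positivity) (by positivity))
  have h1 : ∀ᶠ N : ℕ in atTop, (η N + (e N : ℝ≥0∞)) ^ ((d : ℝ) - b) /
      ENNReal.ofReal (D N ^ b * (N : ℝ) ^ (b / (d : ℝ))) < ENNReal.ofReal θ :=
    (tendsto_order.1 hQ).2 _ (ENNReal.ofReal_pos.2 hθ0)
  filter_upwards [h1, hc, eventually_ge_atTop 2] with N h1 hcN hN
  have hDN := hD N hN
  have hN' : (0 : ℝ) < N := by exact_mod_cast (by omega : 0 < N)
  set B : ℝ := D N ^ b * (N : ℝ) ^ (b / (d : ℝ)) with hB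
  have hB0 : 0 < B := by positivity
  have h2 : (η N + (e N : ℝ≥0∞)) ^ ((d : ℝ) - b) ≤ ENNReal.ofReal (θ * B) := by
    rw [ENNReal.ofReal_mul hθ0.le]
    exact (ENNReal.div_le_iff (ENNReal.ofReal_pos.2 hB0).ne' ENNReal.ofReal_ne_top).1 h1.le
  have hη : η N ≠ ⊤ := by
    intro h
    rw [h, top_add, ENNReal.top_rpow_of_pos hdb] at h2
    exact ENNReal.ofReal_ne_top (top_le_iff.1 h2)
  refine ⟨hη, ?_⟩
  have h3 : ((η N).toReal + e N) ^ ((d : ℝ) - b) ≤ θ * B := by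
    have h4 : η N + (e N : ℝ≥0∞) = ENNReal.ofReal ((η N).toReal + e N) := by
      rw [ENNReal.ofReal_add ENNReal.toReal_nonneg (e N).coe_nonneg, ENNReal.ofReal_toReal hη,
        ENNReal.ofReal_coe_nnreal]
    rw [h4, ENNReal.ofReal_rpow_of_nonneg (by positivity) hdb.le] at h2
    exact (ENNReal.ofReal_le_ofReal_iff (by positivity)).1 h2
  have hp : 0 < (4 * κ) ^ ((d : ℝ) - b) := by positivity
  have h5 : (4 * κ * ((η N).toReal + e N)) ^ ((d : ℝ) - b) ≤
      min ((κ⁻¹ / 2) ^ b) (c' ^ b)⁻¹ * B := by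
    rw [Real.mul_rpow (by positivity) (by positivity)]
    calc _ ≤ (4 * κ) ^ ((d : ℝ) - b) * (θ * B) := by gcongr
      _ = _ := by rw [hθ]; field_simp
  have hBe : B = (D N * (N : ℝ) ^ (1 / (d : ℝ))) ^ b := by
    rw [hB, Real.mul_rpow hDN.le (by positivity), ← Real.rpow_mul hN'.le]
    congr 2; ring
  rcases min_choice (D N * κ⁻¹ / 2) ((N : ℝ) ^ (-(1 / (d : ℝ)))) with hm | hm
  · rw [hm]
    calc _ ≤ (κ⁻¹ / 2) ^ b * B := h5.trans (by gcongr; exact min_le_left _ _)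
      _ = _ := by
        rw [hB, mul_div_assoc, Real.mul_rpow hDN.le (by positivity)]; ring
  · rw [hm]
    calc _ ≤ (c' ^ b)⁻¹ * B := h5.trans (by gcongr; exact min_le_right _ _)
      _ ≤ (c' ^ b)⁻¹ * c' ^ b := by
        rw [hBe]
        gcongr
        exact hcN.trans (le_max_left _ _)
      _ = 1 := inv_mul_cancel₀ (by positivity)
      _ = _ := by
        rw [← Real.rpow_mul hN'.le, ← Real.rpow_add hN']
        rw [show -(1 / (d : ℝ)) * b + b / d = 0 by ring, Real.rpow_zero]

end MeanField

theorem theorem2p4 (d : ℕ) (α : ℝ) (hα : -1 ≤ α) (hαd : α < (d : ℝ) - 1)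
    (K : MeanField.Eucl d → MeanField.Eucl d) (hK : MeanField.KernelCondition K α)
    (C₁ Mτ Mφ : ℝ) :
    ∃ C₂ : ℝ, 0 < C₂ ∧
      ∀ (φ : ℕ → ℝ → MeanField.Eucl d → MeanField.Eucl d)
        (τ₀ : ℕ → MeanField.Eucl d → ℝ) (τ : ℕ → ℝ → MeanField.Eucl d → ℝ)
        (E : (N : ℕ) → Fin N → ℝ → MeanField.Eucl d)
        (X : (N : ℕ) → ℝ → Fin N → MeanField.Eucl d) (S : ℕ → EReal)
        (e : ℕ → ℝ → ℝ≥0),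
        (∀ N, MeanField.IsDrift (φ N) Mφ) →
        (∀ N, MeanField.IsProbDensity (τ₀ N)) →
        (∀ N, ∀ᵐ x, τ₀ N x ≤ Mτ) →
        (∀ N, MeanField.IsTransportSolution K (φ N) (τ₀ N) (τ N)) →
        (∀ N, MeanField.IsParticleSolution K (φ N) (E N) (X N) (S N)) →
        (∀ N, MonotoneOn (e N) (Ici 0)) →
        (∀ t : ℝ, 0 ≤ t → Tendsto (fun N : ℕ =>
          (MeanField.etaDist (X N 0) (τ N 0) + (e N t : ℝ≥0∞)) ^ ((d : ℝ) - (1 + α)) /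
            ENNReal.ofReal (MeanField.dMin (X N 0) ^ (1 + α) * (N : ℝ) ^ ((1 + α) / (d : ℝ))))
          atTop (𝓝 0)) →
        (∃ c : ℝ, ∀ᶠ N : ℕ in atTop,
          MeanField.dMin (X N 0) * (N : ℝ) ^ (1 / (d : ℝ)) ≤ c) →
        (∀ T : ℝ, 0 < T → ∀ lam : ℝ, 0 < lam → ∃ N₀ : ℕ, ∀ N > N₀, ∀ t ∈ Icc 0 T,
          (t : EReal) < S N →
          MeanField.etaDist (X N t) (τ N t) /
              (MeanField.etaDist (X N 0) (τ N 0) + (e N t : ℝ≥0∞)) +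
            ENNReal.ofReal (MeanField.dMin (X N 0) / MeanField.dMin (X N t))
              ≤ ENNReal.ofReal lam →
          (∀ i, ‖E N i t‖ ≤ e N t) ∧
            ∀ i j, i ≠ j → ‖E N i t - E N j t‖ / ‖X N t i - X N t j‖ ≤ C₁) →
        ∀ T : ℝ, 0 < T → ∃ N₁ : ℕ, ∀ N ≥ N₁,
          (T : EReal) < S N ∧
          ∀ t ∈ Icc 0 T,
            MeanField.etaDist (X N t) (τ N t) ≤
              ENNReal.ofReal (Real.exp (C₂ * t)) *
                (MeanField.etaDist (X N 0) (τ N 0) + (e N t : ℝ≥0∞)) ∧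
            MeanField.dMin (X N 0) * Real.exp (-C₂ * t) ≤ MeanField.dMin (X N t) ∧
            ∀ x, x ∉ range (X N t) →
              ‖MeanField.kernelConv K (τ N t) x - (1 / (N : ℝ)) • ∑ i, K (x - X N t i)‖ₑ ≤
                ENNReal.ofReal (C₂ / (N * Metric.infDist x (range (X N t)) ^ α)) +
                ENNReal.ofReal (C₂ * Real.exp (C₂ * t)) *
                  (MeanField.etaDist (X N 0) (τ N 0) + (e N t : ℝ≥0∞)) := by
  obtain ⟨Ck, hKb, hKα⟩ := hK.exists_kernelBounds hα
  have hb : 0 ≤ 1 + α := by linarith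
  have hbd : 1 + α < d := by linarith
  obtain ⟨C, hB⟩ := MeanField.exists_meanFieldBounds hb hbd hKb hK.measurable (Real.toNNReal Mτ)
  have hC := hB.pos
  have hCk := hKb.pos
  -- the exponential rate, large enough for both Grönwall estimates
  set L : ℝ := |Mφ| + 2 * C + 1 + |C₁| + 4 * Ck * C with hL
  have hp1 : 0 ≤ |Mφ| := abs_nonneg _
  have hp2 : 0 ≤ |C₁| := abs_nonneg _
  have hp3 : 0 < Ck * C := mul_pos hCk hC
  have hle := le_abs_self Mφ
  refine ⟨L + Ck, by linarith, ?_⟩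
  intro φ τ₀ τ E X S e hφ hτ₀ hMτ hτ hX he hQ hc hE T hT
  obtain ⟨c, hc⟩ := hc
  obtain ⟨N₀, hN₀⟩ := hE T hT (6 * Real.exp (L * T)) (by positivity)
  have hsmall := MeanField.eventually_smallness (κ := Real.exp (L * T)) hb hbd (Real.exp_pos _)
    (fun N hN => MeanField.dMin_pos hN ((hX N).no_collision 0 le_rfl (hX N).pos)) (hQ T hT.le) hc
  obtain ⟨N₁, hN₁⟩ := eventually_atTop.1
    ((hsmall.and (eventually_ge_atTop 2)).and (eventually_gt_atTop N₀))
  refine ⟨N₁, fun N hN => ?_⟩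
  obtain ⟨⟨⟨hη, hR⟩, hN2⟩, hNN₀⟩ := hN₁ N hN
  rw [← Real.exp_neg, ← neg_mul] at hR
  exact (hX N).mean_field_estimates hN2 (hτ N) hb hbd hK hKb hKα hB (hφ N) (hτ₀ N) (hMτ N) hT.le
    (he N) hη hR (by linarith) (by linarith) (by linarith) (by linarith) (by linarith)
    (hN₀ N hNN₀)
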